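/- Let $F$ be a nonarchimedean local field with ring of integers $\mathfrak o_F$ and maximal ideal $\mathfrak p_F$, let $D$ be a division algebra with centre $F$ and finite dimension over $F$, let $m\ge 1$, and put $G=\mathrm{GL}_m(D)$. Let $v$ be the valuation of $D$ that extends the valuation of $F$ with $v(F^\times)=\mathbb Z$, and let $\mathfrak o_D=\{a\in D: v(a)\ge 0\}$. Let $\pi$ be an irreducible smooth complex representation of $G$. **Normalized level.** For a hereditary $\mathfrak o_F$-order $\mathfrak A$ in $\mathrm M_m(D)$ with Jacobson radical $\mathfrak P$, let $e_F(\mathfrak A)\ge 1$ be the integer with $\mathfrak p_F\mathfrak A=\mathfrak P^{e_F(\mathfrak A)}$, and put $U^0(\mathfrak A)=\mathfrak A^\times$, $U^j(\mathfrak A)=1+\mathfrak P^j$ for $j\ge 1$. The normalized level of $\pi$ is $$d(\pi)=\min\{\,j/e_F(\mathfrak A)\,\},$$ where $(j,\mathfrak A)$ ranges over all pairs consisting of an integer $j\ge 0$ and a hereditary $\mathfrak o_F$-order $\mathfrak A$ in $\mathrm M_m(D)$ such that $\pi$ contains the trivial character of $U^{j+1}(\mathfrak A)$. **Moy--Prasad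 depth.** Let $\mathcal B(G)$ be the (reduced) Bruhat--Tits building of $G$, realized as the set of splittable norms on the right $D$-vector space $D^m$ up to homothety; its points are the translates $g\cdot c$ ($g\in G$) of the points $c\in\mathbb R^m$ of the standard apartment, where $c$ corresponds to the (additive) norm $(a_i)_i\mapsto\min_i(v(a_i)+c_i)$. For $r\in\mathbb R_{\ge 0}$ the Moy--Prasad group $P_{c,r}$ is the subgroup of $G$ generated by the diagonal matrices with entries $t_i\in\mathfrak o_D^\times$ satisfying $v(t_i-1)\ge r$ and by the elements $1+aE_{ij}$ with $i\neq j$, $a\in D$ and $v(a)+c_i-c_j\ge r$; moreover $P_{g\cdot c,r}=gP_{c,r}g^{-1}$, and $P_{x,r+}=\bigcup_{s>r}P_{x,s}$ for $x\in\mathcal B(G)$. The Moy--Prasad depth of $\pi$ is $$d_{\mathrm{MP}}(\pi)=\min\{\,r\in\mathbb R_{\ge 0} : \pi^{P_{x,r+}}\neq 0 \text{ for some } x\in\mathcal B(G)\,\}.$$ Then both minima exist, and $d(\pi)=d_{\mathrm{MP}}(\pi)$. -/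

import Mathlib

open ValuativeRel

namespace DepthGL

section HereditaryOrders

/-- A ring is hereditary if all its left ideals and all its right ideals are projective
(right ideals are treated as left ideals of the opposite ring). -/
def IsHereditaryRing (R : Type*) [Ring R] : Prop :=
  (∀ I : Ideal R, Module.Projective R I) ∧ ∀ I : Ideal Rᵐᵒᵖ, Module.Projective Rᵐᵒᵖ I

variable {F : Type*} [Field F] [ValuativeRel F]
variable {A : Type*} [Ring A] [Algebra F A]

/-- `𝔄` is a hereditary `𝔬_F`-order in the `F`-algebra `A`: a subring containing `𝔬_F` which is a
full `𝔬_F`-lattice in `A`, and which is hereditary as a ring. -/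
structure IsHereditaryOrder (𝔄 : Subalgebra 𝒪[F] A) : Prop where
  fg : (Subalgebra.toSubmodule 𝔄).FG
  span_eq_top : Submodule.span F (𝔄 : Set A) = ⊤
  hereditary : IsHereditaryRing 𝔄

/-- The Jacobson radical `𝔓` of `𝔄`, as an `𝔬_F`-submodule of the ambient algebra `A`. -/
noncomputable def radical (𝔄 : Subalgebra 𝒪[F] A) : Submodule 𝒪[F] A :=
  ((Ring.jacobson 𝔄).restrictScalars 𝒪[F]).map 𝔄.val.toLinearMap

/-- The integer `e = e_F(𝔄) ≥ 1` defined by `𝔭_F 𝔄 = 𝔓 ^ e`. -/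
noncomputable def ramificationIndex (𝔄 : Subalgebra 𝒪[F] A) : ℕ :=
  sInf {e : ℕ | 0 < e ∧ 𝓂[F] • Subalgebra.toSubmodule 𝔄 = radical 𝔄 ^ e}

theorem mem_radical {𝔄 : Subalgebra 𝒪[F] A} {x : A} :
    x ∈ radical 𝔄 ↔ ∃ h : x ∈ 𝔄, (⟨x, h⟩ : 𝔄) ∈ Ring.jacobson 𝔄 := by
  constructor
  · rintro ⟨y, hy, rfl⟩
    exact ⟨y.2, hy⟩
  · rintro ⟨h, hx⟩
    exact ⟨⟨x, h⟩, hx, rfl⟩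

theorem order_mul_radical_pow_le (𝔄 : Subalgebra 𝒪[F] A) (k : ℕ) :
    Subalgebra.toSubmodule 𝔄 * radical 𝔄 ^ (k + 1) ≤ radical 𝔄 ^ (k + 1) := by
  have h : Subalgebra.toSubmodule 𝔄 * radical 𝔄 ≤ radical 𝔄 := by
    rw [Submodule.mul_le]
    intro a ha x hx
    obtain ⟨hx', hx⟩ := mem_radical.1 hx
    exact mem_radical.2 ⟨𝔄.mul_mem ha hx', Ideal.mul_mem_left _ (⟨a, ha⟩ : 𝔄) hx⟩
  rw [pow_succ', ← mul_assoc]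
  exact mul_le_mul_left h _

theorem radical_pow_le_radical (𝔄 : Subalgebra 𝒪[F] A) (k : ℕ) :
    radical 𝔄 ^ (k + 1) ≤ radical 𝔄 := by
  induction k with
  | zero => simp
  | succ k ih =>
    rw [pow_succ']
    calc radical 𝔄 * radical 𝔄 ^ (k + 1)
        ≤ Subalgebra.toSubmodule 𝔄 * radical 𝔄 ^ (k + 1) :=
          mul_le_mul_left (fun x hx => (mem_radical.1 hx).1) _
      _ ≤ radical 𝔄 ^ (k + 1) := order_mul_radical_pow_le 𝔄 k
      _ ≤ radical 𝔄 := ih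

theorem inv_mem_of_sub_one_mem_radical {𝔄 : Subalgebra 𝒪[F] A} {g : Aˣ}
    (hg : (g : A) - 1 ∈ radical 𝔄) : (↑g⁻¹ : A) ∈ 𝔄 := by
  obtain ⟨h, hj⟩ := mem_radical.1 hg
  rw [← Ideal.jacobson_bot, Ideal.mem_jacobson_iff] at hj
  obtain ⟨z, hz⟩ := hj 1
  have h1 : (z : A) * 1 * ((g : A) - 1) + z - 1 = 0 :=
    congrArg (Subtype.val : 𝔄 → A) ((Submodule.mem_bot _).1 hz)
  have h2 : (z : A) * g = 1 := by
    have h3 : (z : A) * g - 1 = 0 := by rw [← h1]; noncomm_ring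
    exact sub_eq_zero.1 h3
  have h4 : (↑g⁻¹ : A) = z := by
    rw [← one_mul (↑g⁻¹ : A), ← h2, mul_assoc, Units.mul_inv, mul_one]
  rw [h4]
  exact z.2

/-- The filtration `U^0(𝔄) = 𝔄ˣ` and `U^j(𝔄) = 1 + 𝔓^j` for `j ≥ 1`, by subgroups of `Aˣ`. -/
def U (𝔄 : Subalgebra 𝒪[F] A) : ℕ → Subgroup Aˣ
  | 0 => 𝔄.toSubmonoid.units
  | k + 1 =>
    { carrier := {g | (g : A) - 1 ∈ radical 𝔄 ^ (k + 1)}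
      one_mem' := by simp
      mul_mem' := by
        intro g h hg hh
        have hg' : (g : A) ∈ 𝔄 := by
          have := 𝔄.add_mem (mem_radical.1 (radical_pow_le_radical 𝔄 k hg)).1 𝔄.one_mem
          simpa using this
        have h1 : (g : A) * ((h : A) - 1) ∈ radical 𝔄 ^ (k + 1) :=
          order_mul_radical_pow_le 𝔄 k (Submodule.mul_mem_mul hg' hh)
        have h2 := add_mem h1 hg
        have h3 : (g : A) * ((h : A) - 1) + ((g : A) - 1) = ((g * h : Aˣ) : A) - 1 := by
          rw [Units.val_mul]; noncomm_ring
        rw [h3] at h2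
        exact h2
      inv_mem' := by
        intro g hg
        have hg' : (↑g⁻¹ : A) ∈ 𝔄 :=
          inv_mem_of_sub_one_mem_radical (radical_pow_le_radical 𝔄 k hg)
        have h1 : (↑g⁻¹ : A) * ((g : A) - 1) ∈ radical 𝔄 ^ (k + 1) :=
          order_mul_radical_pow_le 𝔄 k (Submodule.mul_mem_mul hg' hg)
        have h2 := neg_mem h1
        rw [mul_sub, Units.inv_mul, mul_one, neg_sub] at h2
        exact h2 }

end HereditaryOrders

section Building

variable (F : Type*) [Field F] [ValuativeRel F] [TopologicalSpace F] [IsNonarchimedeanLocalField F]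
variable {D : Type*} [DivisionRing D] [Algebra F D] {m : ℕ}

open Classical in
/-- The valuation of the division algebra `D` that extends the valuation of `F` with
`v(Fˣ) = ℤ`. It is given by `v(a) = v(N_{D/F}(a)) / [D : F]` and `v(0) = ∞`, where `N_{D/F}(a)` is
the determinant over `F` of left multiplication by `a`. -/
noncomputable def ordD (a : D) : WithTop ℝ :=
  if a = 0 then ⊤ else
    ((-((IsNonarchimedeanLocalField.valueGroupWithZeroIsoInt F
        (valuation F (Algebra.norm F a))).log : ℝ) / (Module.finrank F D : ℝ) : ℝ) : WithTop ℝ)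

/-- The Moy--Prasad group `P_{c,r}` of `GL_m(D)` at the point `c` of the standard apartment `ℝ^m`.
It is generated by the diagonal matrices with entries `t_i` in `𝔬_Dˣ` such that `v(t_i - 1) ≥ r`
and by the subgroups of the root groups `1 + D E_{ij}` (`i ≠ j`) that correspond to the affine roots
with value at least `r` in `c`: the elements `1 + a E_{ij}` with `v(a) + c_i - c_j ≥ r`. -/
def standardMoyPrasad (c : Fin m → ℝ) (r : ℝ) : Subgroup (Matrix (Fin m) (Fin m) D)ˣ :=
  Subgroup.closure
    ({g | ∃ t : Fin m → D, (∀ i, ordD F (t i) = 0 ∧ (r : WithTop ℝ) ≤ ordD F (t i - 1)) ∧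
        (g : Matrix (Fin m) (Fin m) D) = Matrix.diagonal t} ∪
     {g | ∃ (i j : Fin m) (a : D), i ≠ j ∧
        (r : WithTop ℝ) ≤ ordD F a + ((c i - c j : ℝ) : WithTop ℝ) ∧
        (g : Matrix (Fin m) (Fin m) D) = 1 + Matrix.single i j a})

/-- The (additive) norm on `D^m` attached to `p = (g, c)`: with respect to the basis formed by the
columns `g e_1, …, g e_m` it sends `∑ g e_i a_i` to `min_i (v(a_i) + c_i)`. -/
noncomputable def splitNorm (p : (Matrix (Fin m) (Fin m) D)ˣ × (Fin m → ℝ)) (w : Fin m → D) :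
    WithTop ℝ :=
  Finset.univ.inf fun i =>
    ordD F (((↑p.1⁻¹ : Matrix (Fin m) (Fin m) D).mulVec w) i) + ((p.2 i : ℝ) : WithTop ℝ)

/-- `(g, c)` and `(h, d)` give the same point of the building if their norms differ by a
constant. -/
def buildingSetoid (D : Type*) [DivisionRing D] [Algebra F D] (m : ℕ) :
    Setoid ((Matrix (Fin m) (Fin m) D)ˣ × (Fin m → ℝ)) where
  r p q := ∃ k : ℝ, ∀ w, splitNorm F p w = splitNorm F q w + (k : WithTop ℝ)
  iseqv :=
    { refl := fun p => ⟨0, fun w => by simp⟩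
      symm := by
        rintro p q ⟨k, hk⟩
        refine ⟨-k, fun w => ?_⟩
        rw [hk, add_assoc, ← WithTop.coe_add, add_neg_cancel, WithTop.coe_zero, add_zero]
      trans := by
        rintro p q s ⟨k, hk⟩ ⟨l, hl⟩
        refine ⟨l + k, fun w => ?_⟩
        rw [hk, hl, add_assoc, WithTop.coe_add] }

/-- The (reduced) Bruhat--Tits building of `GL_m(D)`, in the Goldman--Iwahori--Bruhat--Tits
description: the set of homothety classes of splittable norms on the right `D`-module `D^m`.
The class of `(g, c)` is the translate by `g` of the point `c` of the standard apartment. -/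
def Building (D : Type*) [DivisionRing D] [Algebra F D] (m : ℕ) : Type _ :=
  Quotient (buildingSetoid F D m)

/-- The Moy--Prasad group `P_{x,r}` at a point `x` of the building: it is `g P_{c,r} g⁻¹` if `x` is
the translate by `g` of the point `c` of the standard apartment. (For `r ≥ 0` this group is the same
for all such pairs `(g, c)`, that is, for all frames whose apartment contains `x`; it is written
here as the subgroup generated by all of them.) -/
def moyPrasad (x : Building F D m) (r : ℝ) : Subgroup (Matrix (Fin m) (Fin m) D)ˣ :=
  ⨆ (p : (Matrix (Fin m) (Fin m) D)ˣ × (Fin m → ℝ)) (_ : Quotient.mk (buildingSetoid F D m) p = x),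
    (standardMoyPrasad F p.2 r).map (MulAut.conj p.1).toMonoidHom

/-- `P_{x,r+}`, the union of the decreasing family of groups `P_{x,s}` with `s > r`. -/
def moyPrasadPlus (x : Building F D m) (r : ℝ) : Subgroup (Matrix (Fin m) (Fin m) D)ˣ :=
  ⨆ (s : ℝ) (_ : r < s), moyPrasad F x s

end Building

section Representations

variable {G V : Type*} [Group G] [AddCommGroup V] [Module ℂ V]

/-- A complex representation of a topological group is smooth if every vector is fixed by some
open subgroup. -/
def IsSmoothRep [TopologicalSpace G] (π : Representation ℂ G V) : Prop :=
  ∀ v : V, ∃ K : Subgroup G, IsOpen (K : Set G) ∧ ∀ g ∈ K, π g v = v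

/-- `π` has a nonzero `H`-fixed vector, i.e. it contains the trivial character of `H`. -/
def HasFixedVector (π : Representation ℂ G V) (H : Subgroup G) : Prop :=
  ∃ v : V, v ≠ 0 ∧ ∀ g ∈ H, π g v = v

end Representations

section Depth

variable (F : Type*) [Field F] [ValuativeRel F] [TopologicalSpace F] [IsNonarchimedeanLocalField F]
variable {D : Type*} [DivisionRing D] [Algebra F D] {m : ℕ}
variable {V : Type*} [AddCommGroup V] [Module ℂ V]

/-- The set of all `j / e_F(𝔄)`, with `j ≥ 0` an integer and `𝔄` a hereditary `𝔬_F`-order in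
`M_m(D)` such that `π` contains the trivial character of `U^{j+1}(𝔄)`. -/
def normalizedLevelSet (π : Representation ℂ (Matrix (Fin m) (Fin m) D)ˣ V) : Set ℝ :=
  {r | ∃ (𝔄 : Subalgebra 𝒪[F] (Matrix (Fin m) (Fin m) D)) (j : ℕ), IsHereditaryOrder 𝔄 ∧
    HasFixedVector π (U 𝔄 (j + 1)) ∧ r = (j : ℝ) / (ramificationIndex 𝔄 : ℝ)}

/-- The normalized level of `π`. -/
noncomputable def normalizedLevel (π : Representation ℂ (Matrix (Fin m) (Fin m) D)ˣ V) : ℝ :=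
  sInf (normalizedLevelSet F π)

/-- The set of all real `r ≥ 0` such that `π` has nonzero `P_{x,r+}`-fixed vectors for some point
`x` of the building. -/
def moyPrasadDepthSet (π : Representation ℂ (Matrix (Fin m) (Fin m) D)ˣ V) : Set ℝ :=
  {r | 0 ≤ r ∧ ∃ x : Building F D m, HasFixedVector π (moyPrasadPlus F x r)}

/-- The Moy--Prasad depth of `π`. -/
noncomputable def moyPrasadDepth (π : Representation ℂ (Matrix (Fin m) (Fin m) D)ˣ V) : ℝ :=
  sInf (moyPrasadDepthSet F π)

end Depth

end DepthGL

/-!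
The normalized level and the Moy--Prasad depth are compared through standard orders. A frame
`g ∈ GL_m(D)` and exponents `c ∈ ℝ^m` define a norm on `D^m`, and hence, for every `s`, the lattice
of endomorphisms that raise this norm by at least `s`; in the coordinates given by `g` its elements
are the matrices with `v(a_{pq}) + c_p - c_q ≥ s`. For `c = y / (n E)`, with integers `n ≥ 1` and
`y_p` and the ramification index `E` of `D`, the case `s = 0` is the standard order
`stdOrder F g n y`. It is hereditary. If `y` meets every residue class modulo `n`, then the `j`-th
power of its radical is the lattice for `s = j / (n E)`, so that its ramification index is `n E`.

Every hereditary order is of this form (`IsHereditaryOrder.exists_eq_stdOrder`). The lattices in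
`D^m` over a hereditary order are projective, and therefore form a chain: for two lattices the
surjection `N₁ × N₂ → N₁ + N₂` splits, the components of the splitting are right multiplications by
elements `d₁`, `d₂` of `D` with `d₁ + d₂ = 1`, and one of these is a unit of the valuation ring,
which preserves all lattices (`IsHereditaryOrder.le_total`). The order is the stabilizer of this
chain (`IsHereditaryOrder.mem_of_preserves`), and the chain is split by a basis of `D^m`
(`IsHereditaryOrder.exists_splitting`).

It remains to compare the groups.

* For `𝔄 = stdOrder F g n y` and the point `x` of the building given by `(g, y / (n E))`, the group
  `P_{x,r+}` with `r = j / (n E)` is contained in `U^{j+1}(𝔄)`. The Moy--Prasad group `P_{x,s}` is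
  generated by conjugates attached to all frames that represent `x`, but the condition of raising
  the norm by `s` depends on `x` only (`moyPrasad_le`).
* Conversely, every `P_{x,r+}` contains some `U^{j+1}(𝔄)` with `j / e_F(𝔄) ≤ r`
  (`exists_U_le_moyPrasadPlus`). If `x` is given by `(g, c)`, the inclusion holds for
  `𝔄 = stdOrder F g n y` as soon as `n w_{pq} + y_p - y_q ≤ j` for all `p`, `q`, where `w_{pq}` is
  the largest integer with `w_{pq} / E + c_p - c_q ≤ r`; here Gaussian elimination shows that
  `P_{x,s}` contains all `u` such that `u - 1` raises the norm by `s > 0`. The least ratio `j / n` for which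
  these inequalities have a solution is the maximal mean of `w` along a cycle. It is at most `E r`,
  because `E c` solves the inequalities with this bound, and the solution takes all values modulo
  the reduced denominator along an optimal cycle (`exists_integral_potential`).

The first inclusion shows that every normalized level belongs to the set of Moy--Prasad depths, and
the second that every element of the latter is at least some normalized level. Finally the set of
normalized levels has a least element: it is nonempty by smoothness, and `n ≤ m` bounds the
denominators of its elements.
-/

set_option linter.unusedSectionVars false

namespace DepthGL

/-! ### The valuation of a division algebra -/

section BaseField

variable (F : Type*) [Field F] [ValuativeRel F] [TopologicalSpace F] [IsNonarchimedeanLocalField F]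

/-- The normalized additive valuation of `F`, with values in `ℤ` (and the junk value `0` at `0`). -/
noncomputable def ordF (x : F) : ℤ :=
  -(IsNonarchimedeanLocalField.valueGroupWithZeroIsoInt F (valuation F x)).log

variable {F}

theorem valueGroup_ne_zero {x : F} (hx : x ≠ 0) :
    IsNonarchimedeanLocalField.valueGroupWithZeroIsoInt F (valuation F x) ≠ 0 := by
  simpa using hx

theorem ordF_mul {x y : F} (hx : x ≠ 0) (hy : y ≠ 0) : ordF F (x * y) = ordF F x + ordF F y := by
  simp only [ordF, map_mul]
  rw [WithZero.log_mul (valueGroup_ne_zero hx) (valueGroup_ne_zero hy)]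
  ring

theorem ordF_one : ordF F 1 = 0 := by simp [ordF]

theorem ordF_le_ordF {x y : F} (hx : x ≠ 0) (hy : y ≠ 0) :
    ordF F x ≤ ordF F y ↔ valuation F y ≤ valuation F x := by
  rw [ordF, ordF, neg_le_neg_iff, WithZero.log_le_log (valueGroup_ne_zero hy)
    (valueGroup_ne_zero hx)]
  exact map_le_map_iff (IsNonarchimedeanLocalField.valueGroupWithZeroIsoInt F)

theorem mem_integer_iff {x : F} (hx : x ≠ 0) : x ∈ 𝒪[F] ↔ 0 ≤ ordF F x := by
  rw [← ordF_one (F := F), ordF_le_ordF one_ne_zero hx, map_one]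
  rfl

theorem ordF_add {x y : F} {k : ℤ} (hx : x = 0 ∨ k ≤ ordF F x) (hy : y = 0 ∨ k ≤ ordF F y) :
    x + y = 0 ∨ k ≤ ordF F (x + y) := by
  by_cases hx0 : x = 0
  · simpa [hx0] using hy
  by_cases hy0 : y = 0
  · simpa [hy0] using hx
  by_cases h : x + y = 0
  · exact Or.inl h
  right
  have hx := hx.resolve_left hx0
  have hy := hy.resolve_left hy0
  rcases le_max_iff.1 ((valuation F).map_add x y) with h1 | h1
  · exact hx.trans ((ordF_le_ordF hx0 h).2 h1)
  · exact hy.trans ((ordF_le_ordF hy0 h).2 h1)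

theorem exists_ordF_eq_one : ∃ x : F, x ≠ 0 ∧ ordF F x = 1 := by
  obtain ⟨x, hx⟩ := valuation_surjective
    ((IsNonarchimedeanLocalField.valueGroupWithZeroIsoInt F).symm (WithZero.exp (-1)))
  have h : ordF F x = 1 := by simp [ordF, hx]
  exact ⟨x, by rintro rfl; simp [ordF] at h, h⟩

/-- A uniformizer of `F`. -/
noncomputable def unifF (F : Type*) [Field F] [ValuativeRel F] [TopologicalSpace F]
    [IsNonarchimedeanLocalField F] : F := (exists_ordF_eq_one (F := F)).choose

theorem unifF_ne_zero : unifF F ≠ 0 := (exists_ordF_eq_one (F := F)).choose_spec.1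

theorem ordF_unifF : ordF F (unifF F) = 1 := (exists_ordF_eq_one (F := F)).choose_spec.2

theorem ordF_inv {x : F} (hx : x ≠ 0) : ordF F x⁻¹ = - ordF F x := by
  have := ordF_mul hx (inv_ne_zero hx)
  rw [mul_inv_cancel₀ hx, ordF_one] at this
  omega

theorem ordF_pow {x : F} (hx : x ≠ 0) (k : ℕ) : ordF F (x ^ k) = k * ordF F x := by
  induction k with
  | zero => simp [ordF_one]
  | succ k ih => rw [pow_succ, ordF_mul (pow_ne_zero _ hx) hx, ih]; push_cast; ring

theorem ordF_zpow {x : F} (hx : x ≠ 0) (k : ℤ) : ordF F (x ^ k) = k * ordF F x := by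
  cases k with
  | ofNat k => simpa using ordF_pow hx k
  | negSucc k => rw [zpow_negSucc, ordF_inv (pow_ne_zero _ hx), ordF_pow hx, Int.negSucc_eq]
                 push_cast; ring

theorem ordF_unifF_zpow (k : ℤ) : ordF F (unifF F ^ k) = k := by
  rw [ordF_zpow unifF_ne_zero, ordF_unifF, mul_one]

theorem t2Space_of_localField : T2Space F := by
  let := IsTopologicalAddGroup.rightUniformSpace F
  have := isUniformAddGroup_of_addCommGroup (G := F)
  infer_instance

theorem isOpen_valuation_lt (γ : ValueGroupWithZero F) (hγ : γ ≠ 0) :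
    IsOpen {x : F | valuation F x < γ} := by
  have h : {x : F | valuation F x < γ} ∈ nhds (0 : F) :=
    (IsValuativeTopology.hasBasis_nhds_zero' F).mem_of_mem hγ
  exact AddSubgroup.isOpen_of_mem_nhds ((valuation F).ltAddSubgroup (Units.mk0 γ hγ)) h

theorem ordF_le_of_isCompact {K : Set F} (hK : IsCompact K) (h0 : (0 : F) ∉ K) :
    ∃ C : ℤ, ∀ x ∈ K, ordF F x ≤ C := by
  have := t2Space_of_localField (F := F)
  have hn : Kᶜ ∈ nhds (0 : F) := hK.isClosed.isOpen_compl.mem_nhds h0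
  obtain ⟨γ, hγ, h⟩ := (IsValuativeTopology.hasBasis_nhds_zero' F).mem_iff.1 hn
  obtain ⟨c, rfl⟩ := valuation_surjective γ
  have hc : c ≠ 0 := by simpa using hγ
  refine ⟨ordF F c, fun x hx => ?_⟩
  have hx0 : x ≠ 0 := by rintro rfl; exact h0 hx
  rw [ordF_le_ordF hx0 hc]
  by_contra hlt
  exact h (show valuation F x < valuation F c from not_le.1 hlt) hx

theorem abs_ordF_le_of_isCompact {K : Set F} (hK : IsCompact K) (h0 : (0 : F) ∉ K) :
    ∃ C : ℤ, ∀ x ∈ K, |ordF F x| ≤ C := by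
  obtain ⟨C, hC⟩ := ordF_le_of_isCompact hK h0
  have hK' : IsCompact ((fun x : F => x⁻¹) '' K) :=
    hK.image_of_continuousOn (continuousOn_inv₀.mono fun x hx => by rintro rfl; exact h0 hx)
  obtain ⟨C', hC'⟩ := ordF_le_of_isCompact hK' (by
    rintro ⟨x, hx, h⟩
    exact h0 ((inv_eq_zero.1 h) ▸ hx))
  refine ⟨max C C', fun x hx => ?_⟩
  have hx0 : x ≠ 0 := by rintro rfl; exact h0 hx
  have h1 := hC x hx
  have h2 := hC' x⁻¹ ⟨x, hx, rfl⟩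
  rw [ordF_inv hx0] at h2
  rw [abs_le]
  constructor
  · have := le_max_right C C'; omega
  · exact h1.trans (le_max_left _ _)

end BaseField

section NormOrd

variable (F : Type*) [Field F] [ValuativeRel F] [TopologicalSpace F] [IsNonarchimedeanLocalField F]
variable {D : Type*} [DivisionRing D] [Algebra F D] [FiniteDimensional F D]

/-- The unnormalized integral valuation `v_F ∘ N_{D/F}` of `D`. -/
noncomputable def normOrd (a : D) : ℤ := ordF F (Algebra.norm F a)

variable {F}

theorem norm_ne_zero {a : D} (ha : a ≠ 0) : Algebra.norm F a ≠ 0 :=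
  (Algebra.norm_ne_zero_iff_of_basis (Module.finBasis F D)).2 ha

theorem normOrd_mul {a b : D} (ha : a ≠ 0) (hb : b ≠ 0) :
    normOrd F (a * b) = normOrd F a + normOrd F b := by
  rw [normOrd, map_mul, ordF_mul (norm_ne_zero ha) (norm_ne_zero hb)]; rfl

theorem normOrd_algebraMap {x : F} (hx : x ≠ 0) :
    normOrd F (algebraMap F D x) = Module.finrank F D * ordF F x := by
  rw [normOrd, Algebra.norm_algebraMap, ordF_pow hx]

theorem normOrd_one : normOrd F (1 : D) = 0 := by simp [normOrd, ordF_one]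

theorem normOrd_pow {a : D} (ha : a ≠ 0) (k : ℕ) : normOrd F (a ^ k) = k * normOrd F a := by
  rw [normOrd, map_pow, ordF_pow (norm_ne_zero ha)]; rfl

/-- The lattice of all elements of `D` whose coordinates in a fixed basis over `F` have valuation at
least `k`. -/
noncomputable def coordLattice (F D : Type*) [Field F] [ValuativeRel F] [TopologicalSpace F]
    [IsNonarchimedeanLocalField F] [DivisionRing D] [Algebra F D] [FiniteDimensional F D]
    (k : ℤ) : AddSubgroup D where
  carrier := {a | ∀ i, (Module.finBasis F D).repr a i = 0 ∨
    k ≤ ordF F ((Module.finBasis F D).repr a i)}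
  zero_mem' := by simp
  add_mem' := by
    intro a b ha hb i
    rw [map_add, Finsupp.add_apply]
    exact ordF_add (ha i) (hb i)
  neg_mem' := by
    intro a ha i
    rw [map_neg, Finsupp.neg_apply]
    simpa [ordF] using ha i

theorem finrank_pos' : 0 < (Module.finrank F D : ℤ) := by
  exact_mod_cast Module.finrank_pos

/-- The norm is bounded above and below on the compact set of primitive vectors. -/
theorem exists_abs_normOrd_le_of_primitive :
    ∃ C : ℤ, ∀ s : Fin (Module.finrank F D) → F, (∀ i, valuation F (s i) ≤ 1) →
      (∃ i, valuation F (s i) = 1) → |normOrd F (∑ i, s i • Module.finBasis F D i)| ≤ C := by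
  set b := Module.finBasis F D
  set S : Set (Fin (Module.finrank F D) → F) :=
    {s | (∀ i, valuation F (s i) ≤ 1)} ∩ {s | ∀ i, valuation F (s i) < 1}ᶜ
  have hcl : IsClosed {s : Fin (Module.finrank F D) → F | ∀ i, valuation F (s i) < 1}ᶜ := by
    have := isOpen_set_pi (s := fun _ : Fin (Module.finrank F D) => {x : F | valuation F x < 1})
      (i := Set.univ) Set.finite_univ fun _ _ => isOpen_valuation_lt 1 one_ne_zero
    simpa [Set.pi] using this.isClosed_compl
  have hbox : IsCompact {s : Fin (Module.finrank F D) → F | ∀ i, valuation F (s i) ≤ 1} := by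
    have := isCompact_univ_pi (s := fun _ : Fin (Module.finrank F D) => {x : F | valuation F x ≤ 1})
      fun _ => IsNonarchimedeanLocalField.isCompact_closedBall F 1
    simpa [Set.pi] using this
  have hSc : IsCompact S := hbox.inter_right hcl
  have hcont : Continuous fun s : Fin (Module.finrank F D) → F =>
      Algebra.norm F (∑ i, s i • b i) := by
    simp only [Algebra.norm_eq_matrix_det b, map_sum, map_smul]
    refine Continuous.matrix_det ?_
    fun_prop
  obtain ⟨C, hC⟩ := abs_ordF_le_of_isCompact (hSc.image hcont) (by
    rintro ⟨s, ⟨-, hs⟩, h⟩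
    refine hs fun i => ?_
    rw [Algebra.norm_eq_zero_iff] at h
    simp [Fintype.linearIndependent_iff.1 b.linearIndependent s h i])
  exact ⟨C, fun s h1 ⟨i, hi⟩ => hC _ ⟨s, ⟨h1, fun h => (h i).ne hi⟩, rfl⟩⟩

/-- Up to a bounded error, the valuation of the norm of `a` is `[D : F]` times the largest `k` such
that `a` lies in the coordinate lattice of level `k`: scaling by a power of the uniformizer makes
`a` primitive. -/
theorem exists_normOrd_bounds (F D : Type*) [Field F] [ValuativeRel F] [TopologicalSpace F]
    [IsNonarchimedeanLocalField F] [DivisionRing D] [Algebra F D] [FiniteDimensional F D] :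
    ∃ C : ℤ, ∀ a : D, a ≠ 0 → ∃ k : ℤ, a ∈ coordLattice F D k ∧
      (∀ l, a ∈ coordLattice F D l → l ≤ k) ∧ |normOrd F a - Module.finrank F D * k| ≤ C := by
  obtain ⟨C, hC⟩ := exists_abs_normOrd_le_of_primitive (F := F) (D := D)
  refine ⟨C, fun a ha => ?_⟩
  classical
  set b := Module.finBasis F D with hb
  set T := Finset.univ.filter fun i => b.repr a i ≠ 0
  have hT : T.Nonempty := by
    by_contra h
    rw [Finset.not_nonempty_iff_eq_empty, Finset.filter_eq_empty_iff] at h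
    refine ha (b.repr.map_eq_zero_iff.1 (Finsupp.ext fun i => ?_))
    simpa using h (Finset.mem_univ i)
  obtain ⟨i₀, hi₀, hmin⟩ := T.exists_min_image (fun i => ordF F (b.repr a i)) hT
  have hi₀' : b.repr a i₀ ≠ 0 := (Finset.mem_filter.1 hi₀).2
  set k := ordF F (b.repr a i₀) with hk
  set u : F := unifF F ^ (-k) with hu
  have hu0 : u ≠ 0 := zpow_ne_zero _ unifF_ne_zero
  have huk : ordF F u = -k := ordF_unifF_zpow _
  have hmem : a ∈ coordLattice F D k := by
    intro i
    by_cases h : b.repr a i = 0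
    · exact Or.inl h
    · exact Or.inr (hmin i (Finset.mem_filter.2 ⟨Finset.mem_univ _, h⟩))
  refine ⟨k, hmem, fun l hl => (hl i₀).resolve_left hi₀', ?_⟩
  have hval : ∀ x : F, x ≠ 0 → ordF F x = 0 → valuation F x = 1 := fun x hx h => by
    rw [← map_one (valuation F)]
    refine le_antisymm ?_ ?_
    · rw [← ordF_le_ordF one_ne_zero hx, ordF_one, h]
    · rw [← ordF_le_ordF hx one_ne_zero, ordF_one, h]
  have h1 := hC (fun i => u * b.repr a i) (fun i => by
      rcases hmem i with h | h
      · rw [h]; simp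
      · by_cases h0 : b.repr a i = 0
        · rw [h0]; simp
        · rw [← map_one (valuation F), ← ordF_le_ordF one_ne_zero (mul_ne_zero hu0 h0), ordF_one,
            ordF_mul hu0 h0, huk]
          have h : k ≤ ordF F (b.repr a i) := h
          omega)
    ⟨i₀, hval _ (mul_ne_zero hu0 hi₀') (by rw [ordF_mul hu0 hi₀', huk]; omega)⟩
  have h2 : ∑ i, (u * b.repr a i) • b i = algebraMap F D u * a := by
    conv_rhs => rw [← b.sum_repr a, ← Algebra.smul_def, Finset.smul_sum]
    simp [mul_smul]
  rw [h2, normOrd_mul (by simpa using hu0) ha, normOrd_algebraMap hu0, huk] at h1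
  convert h1 using 2
  ring

theorem coordLattice_anti {k l : ℤ} (h : k ≤ l) : coordLattice F D l ≤ coordLattice F D k :=
  fun _ ha i => (ha i).imp_right h.trans

theorem exists_le_normOrd (F D : Type*) [Field F] [ValuativeRel F] [TopologicalSpace F]
    [IsNonarchimedeanLocalField F] [DivisionRing D] [Algebra F D] [FiniteDimensional F D] :
    ∃ C : ℤ, ∀ (a : D) (k : ℤ), a ≠ 0 → a ∈ coordLattice F D k →
      Module.finrank F D * k - C ≤ normOrd F a := by
  obtain ⟨C, hC⟩ := exists_normOrd_bounds F D
  refine ⟨C, fun a k ha hk => ?_⟩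
  obtain ⟨l, -, h2, h3⟩ := hC a ha
  have := mul_le_mul_of_nonneg_left (h2 k hk) (finrank_pos' (F := F) (D := D)).le
  have := (abs_le.1 h3).1
  omega

theorem exists_mem_coordLattice (F D : Type*) [Field F] [ValuativeRel F] [TopologicalSpace F]
    [IsNonarchimedeanLocalField F] [DivisionRing D] [Algebra F D] [FiniteDimensional F D] :
    ∃ C : ℤ, ∀ (a : D) (k : ℤ), a ≠ 0 → Module.finrank F D * k + C ≤ normOrd F a →
      a ∈ coordLattice F D k := by
  obtain ⟨C, hC⟩ := exists_normOrd_bounds F D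
  refine ⟨C, fun a k ha hk => ?_⟩
  obtain ⟨l, h1, -, h3⟩ := hC a ha
  have := (abs_le.1 h3).2
  exact coordLattice_anti (le_of_mul_le_mul_left (a := (Module.finrank F D : ℤ)) (by omega)
    finrank_pos') h1

/-- If `v(a) ≥ 0` then all powers of `a`, hence all powers of `1 + a`, lie in a bounded set, and
this forces `v(1 + a) ≥ 0`. -/
theorem normOrd_one_add_nonneg {a : D} (ha : a ≠ 0) (h : 0 ≤ normOrd F a) (h1 : 1 + a ≠ 0) :
    0 ≤ normOrd F (1 + a) := by
  obtain ⟨C, hC⟩ := exists_mem_coordLattice F D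
  obtain ⟨C', hC'⟩ := exists_le_normOrd F D
  set n : ℤ := (Module.finrank F D : ℤ)
  have hn : 0 < n := finrank_pos'
  have hpow : ∀ j : ℕ, a ^ j ∈ coordLattice F D (-|C|) := fun j => by
    refine hC _ _ (pow_ne_zero _ ha) ?_
    rw [normOrd_pow ha]
    have h2 : 0 ≤ (j : ℤ) * normOrd F a := by positivity
    have h3 : |C| ≤ n * |C| := le_mul_of_one_le_left (abs_nonneg _) hn
    have := le_abs_self C
    linarith
  have hpow' : ∀ j : ℕ, (1 + a) ^ j ∈ coordLattice F D (-|C|) := fun j => by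
    rw [add_comm, (Commute.one_right a).add_pow]
    refine sum_mem fun i _ => ?_
    rw [one_pow, mul_one, ← nsmul_eq_mul']
    exact nsmul_mem (hpow i) _
  by_contra hneg
  have h4 := hC' _ _ (pow_ne_zero (n * |C| + |C'| + 1).toNat h1) (hpow' _)
  have hp : 0 ≤ n * |C| := by positivity
  have hp' := abs_nonneg C'
  rw [normOrd_pow h1, Int.toNat_of_nonneg (by omega)] at h4
  have h5 : (n * |C| + |C'| + 1) * normOrd F (1 + a) ≤ (n * |C| + |C'| + 1) * (-1) :=
    mul_le_mul_of_nonneg_left (by omega) (by omega)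
  have := le_abs_self C'
  linarith

theorem normOrd_inv {a : D} (ha : a ≠ 0) : normOrd F a⁻¹ = - normOrd F a := by
  have := normOrd_mul (F := F) ha (inv_ne_zero ha)
  rw [mul_inv_cancel₀ ha, normOrd_one] at this
  omega

theorem normOrd_add {a b : D} (ha : a ≠ 0) (hb : b ≠ 0) (hab : a + b ≠ 0) :
    min (normOrd F a) (normOrd F b) ≤ normOrd F (a + b) := by
  wlog h : normOrd F a ≤ normOrd F b generalizing a b
  · rw [min_comm, add_comm]
    exact this hb ha (by rwa [add_comm]) (by omega)
  rw [min_eq_left h]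
  have e : a + b = a * (1 + a⁻¹ * b) := by rw [mul_add, mul_one, mul_inv_cancel_left₀ ha]
  have h0 : 1 + a⁻¹ * b ≠ 0 := by rintro h0; rw [e, h0, mul_zero] at hab; exact hab rfl
  have := normOrd_one_add_nonneg (F := F) (mul_ne_zero (inv_ne_zero ha) hb)
    (by rw [normOrd_mul (inv_ne_zero ha) hb, normOrd_inv ha]; omega) h0
  rw [e, normOrd_mul ha h0]
  omega

/-- The value group of `v_F ∘ N_{D/F}` has a positive generator. -/
theorem exists_normOrd_generator (F D : Type*) [Field F] [ValuativeRel F] [TopologicalSpace F]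
    [IsNonarchimedeanLocalField F] [DivisionRing D] [Algebra F D] [FiniteDimensional F D] :
    ∃ f : ℕ, 0 < f ∧ (∃ a : D, a ≠ 0 ∧ normOrd F a = f) ∧
      ∀ a : D, a ≠ 0 → (f : ℤ) ∣ normOrd F a := by
  let H : AddSubgroup ℤ :=
    { carrier := {k | ∃ a : D, a ≠ 0 ∧ normOrd F a = k}
      zero_mem' := ⟨1, one_ne_zero, normOrd_one⟩
      add_mem' := by
        rintro _ _ ⟨a, ha, rfl⟩ ⟨b, hb, rfl⟩
        exact ⟨a * b, mul_ne_zero ha hb, normOrd_mul ha hb⟩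
      neg_mem' := by
        rintro _ ⟨a, ha, rfl⟩
        exact ⟨a⁻¹, inv_ne_zero ha, normOrd_inv ha⟩ }
  obtain ⟨g, hg⟩ := Int.subgroup_cyclic H
  have hmem : ∀ k, k ∈ H ↔ g ∣ k := fun k => by
    rw [hg, AddSubgroup.mem_closure_singleton]
    simp only [smul_eq_mul, dvd_def, mul_comm, eq_comm]
  have hn : (Module.finrank F D : ℤ) ∈ H := ⟨algebraMap F D (unifF F),
    by simpa using unifF_ne_zero, by rw [normOrd_algebraMap unifF_ne_zero, ordF_unifF, mul_one]⟩
  refine ⟨g.natAbs, ?_, ?_, fun a ha => ?_⟩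
  · rw [Int.natAbs_pos]
    rintro rfl
    have := finrank_pos' (F := F) (D := D)
    have := (hmem _).1 hn
    rw [zero_dvd_iff] at this
    omega
  · exact (hmem _).2 (Int.dvd_natAbs.2 dvd_rfl)
  · exact Int.natAbs_dvd.2 ((hmem _).1 ⟨a, ha, rfl⟩)

end NormOrd

section Valuation

variable (F : Type*) [Field F] [ValuativeRel F] [TopologicalSpace F] [IsNonarchimedeanLocalField F]
variable (D : Type*) [DivisionRing D] [Algebra F D] [FiniteDimensional F D]

/-- The positive generator of the group of values of `v_F ∘ N_{D/F}`. -/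
noncomputable def valGen : ℕ := (exists_normOrd_generator F D).choose

/-- The ramification index of `D` over `F`: the group of values of `ordD` on `Dˣ` is
`(1 / ramD) ℤ`. -/
noncomputable def ramD : ℕ := Module.finrank F D / valGen F D

variable {D}

/-- The surjective integral valuation of `D` (with a junk value at `0`). -/
noncomputable def valD (a : D) : ℤ := normOrd F a / valGen F D

/-- `valGE F n c k a` says that `n v(a) + c ≥ k`, where `v` is the integral valuation `valD`, with
`v(0) = ∞`. -/
def valGE (n : ℕ) (c k : ℤ) (a : D) : Prop := a = 0 ∨ k ≤ n * valD F a + c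

variable {F}

theorem valGen_pos : 0 < (valGen F D : ℤ) := by
  exact_mod_cast (exists_normOrd_generator F D).choose_spec.1

theorem valGen_mul_valD {a : D} (ha : a ≠ 0) : valGen F D * valD F a = normOrd F a :=
  Int.mul_ediv_cancel' ((exists_normOrd_generator F D).choose_spec.2.2 a ha)

theorem valGen_mul_ramD : (valGen F D * ramD F D : ℤ) = Module.finrank F D := by
  have h := (exists_normOrd_generator F D).choose_spec.2.2 (algebraMap F D (unifF F))
    (by simpa using unifF_ne_zero)
  rw [normOrd_algebraMap unifF_ne_zero, ordF_unifF, mul_one] at h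
  exact_mod_cast Nat.mul_div_cancel' (Int.natCast_dvd_natCast.1 h)

theorem ramD_pos : 0 < (ramD F D : ℤ) := by
  have h := valGen_mul_ramD (F := F) (D := D)
  have h2 := finrank_pos' (F := F) (D := D)
  rw [← h] at h2
  exact (pos_iff_pos_of_mul_pos h2).1 (valGen_pos (F := F) (D := D))

theorem exists_valD_eq_one (F D : Type*) [Field F] [ValuativeRel F] [TopologicalSpace F]
    [IsNonarchimedeanLocalField F] [DivisionRing D] [Algebra F D] [FiniteDimensional F D] :
    ∃ a : D, a ≠ 0 ∧ valD F a = 1 := by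
  obtain ⟨a, ha, h⟩ := (exists_normOrd_generator F D).choose_spec.2.1
  refine ⟨a, ha, mul_left_cancel₀ (valGen_pos (F := F) (D := D)).ne' ?_⟩
  rw [valGen_mul_valD ha, mul_one]
  exact h

theorem valD_mul {a b : D} (ha : a ≠ 0) (hb : b ≠ 0) :
    valD F (a * b) = valD F a + valD F b := by
  refine mul_left_cancel₀ (valGen_pos (F := F) (D := D)).ne' ?_
  rw [mul_add, valGen_mul_valD ha, valGen_mul_valD hb, valGen_mul_valD (mul_ne_zero ha hb),
    normOrd_mul ha hb]

theorem valD_one : valD F (1 : D) = 0 := by simp [valD, normOrd_one]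

theorem valD_inv {a : D} (ha : a ≠ 0) : valD F a⁻¹ = - valD F a := by
  have := valD_mul (F := F) ha (inv_ne_zero ha)
  rw [mul_inv_cancel₀ ha, valD_one] at this
  omega

theorem valD_pow {a : D} (ha : a ≠ 0) (k : ℕ) : valD F (a ^ k) = k * valD F a := by
  induction k with
  | zero => simp [valD_one]
  | succ k ih => rw [pow_succ, valD_mul (pow_ne_zero _ ha) ha, ih]; push_cast; ring

theorem valD_zpow {a : D} (ha : a ≠ 0) (k : ℤ) : valD F (a ^ k) = k * valD F a := by
  cases k with
  | ofNat k => simpa using valD_pow ha k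
  | negSucc k => rw [zpow_negSucc, valD_inv (pow_ne_zero _ ha), valD_pow ha, Int.negSucc_eq]
                 push_cast; ring

theorem exists_valD_eq (F D : Type*) [Field F] [ValuativeRel F] [TopologicalSpace F]
    [IsNonarchimedeanLocalField F] [DivisionRing D] [Algebra F D] [FiniteDimensional F D] (k : ℤ) :
    ∃ a : D, a ≠ 0 ∧ valD F a = k := by
  obtain ⟨a, ha, h⟩ := exists_valD_eq_one F D
  exact ⟨a ^ k, zpow_ne_zero _ ha, by rw [valD_zpow ha, h, mul_one]⟩

theorem valD_neg (a : D) : valD F (-a) = valD F a := by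
  by_cases ha : a = 0
  · simp [ha]
  have h1 : (-1 : D) ≠ 0 := neg_ne_zero.2 one_ne_zero
  have h2 : valD F (-1 : D) = 0 := by
    have := valD_mul (F := F) h1 h1
    rw [neg_mul_neg, one_mul, valD_one] at this
    omega
  rw [← neg_one_mul, valD_mul h1 ha, h2, zero_add]

theorem valD_add {a b : D} (ha : a ≠ 0) (hb : b ≠ 0) (hab : a + b ≠ 0) :
    min (valD F a) (valD F b) ≤ valD F (a + b) := by
  have h := normOrd_add (F := F) ha hb hab
  rw [← valGen_mul_valD ha, ← valGen_mul_valD hb, ← valGen_mul_valD hab,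
    ← mul_min_of_nonneg _ _ valGen_pos.le] at h
  exact le_of_mul_le_mul_left h valGen_pos

theorem valD_algebraMap {x : F} (hx : x ≠ 0) :
    valD F (algebraMap F D x) = ramD F D * ordF F x := by
  refine mul_left_cancel₀ (valGen_pos (F := F) (D := D)).ne' ?_
  rw [valGen_mul_valD (by simpa using hx), normOrd_algebraMap hx, ← valGen_mul_ramD, mul_assoc]

theorem ordD_eq {a : D} (ha : a ≠ 0) :
    ordD F a = (((valD F a : ℝ) / (ramD F D : ℝ) : ℝ) : WithTop ℝ) := by
  rw [ordD, if_neg ha]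
  congr 1
  have h1 : (normOrd F a : ℝ) = valGen F D * valD F a := by
    exact_mod_cast (valGen_mul_valD (F := F) ha).symm
  have h2 : (Module.finrank F D : ℝ) = valGen F D * ramD F D := by
    exact_mod_cast (valGen_mul_ramD (F := F) (D := D)).symm
  have h3 : (valGen F D : ℝ) ≠ 0 := by
    exact_mod_cast (valGen_pos (F := F) (D := D)).ne'
  have h4 : (-((IsNonarchimedeanLocalField.valueGroupWithZeroIsoInt F
        (valuation F (Algebra.norm F a))).log : ℝ)) = normOrd F a := by
    rw [normOrd, ordF]; push_cast; rfl
  rw [h4, h1, h2, mul_div_mul_left _ _ h3]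

/-! ### Elements of valuation at least a given bound -/

theorem valGE_zero (n : ℕ) (c k : ℤ) : valGE F n c k (0 : D) := Or.inl rfl

theorem valGE_mono {n : ℕ} {c k c' k' : ℤ} {a : D} (h : valGE F n c k a) (hk : k' - c' ≤ k - c) :
    valGE F n c' k' a := h.imp_right fun h => by omega

theorem valGE_add {n : ℕ} {c k : ℤ} {a b : D} (ha : valGE F n c k a) (hb : valGE F n c k b) :
    valGE F n c k (a + b) := by
  by_cases ha0 : a = 0
  · simpa [ha0] using hb
  by_cases hb0 : b = 0
  · simpa [hb0] using ha
  by_cases h : a + b = 0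
  · exact Or.inl h
  have h1 := ha.resolve_left ha0
  have h2 := hb.resolve_left hb0
  right
  rcases min_le_iff.1 (valD_add (F := F) ha0 hb0 h) with h3 | h3
  · have := mul_le_mul_of_nonneg_left h3 (Nat.cast_nonneg (α := ℤ) n)
    omega
  · have := mul_le_mul_of_nonneg_left h3 (Nat.cast_nonneg (α := ℤ) n)
    omega

theorem valGE_sum {ι : Type*} (s : Finset ι) {n : ℕ} {c k : ℤ} {f : ι → D}
    (h : ∀ i ∈ s, valGE F n c k (f i)) : valGE F n c k (∑ i ∈ s, f i) := by
  classical
  induction s using Finset.induction_on with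
  | empty => simp [valGE]
  | insert i s hi ih =>
    rw [Finset.sum_insert hi]
    exact valGE_add (h i (by simp)) (ih fun j hj => h j (by simp [hj]))

theorem valGE_mul {n : ℕ} {c k c' k' : ℤ} {a b : D} (ha : valGE F n c k a)
    (hb : valGE F n c' k' b) : valGE F n (c + c') (k + k') (a * b) := by
  by_cases ha0 : a = 0
  · simp [ha0, valGE]
  by_cases hb0 : b = 0
  · simp [hb0, valGE]
  have h1 := ha.resolve_left ha0
  have h2 := hb.resolve_left hb0
  right; rw [valD_mul ha0 hb0, mul_add]; omega

theorem valGE_algebraMap {n : ℕ} {x : F} (hx : x ∈ 𝒪[F]) : valGE F n 0 0 (algebraMap F D x) := by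
  by_cases h : x = 0
  · simp [h, valGE]
  · right
    rw [valD_algebraMap h, add_zero]
    exact mul_nonneg n.cast_nonneg <| mul_nonneg ramD_pos.le ((mem_integer_iff h).1 hx)

theorem valGE_smul {n : ℕ} {c k : ℤ} {a : D} (x : 𝒪[F]) (ha : valGE F n c k a) :
    valGE F n c k (x • a) := by
  have : x • a = algebraMap F D x * a := by
    rw [← Algebra.smul_def]; rfl
  rw [this]
  exact valGE_mono (valGE_mul (valGE_algebraMap x.2) ha) (by omega)

/-! ### Lattices in `D` -/

/-- The fractional ideal of all `a ∈ D` with integral valuation at least `k`. -/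
def idealD (F D : Type*) [Field F] [ValuativeRel F] [TopologicalSpace F]
    [IsNonarchimedeanLocalField F] [DivisionRing D] [Algebra F D] [FiniteDimensional F D]
    (k : ℤ) : Submodule 𝒪[F] D where
  carrier := {a | valGE F 1 0 k a}
  zero_mem' := valGE_zero _ _ _
  add_mem' := valGE_add
  smul_mem' := fun x _ ha => valGE_smul x ha

theorem mem_idealD {k : ℤ} {a : D} : a ∈ idealD F D k ↔ valGE F 1 0 k a := Iff.rfl

theorem exists_valGE_mem_coordLattice (F D : Type*) [Field F] [ValuativeRel F] [TopologicalSpace F]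
    [IsNonarchimedeanLocalField F] [DivisionRing D] [Algebra F D] [FiniteDimensional F D] :
    ∃ C : ℤ, ∀ (a : D) (k : ℤ), valGE F 1 0 (ramD F D * k + C) a → a ∈ coordLattice F D k := by
  obtain ⟨C, hC⟩ := exists_mem_coordLattice F D
  refine ⟨|C|, fun a k h => ?_⟩
  by_cases ha : a = 0
  · rw [ha]; exact zero_mem _
  have h := h.resolve_left ha
  refine hC a k ha ?_
  have h2 := mul_le_mul_of_nonneg_left h (valGen_pos (F := F) (D := D)).le
  rw [add_zero, Nat.cast_one, one_mul, valGen_mul_valD ha, mul_add, ← mul_assoc,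
    valGen_mul_ramD] at h2
  have h3 : |C| ≤ valGen F D * |C| := le_mul_of_one_le_left (abs_nonneg _) valGen_pos
  have := le_abs_self C
  linarith

theorem unifF_mem : unifF F ∈ 𝒪[F] := by
  rw [mem_integer_iff unifF_ne_zero, ordF_unifF]; omega

theorem maximalIdeal_eq : 𝓂[F] = Ideal.span {(⟨unifF F, unifF_mem⟩ : 𝒪[F])} := by
  ext ⟨x, hx⟩
  rw [IsLocalRing.mem_maximalIdeal, mem_nonunits_iff, Ideal.mem_span_singleton]
  constructor
  · intro h
    by_cases hx0 : x = 0
    · subst hx0; exact dvd_zero _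
    have h1 : 1 ≤ ordF F x := by
      by_contra hlt
      have h0 := (mem_integer_iff hx0).1 hx
      refine h (IsUnit.of_mul_eq_one ⟨x⁻¹, ?_⟩ (Subtype.ext (mul_inv_cancel₀ hx0)))
      rw [mem_integer_iff (inv_ne_zero hx0), ordF_inv hx0]; omega
    refine ⟨⟨(unifF F)⁻¹ * x, ?_⟩, Subtype.ext (mul_inv_cancel_left₀ unifF_ne_zero x).symm⟩
    rw [mem_integer_iff (mul_ne_zero (inv_ne_zero unifF_ne_zero) hx0),
      ordF_mul (inv_ne_zero unifF_ne_zero) hx0, ordF_inv unifF_ne_zero, ordF_unifF]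
    omega
  · intro hd hu
    have := isUnit_of_dvd_unit hd hu
    obtain ⟨⟨y, hy⟩, h⟩ := this.exists_right_inv
    have h : unifF F * y = 1 := congrArg Subtype.val h
    have hy0 : y ≠ 0 := by rintro rfl; simp at h
    have h1 := ordF_mul unifF_ne_zero hy0
    have := (mem_integer_iff hy0).1 hy
    rw [h, ordF_one, ordF_unifF] at h1
    omega

theorem idealD_fg (k : ℤ) : (idealD F D k).FG := by
  obtain ⟨C, hC⟩ := exists_valGE_mem_coordLattice F D
  set b := Module.finBasis F D with hb
  set l : ℤ := -(|k| + |C|) with hl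
  set u : F := unifF F ^ l with hu
  have hu0 : u ≠ 0 := zpow_ne_zero _ unifF_ne_zero
  have h1 : idealD F D k ≤ Submodule.span 𝒪[F] (Set.range fun i => u • b i) := by
    intro a ha
    have h2 : a ∈ coordLattice F D l := hC a l (valGE_mono ha (by
      have h3 : (ramD F D : ℤ) * (-l) ≥ 1 * (-l) := mul_le_mul_of_nonneg_right ramD_pos (by
        have := abs_nonneg k; have := abs_nonneg C; omega)
      have := le_abs_self C; have := neg_abs_le k
      have : (ramD F D : ℤ) * (-l) = - (ramD F D * l) := by ring
      omega))
    rw [← b.sum_repr a]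
    refine sum_mem fun i _ => ?_
    have h3 : u⁻¹ * b.repr a i ∈ 𝒪[F] := by
      by_cases h0 : b.repr a i = 0
      · rw [h0, mul_zero]; exact zero_mem _
      rw [mem_integer_iff (mul_ne_zero (inv_ne_zero hu0) h0), ordF_mul (inv_ne_zero hu0) h0,
        ordF_inv hu0, ordF_unifF_zpow]
      have : l ≤ ordF F (b.repr a i) := (h2 i).resolve_left h0
      omega
    have h4 : b.repr a i • b i = (⟨_, h3⟩ : 𝒪[F]) • (u • b i) := by
      change _ = (u⁻¹ * b.repr a i) • (u • b i)
      rw [smul_smul]; congr 1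
      field_simp
    rw [h4]
    exact Submodule.smul_mem _ _ (Submodule.subset_span ⟨i, rfl⟩)
  have : IsNoetherian 𝒪[F] (Submodule.span 𝒪[F] (Set.range fun i => u • b i)) :=
    isNoetherian_of_fg_of_noetherian _ (Submodule.fg_span (Set.finite_range _))
  exact Submodule.FG.of_le (Submodule.fg_span (Set.finite_range _)) h1

/-- A unit of the valuation ring of `D` has powers arbitrarily close to `1`, by finiteness of the
residue rings. -/
theorem exists_pow_sub_one_valGE {d : D} (hd : d ≠ 0) (h0 : valD F d = 0) (s : ℕ) :
    ∃ k : ℕ, 0 < k ∧ valGE F 1 0 s (d ^ k - 1) := by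
  set M := idealD F D 0
  have hfg : (⊤ : Submodule 𝒪[F] M).FG := (Submodule.fg_top _).2 (idealD_fg 0)
  have : Finite (𝒪[F] ⧸ 𝓂[F]) := inferInstanceAs (Finite 𝓀[F])
  have hfin : Finite (𝒪[F] ⧸ 𝓂[F] ^ s) := Ideal.finite_quotient_pow (IsNoetherian.noetherian _) s
  have : Finite (M ⧸ (𝓂[F] ^ s • (⊤ : Submodule 𝒪[F] M))) :=
    Submodule.finite_quotient_smul _ hfg
  have hmem : ∀ j : ℕ, d ^ j ∈ M := fun j => Or.inr (by simp [valD_pow hd, h0])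
  obtain ⟨i, j, hij, h⟩ := Finite.exists_ne_map_eq_of_infinite fun j : ℕ =>
    (𝓂[F] ^ s • (⊤ : Submodule 𝒪[F] M)).mkQ ⟨d ^ j, hmem j⟩
  wlog hlt : i < j generalizing i j
  · exact this j i hij.symm h.symm (by omega)
  have h := (Submodule.Quotient.eq _).1 h.symm
  have hs : valGE F 1 0 s (d ^ j - d ^ i) := by
    rw [maximalIdeal_eq, Ideal.span_singleton_pow, Submodule.ideal_span_singleton_smul] at h
    obtain ⟨⟨x, hx⟩, -, h⟩ := Submodule.mem_smul_pointwise_iff_exists _ _ _ |>.1 h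
    have h : (unifF F ^ s) • x = d ^ j - d ^ i := congrArg Subtype.val h
    rw [← h, Algebra.smul_def]
    refine valGE_mono (valGE_mul (c := 0) (k := ramD F D * s) (Or.inr ?_) hx) ?_
    · rw [valD_algebraMap (pow_ne_zero _ unifF_ne_zero), ordF_pow unifF_ne_zero, ordF_unifF]
      simp
    · have : (ramD F D : ℤ) * s ≥ 1 * s := mul_le_mul_of_nonneg_right ramD_pos (by positivity)
      omega
  refine ⟨j - i, by omega, ?_⟩
  have h2 : d ^ (j - i) - 1 = (d ^ i)⁻¹ * (d ^ j - d ^ i) := by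
    rw [mul_sub, inv_mul_cancel₀ (pow_ne_zero _ hd)]
    congr 1
    rw [eq_inv_mul_iff_mul_eq₀ (pow_ne_zero _ hd), ← pow_add]
    congr 1; omega
  rw [h2]
  exact valGE_mono (valGE_mul (c := 0) (k := 0) (Or.inr (by
    rw [valD_inv (pow_ne_zero _ hd), valD_pow hd, h0]; simp)) hs) (by omega)

/-- The valuation of `D` defines its module topology. -/
theorem exists_valGE_subset_of_mem_nhds [TopologicalSpace D] [IsModuleTopology F D] {U : Set D}
    (hU : U ∈ nhds (0 : D)) : ∃ k : ℕ, ∀ a : D, valGE F 1 0 k a → a ∈ U := by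
  obtain ⟨C, hC⟩ := exists_valGE_mem_coordLattice F D
  set b := Module.finBasis F D with hb
  have := IsModuleTopology.isTopologicalRing F D
  have := IsModuleTopology.toContinuousSMul F D
  have hcont : Continuous (Fintype.linearCombination F b) :=
    IsModuleTopology.continuous_of_linearMap _
  have hU' : (Fintype.linearCombination F b) ⁻¹' U ∈ nhds 0 :=
    hcont.continuousAt.preimage_mem_nhds (by simpa using hU)
  rw [nhds_pi, Filter.mem_pi] at hU'
  obtain ⟨I, -, t, ht, hsub⟩ := hU'
  have hk : ∀ i, ∃ l : ℤ, ∀ x : F, x = 0 ∨ l ≤ ordF F x → x ∈ t i := fun i => by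
    obtain ⟨γ, hγ, h⟩ := (IsValuativeTopology.hasBasis_nhds_zero' F).mem_iff.1 (ht i)
    obtain ⟨c, rfl⟩ := valuation_surjective γ
    have hc : c ≠ 0 := by simpa using hγ
    refine ⟨ordF F c + 1, fun x hx => h ?_⟩
    by_cases hx0 : x = 0
    · simpa [hx0, zero_lt_iff] using hc
    · have := hx.resolve_left hx0
      exact not_le.1 fun hle => by
        have := (ordF_le_ordF hx0 hc).2 hle
        omega
  choose l hl using hk
  obtain ⟨L, hL⟩ := (Set.finite_range l).bddAbove
  refine ⟨(ramD F D * L + C).toNat, fun a ha => ?_⟩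
  have h1 := hC a L (valGE_mono ha (by have := Int.self_le_toNat (ramD F D * L + C); omega))
  have h2 : (fun i => b.repr a i) ∈ I.pi t := fun i _ => hl i _ ((h1 i).imp_right
    (le_trans (hL ⟨i, rfl⟩)))
  have h3 := hsub h2
  simpa [Fintype.linearCombination_apply, b.sum_repr] using h3

end Valuation

/-! ### A criterion for hereditary rings -/

section HereditaryCriterion

theorem projective_of_surjective_of_ker {R M N : Type*} [Ring R] [AddCommGroup M] [AddCommGroup N]
    [Module R M] [Module R N] (f : M →ₗ[R] N) (hf : Function.Surjective f)
    [Module.Projective R N] [Module.Projective R f.ker] : Module.Projective R M := by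
  obtain ⟨g, hg⟩ := f.exists_rightInverse_of_surjective (LinearMap.range_eq_top.2 hf)
  have hg' : ∀ x, f (g x) = x := fun x => LinearMap.congr_fun hg x
  refine Module.Projective.of_split (M := f.ker × N)
    (((LinearMap.id - g ∘ₗ f).codRestrict f.ker fun x => by simp [hg']).prod f)
    (f.ker.subtype.coprod g) ?_
  ext x
  simp

/-- In a ring with a complete orthogonal family of idempotents `ε i`, in which homogeneous elements
of `R * ε j` divide each other on the right according to their size and are right regular up to the
idempotents, every left ideal is projective: the image of a left ideal in `R * ε j` is generated by
a homogeneous element of minimal size. -/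
theorem projective_ideal_of_homogeneous_dvd {R ι : Type*} [Ring R] [Fintype ι] {ε : ι → R}
    (hε : CompleteOrthogonalIdempotents ε) (w : R → ℕ)
    (hdvd : ∀ i j k x y, ε i * x * ε j = x → ε k * y * ε j = y → x ≠ 0 → y ≠ 0 → w x ≤ w y →
      ∃ z, y = z * x)
    (hreg : ∀ i j x, ε i * x * ε j = x → x ≠ 0 → ∀ a, a * x = 0 → a * ε i = 0) (I : Ideal R) :
    Module.Projective R I := by
  classical
  have hcyc : ∀ (j : ι) (N : Ideal R), (∀ x ∈ N, x * ε j = x) → Module.Projective R N := by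
    intro j N hN
    by_cases hbot : N = ⊥
    · subst hbot
      exact Module.Projective.of_free
    obtain ⟨x₀, hx₀, hne⟩ := (Submodule.ne_bot_iff _).1 hbot
    have hS : {x | x ∈ N ∧ x ≠ 0 ∧ ∃ i, ε i * x = x}.Nonempty := by
      by_contra h
      refine hne ?_
      rw [← one_mul x₀, ← hε.complete, Finset.sum_mul]
      refine Finset.sum_eq_zero fun i _ => ?_
      by_contra h'
      exact h ⟨ε i * x₀, N.mul_mem_left _ hx₀, h', i, by rw [← mul_assoc, (hε.idem i).eq]⟩
    obtain ⟨x, ⟨hx, hx0, i, hi⟩, hmin⟩ := exists_minimalFor_of_wellFoundedLT _ w hS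
    have hix : ε i * x * ε j = x := by rw [hi, hN x hx]
    have hgen : ∀ y ∈ N, ∃ a, a * x = y := by
      intro y hy
      have h : ∀ k, ∃ a, a * x = ε k * y := by
        intro k
        by_cases h0 : ε k * y = 0
        · exact ⟨0, by rw [zero_mul, h0]⟩
        have hy' := N.mul_mem_left (ε k) hy
        have hle : w x ≤ w (ε k * y) := by
          rcases le_total (w x) (w (ε k * y)) with h | h
          · exact h
          · exact hmin ⟨hy', h0, k, by rw [← mul_assoc, (hε.idem k).eq]⟩ h
        obtain ⟨z, hz⟩ := hdvd i j k x (ε k * y) hix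
          (by rw [hN _ (N.mul_mem_left _ hy'), ← mul_assoc, (hε.idem k).eq]) hx0 h0 hle
        exact ⟨z, hz.symm⟩
      choose a ha using h
      refine ⟨∑ k, a k, ?_⟩
      rw [Finset.sum_mul, Finset.sum_congr rfl fun k _ => ha k, ← Finset.sum_mul, hε.complete,
        one_mul]
    have huniq : ∀ a b, a * ε i = a → b * ε i = b → a * x = b * x → a = b := by
      intro a b ha hb h
      have := hreg i j x hix hx0 (a - b) (by rw [sub_mul, h, sub_self])
      rwa [sub_mul, ha, hb, sub_eq_zero] at this
    have hsec : ∀ y : N, ∃ a, a * ε i = a ∧ a * x = y := by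
      intro y
      obtain ⟨a, ha⟩ := hgen y y.2
      exact ⟨a * ε i, by rw [mul_assoc, (hε.idem i).eq], by rw [mul_assoc, hi, ha]⟩
    choose s hs₁ hs₂ using hsec
    refine Module.Projective.of_split (M := R)
      { toFun := s
        map_add' := fun y z => huniq _ _ (hs₁ _) (by rw [add_mul, hs₁, hs₁])
          (by rw [add_mul, hs₂, hs₂, hs₂]; rfl)
        map_smul' := fun r y => huniq _ _ (hs₁ _)
          (by rw [RingHom.id_apply, smul_eq_mul, mul_assoc, hs₁])
          (by rw [RingHom.id_apply, smul_eq_mul, mul_assoc, hs₂, hs₂]; rfl) }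
      ((LinearMap.toSpanSingleton R N ⟨x, hx⟩)) ?_
    ext y
    simpa using hs₂ y
  have key : ∀ (s : Finset ι) (I : Ideal R), (∀ x ∈ I, ∀ j ∉ s, x * ε j = 0) →
      Module.Projective R I := by
    intro s
    induction s using Finset.induction_on with
    | empty =>
      intro I hI
      have : I = ⊥ := (Submodule.eq_bot_iff _).2 fun x hx => by
        rw [← mul_one x, ← hε.complete, Finset.mul_sum]
        exact Finset.sum_eq_zero fun j _ => hI x hx j (by simp)
      subst this
      exact Module.Projective.of_free
    | insert j s hj ih =>
      intro I hI
      let f : I →ₗ[R] R := (LinearMap.toSpanSingleton R R (ε j)) ∘ₗ I.subtype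
      have hf : ∀ x, f x = x * ε j := fun x => rfl
      have h1 : Module.Projective R f.range := by
        refine hcyc j _ ?_
        rintro _ ⟨x, rfl⟩
        rw [hf, mul_assoc, (hε.idem j).eq]
      have h2 : Module.Projective R (f.ker.map I.subtype) := by
        refine ih _ ?_
        rintro _ ⟨x, hx, rfl⟩ k hk
        by_cases hkj : k = j
        · subst hkj
          exact hx
        · exact hI x x.2 k (by simp [hkj, hk])
      have h3 : Module.Projective R f.rangeRestrict.ker := by
        rw [LinearMap.ker_rangeRestrict]
        exact Module.Projective.of_equiv
          (Submodule.equivMapOfInjective I.subtype I.injective_subtype f.ker).symm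
      exact projective_of_surjective_of_ker f.rangeRestrict f.surjective_rangeRestrict
  exact key Finset.univ I fun x _ j hj => absurd (Finset.mem_univ j) hj

/-- The two-sided form of `projective_ideal_of_homogeneous_dvd`. -/
theorem isHereditaryRing_of_homogeneous_dvd {R ι : Type*} [Ring R] [Fintype ι] {ε : ι → R}
    (hε : CompleteOrthogonalIdempotents ε) (w : R → ℕ)
    (hdvd : ∀ i j k x y, ε i * x * ε j = x → ε k * y * ε j = y → x ≠ 0 → y ≠ 0 → w x ≤ w y →
      ∃ z, y = z * x)
    (hdvd' : ∀ i j k x y, ε j * x * ε i = x → ε j * y * ε k = y → x ≠ 0 → y ≠ 0 → w x ≤ w y →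
      ∃ z, y = x * z)
    (hreg : ∀ i j x, ε i * x * ε j = x → x ≠ 0 → ∀ a, a * x = 0 → a * ε i = 0)
    (hreg' : ∀ i j x, ε j * x * ε i = x → x ≠ 0 → ∀ a, x * a = 0 → ε i * a = 0) :
    IsHereditaryRing R := by
  refine ⟨projective_ideal_of_homogeneous_dvd hε w hdvd hreg, ?_⟩
  have hop : CompleteOrthogonalIdempotents fun i => MulOpposite.op (ε i) :=
    { idem := fun i => congrArg MulOpposite.op (hε.idem i)
      ortho := fun i j hij => congrArg MulOpposite.op (hε.ortho hij.symm)
      complete := MulOpposite.unop_injective (by simpa using hε.complete) }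
  refine projective_ideal_of_homogeneous_dvd hop (fun x => w x.unop) ?_ ?_
  · intro i j k x y hx hy hx0 hy0 hw
    obtain ⟨z, hz⟩ := hdvd' i j k x.unop y.unop
      (by simpa [mul_assoc] using congrArg MulOpposite.unop hx)
      (by simpa [mul_assoc] using congrArg MulOpposite.unop hy) (by simpa using hx0)
      (by simpa using hy0) hw
    exact ⟨MulOpposite.op z, MulOpposite.unop_injective hz⟩
  · intro i j x hx hx0 a ha
    exact MulOpposite.unop_injective (hreg' i j x.unop
      (by simpa [mul_assoc] using congrArg MulOpposite.unop hx) (by simpa using hx0) a.unop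
      (congrArg MulOpposite.unop ha))

end HereditaryCriterion

/-! ### Standard hereditary orders and their radicals -/

theorem eq_zero_of_idempotent_mem_jacobson {R : Type*} [Ring R] {e : R} (he : e * e = e)
    (h : e ∈ Ring.jacobson R) : e = 0 := by
  rw [← Ideal.jacobson_bot, Ideal.mem_jacobson_iff] at h
  obtain ⟨z, hz⟩ := h (-1)
  have hz' : z * (1 - e) = 1 := by
    rw [← sub_eq_zero, ← (Submodule.mem_bot _).1 hz]; noncomm_ring
  rw [← one_mul e, ← hz', mul_assoc, sub_mul, he, one_mul, sub_self, mul_zero]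

section Frame

variable {D : Type*} [DivisionRing D] {m : ℕ}

/-- The matrix of `a` with respect to the basis formed by the columns of `g`. -/
def coord (g : (Matrix (Fin m) (Fin m) D)ˣ) (a : Matrix (Fin m) (Fin m) D) :
    Matrix (Fin m) (Fin m) D := (↑g⁻¹ : Matrix (Fin m) (Fin m) D) * a * g.val

/-- The endomorphism with matrix `c E_{ij}` with respect to the basis formed by the columns of
`g`. -/
def elemMat (g : (Matrix (Fin m) (Fin m) D)ˣ) (i j : Fin m) (c : D) :
    Matrix (Fin m) (Fin m) D := g.val * Matrix.single i j c * (↑g⁻¹ : Matrix (Fin m) (Fin m) D)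

variable (g : (Matrix (Fin m) (Fin m) D)ˣ)

theorem coord_injective : Function.Injective (coord g) := fun a b h => by
  simpa [coord] using h

theorem coord_mul (a b : Matrix (Fin m) (Fin m) D) :
    coord g (a * b) = coord g a * coord g b := by
  simp [coord, mul_assoc]

theorem coord_add (a b : Matrix (Fin m) (Fin m) D) :
    coord g (a + b) = coord g a + coord g b := by
  simp [coord, mul_add, add_mul]

theorem coord_zero : coord g 0 = 0 := by simp [coord]

theorem coord_one : coord g 1 = 1 := by simp [coord]

theorem coord_smul {R : Type*} [CommRing R] [Algebra R D] (r : R) (a : Matrix (Fin m) (Fin m) D) :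
    coord g (r • a) = r • coord g a := by
  simp [coord]

theorem coord_elemMat (i j : Fin m) (c : D) : coord g (elemMat g i j c) = Matrix.single i j c := by
  simp [coord, elemMat, mul_assoc]

theorem elemMat_mul_elemMat (i j k : Fin m) (c d : D) :
    elemMat g i j c * elemMat g j k d = elemMat g i k (c * d) := by
  apply coord_injective g
  simp [coord_mul, coord_elemMat]

theorem elemMat_mul_elemMat_of_ne {i j k l : Fin m} (h : j ≠ k) (c d : D) :
    elemMat g i j c * elemMat g k l d = 0 := by
  apply coord_injective g
  rw [coord_mul, coord_elemMat, coord_elemMat, coord_zero, Matrix.single_mul_single_of_ne _ _ _ _ h]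

theorem sum_elemMat_coord (a : Matrix (Fin m) (Fin m) D) :
    ∑ p, ∑ q, elemMat g p q (coord g a p q) = a := by
  have h := Matrix.matrix_eq_sum_single (coord g a)
  apply coord_injective g
  conv_rhs => rw [h]
  simp only [coord, elemMat, Finset.mul_sum, Finset.sum_mul, mul_assoc]
  simp

theorem eq_elemMat_of_homogeneous {i j : Fin m} {x : Matrix (Fin m) (Fin m) D}
    (h : elemMat g i i 1 * x * elemMat g j j 1 = x) : x = elemMat g i j (coord g x i j) := by
  apply coord_injective g
  have := congrArg (coord g) h
  rw [coord_mul, coord_mul, coord_elemMat, coord_elemMat, Matrix.single_mul_mul_single] at this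
  rw [coord_elemMat]
  simpa using this.symm

theorem elemMat_ne_zero {i j : Fin m} {c : D} (hc : c ≠ 0) : elemMat g i j c ≠ 0 := fun h => by
  have := congrFun₂ (congrArg (coord g) h) i j
  rw [coord_elemMat, coord_zero] at this
  simp at this
  exact hc this

end Frame

section StandardOrders

variable (F : Type*) [Field F] [ValuativeRel F] [TopologicalSpace F] [IsNonarchimedeanLocalField F]
variable {D : Type*} [DivisionRing D] [Algebra F D] [FiniteDimensional F D] {m : ℕ}

/-- The lattice of all endomorphisms `a` with matrix entries satisfying
`n v(a_{pq}) + y_p - y_q ≥ k`, with respect to the basis formed by the columns of `g`. These are the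
endomorphisms that raise the norm `w ↦ min_i (n v(w_i) + y_i)` by at least `k`. -/
def stdLattice (g : (Matrix (Fin m) (Fin m) D)ˣ) (n : ℕ) (y : Fin m → ℤ) (k : ℤ) :
    Submodule 𝒪[F] (Matrix (Fin m) (Fin m) D) where
  carrier := {a | ∀ p q, valGE F n (y p - y q) k (coord g a p q)}
  zero_mem' := fun p q => by rw [coord_zero]; exact valGE_zero _ _ _
  add_mem' := fun ha hb p q => by rw [coord_add]; exact valGE_add (ha p q) (hb p q)
  smul_mem' := fun r a ha p q => by rw [coord_smul]; exact valGE_smul r (ha p q)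

variable {F}
variable {g : (Matrix (Fin m) (Fin m) D)ˣ} {n : ℕ} {y : Fin m → ℤ}

theorem mem_stdLattice {k : ℤ} {a : Matrix (Fin m) (Fin m) D} :
    a ∈ stdLattice F g n y k ↔ ∀ p q, valGE F n (y p - y q) k (coord g a p q) := Iff.rfl

theorem mul_mem_stdLattice {k l : ℤ} {a b : Matrix (Fin m) (Fin m) D}
    (ha : a ∈ stdLattice F g n y k) (hb : b ∈ stdLattice F g n y l) :
    a * b ∈ stdLattice F g n y (k + l) := fun p q => by
  rw [coord_mul, Matrix.mul_apply]
  exact valGE_sum _ fun i _ => valGE_mono (valGE_mul (ha p i) (hb i q)) (by omega)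

theorem stdLattice_anti {k l : ℤ} (h : k ≤ l) : stdLattice F g n y l ≤ stdLattice F g n y k :=
  fun _ ha p q => valGE_mono (ha p q) (by omega)

theorem one_mem_stdLattice : (1 : Matrix (Fin m) (Fin m) D) ∈ stdLattice F g n y 0 := fun p q => by
  rw [coord_one, Matrix.one_apply]
  split_ifs with h
  · subst h
    exact Or.inr (by simp [valD_one])
  · exact valGE_zero _ _ _

theorem elemMat_mem_stdLattice {k : ℤ} {i j : Fin m} {c : D} :
    elemMat g i j c ∈ stdLattice F g n y k ↔ valGE F n (y i - y j) k c := by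
  rw [mem_stdLattice, coord_elemMat]
  constructor
  · intro h
    simpa using h i j
  · intro h p q
    rw [Matrix.single_apply]
    split_ifs with hpq
    · obtain ⟨rfl, rfl⟩ := hpq
      exact h
    · exact valGE_zero _ _ _

variable (F g n y) in
/-- The standard order attached to the frame `g` and the exponents `y`. -/
def stdOrder : Subalgebra 𝒪[F] (Matrix (Fin m) (Fin m) D) where
  carrier := stdLattice F g n y 0
  mul_mem' := fun ha hb => mul_mem_stdLattice (k := 0) (l := 0) ha hb
  add_mem' := fun ha hb => add_mem ha hb
  algebraMap_mem' := fun r => by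
    rw [Algebra.algebraMap_eq_smul_one]
    exact Submodule.smul_mem _ _ one_mem_stdLattice

theorem toSubmodule_stdOrder :
    Subalgebra.toSubmodule (stdOrder F g n y) = stdLattice F g n y 0 := rfl

theorem exists_pow_smul_valGE (hn : 0 < n) (c k : ℤ) (a : D) :
    ∃ l : ℕ, valGE F n c k ((unifF F ^ l) • a) := by
  by_cases ha : a = 0
  · exact ⟨0, by simp [ha, valGE]⟩
  refine ⟨(k - c - n * valD F a).toNat, Or.inr ?_⟩
  rw [Algebra.smul_def, valD_mul (by simp [unifF_ne_zero]) ha,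
    valD_algebraMap (pow_ne_zero _ unifF_ne_zero), ordF_pow unifF_ne_zero, ordF_unifF, mul_one]
  have h1 := Int.self_le_toNat (k - c - n * valD F a)
  set t : ℤ := ((k - c - n * valD F a).toNat : ℤ)
  have ht : 0 ≤ t := by positivity
  have h2 : t ≤ ramD F D * t := le_mul_of_one_le_left ht ramD_pos
  have h3 : ramD F D * t ≤ n * (ramD F D * t) :=
    le_mul_of_one_le_left (ht.trans h2) (by exact_mod_cast hn)
  rw [mul_add]
  omega

theorem stdLattice_fg (hn : 0 < n) (k : ℤ) : (stdLattice F g n y k).FG := by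
  let E (p q : Fin m) : D →ₗ[𝒪[F]] Matrix (Fin m) (Fin m) D :=
    { toFun := elemMat g p q
      map_add' := fun a b => by simp [elemMat, Matrix.single_add, mul_add, add_mul]
      map_smul' := fun r a => by simp [elemMat, ← Matrix.smul_single] }
  let N : Submodule 𝒪[F] (Matrix (Fin m) (Fin m) D) :=
    ⨆ p, ⨆ q, (idealD F D (-((y p - y q - k) / n))).map (E p q)
  have hN : N.FG := Submodule.fg_iSup _ fun p => Submodule.fg_iSup _ fun q => (idealD_fg _).map _
  have : IsNoetherian 𝒪[F] N := isNoetherian_of_fg_of_noetherian _ hN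
  refine Submodule.FG.of_le hN fun a ha => ?_
  rw [← sum_elemMat_coord g a]
  refine sum_mem fun p _ => sum_mem fun q _ => ?_
  refine Submodule.mem_iSup_of_mem p (Submodule.mem_iSup_of_mem q ⟨_, ?_, rfl⟩)
  refine (ha p q).imp_right fun h => ?_
  have : -valD F (coord g a p q) ≤ (y p - y q - k) / n := by
    rw [Int.le_ediv_iff_mul_le (by exact_mod_cast hn)]
    linarith
  push_cast
  linarith

theorem span_stdOrder (hn : 0 < n) :
    Submodule.span F (stdOrder F g n y : Set (Matrix (Fin m) (Fin m) D)) = ⊤ := by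
  rw [eq_top_iff]
  intro a _
  rw [← sum_elemMat_coord g a]
  refine sum_mem fun p _ => sum_mem fun q _ => ?_
  obtain ⟨l, hl⟩ := exists_pow_smul_valGE (F := F) hn (y p - y q) 0 (coord g a p q)
  have h : elemMat g p q (coord g a p q) =
      (unifF F ^ l)⁻¹ • elemMat g p q ((unifF F ^ l) • coord g a p q) := by
    simp only [elemMat, ← Matrix.smul_single, mul_smul_comm, smul_mul_assoc]
    rw [smul_smul, inv_mul_cancel₀ (pow_ne_zero _ unifF_ne_zero), one_smul]
  rw [h]
  exact Submodule.smul_mem _ _ (Submodule.subset_span (elemMat_mem_stdLattice.2 hl))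

/-- The elements `c E_{ij}` of a standard order divide each other according to their size
`n v(c) + y_i - y_j`. -/
theorem stdOrder_hereditary : IsHereditaryRing (stdOrder F g n y) := by
  classical
  have hval : ∀ i : Fin m, elemMat g i i (1 : D) ∈ stdOrder F g n y := fun i =>
    elemMat_mem_stdLattice.2 (Or.inr (by simp [valD_one]))
  let ε : Fin m → stdOrder F g n y := fun i => ⟨elemMat g i i 1, hval i⟩
  have hε : CompleteOrthogonalIdempotents ε :=
    { idem := fun i => Subtype.ext (by
        change elemMat g i i 1 * elemMat g i i 1 = elemMat g i i 1
        rw [elemMat_mul_elemMat, one_mul])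
      ortho := fun i j hij => Subtype.ext (elemMat_mul_elemMat_of_ne g hij _ _)
      complete := Subtype.ext (by
        rw [AddSubmonoidClass.coe_finsetSum]
        conv_rhs => rw [← sum_elemMat_coord g ((1 : stdOrder F g n y) : Matrix _ _ D)]
        refine Finset.sum_congr rfl fun p _ => ?_
        rw [OneMemClass.coe_one, coord_one]
        rw [Finset.sum_eq_single p]
        · simp [ε]
        · intro q _ hq
          simp [Matrix.one_apply_ne hq.symm, elemMat]
        · simp) }
  -- the size of a homogeneous element is read off from its only nonzero matrix entry
  let w : stdOrder F g n y → ℕ := fun x => ∑ p, ∑ q,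
    if coord g (x : Matrix _ _ D) p q = 0 then 0 else
      (n * valD F (coord g (x : Matrix _ _ D) p q) + (y p - y q)).toNat
  have hw : ∀ (x : stdOrder F g n y) i j c, (x : Matrix _ _ D) = elemMat g i j c → c ≠ 0 →
      (w x : ℤ) = n * valD F c + (y i - y j) := by
    intro x i j c hx hc
    have h0 : valGE F n (y i - y j) 0 c := elemMat_mem_stdLattice.1 (hx ▸ x.2)
    have h1 : w x = (n * valD F c + (y i - y j)).toNat := by
      simp only [w, hx, coord_elemMat]
      rw [Finset.sum_eq_single i, Finset.sum_eq_single j]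
      · simp [hc]
      · intro q _ hq
        simp [hq.symm]
      · simp
      · intro p _ hp
        simp [hp.symm]
      · simp
    rw [h1, Int.toNat_of_nonneg (h0.resolve_left hc)]
  have hhom : ∀ i j (x : stdOrder F g n y), ε i * x * ε j = x → x ≠ 0 →
      ∃ c, c ≠ 0 ∧ (x : Matrix _ _ D) = elemMat g i j c := by
    intro i j x hx hx0
    have h := eq_elemMat_of_homogeneous g (congrArg Subtype.val hx)
    refine ⟨_, fun h0 => hx0 (Subtype.ext ?_), h⟩
    rw [h, h0]
    simp [elemMat]
  refine isHereditaryRing_of_homogeneous_dvd hε w ?_ ?_ ?_ ?_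
  · intro i j k x z hx hz hx0 hz0 hle
    obtain ⟨c, hc, hxc⟩ := hhom i j x hx hx0
    obtain ⟨d, hd, hzd⟩ := hhom k j z hz hz0
    refine ⟨⟨elemMat g k i (d * c⁻¹), elemMat_mem_stdLattice.2 (Or.inr ?_)⟩, Subtype.ext ?_⟩
    · have h1 := hw x i j c hxc hc
      have h2 := hw z k j d hzd hd
      rw [valD_mul hd (inv_ne_zero hc), valD_inv hc, mul_add, mul_neg]
      omega
    · change (z : Matrix _ _ D) = elemMat g k i (d * c⁻¹) * (x : Matrix _ _ D)
      rw [hxc, hzd, elemMat_mul_elemMat, inv_mul_cancel_right₀ hc]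
  · intro i j k x z hx hz hx0 hz0 hle
    obtain ⟨c, hc, hxc⟩ := hhom j i x hx hx0
    obtain ⟨d, hd, hzd⟩ := hhom j k z hz hz0
    refine ⟨⟨elemMat g i k (c⁻¹ * d), elemMat_mem_stdLattice.2 (Or.inr ?_)⟩, Subtype.ext ?_⟩
    · have h1 := hw x j i c hxc hc
      have h2 := hw z j k d hzd hd
      rw [valD_mul (inv_ne_zero hc) hd, valD_inv hc, mul_add, mul_neg]
      omega
    · change (z : Matrix _ _ D) = (x : Matrix _ _ D) * elemMat g i k (c⁻¹ * d)
      rw [hxc, hzd, elemMat_mul_elemMat, mul_inv_cancel_left₀ hc]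
  · intro i j x hx hx0 a ha
    obtain ⟨c, hc, hxc⟩ := hhom i j x hx hx0
    have ha : (a : Matrix (Fin m) (Fin m) D) * x.val = 0 := congrArg Subtype.val ha
    refine Subtype.ext ?_
    change (a : Matrix _ _ D) * elemMat g i i 1 = 0
    rw [← mul_inv_cancel₀ hc, ← elemMat_mul_elemMat g i j i, ← hxc, ← mul_assoc, ha, zero_mul]
  · intro i j x hx hx0 a ha
    obtain ⟨c, hc, hxc⟩ := hhom j i x hx hx0
    have ha : (x : Matrix (Fin m) (Fin m) D) * a.val = 0 := congrArg Subtype.val ha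
    refine Subtype.ext ?_
    change elemMat g i i 1 * (a : Matrix _ _ D) = 0
    rw [← inv_mul_cancel₀ hc, ← elemMat_mul_elemMat g i j i, ← hxc, mul_assoc, ha, mul_zero]

theorem isHereditaryOrder_stdOrder (hn : 0 < n) : IsHereditaryOrder (stdOrder F g n y) :=
  ⟨stdLattice_fg hn 0, span_stdOrder hn, stdOrder_hereditary⟩

theorem exists_mem_stdLattice (a : Matrix (Fin m) (Fin m) D) :
    ∃ k : ℕ, a ∈ stdLattice F g n y (-k) := by
  have h : ∀ p q, ∃ k : ℕ, valGE F n (y p - y q) (-k) (coord g a p q) := fun p q =>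
    ⟨(-(n * valD F (coord g a p q) + (y p - y q))).toNat, Or.inr (by
      have := Int.self_le_toNat (-(n * valD F (coord g a p q) + (y p - y q))); omega)⟩
  choose k hk using h
  refine ⟨∑ p, ∑ q, k p q, fun p q => valGE_mono (hk p q) ?_⟩
  have h1 : k p q ≤ ∑ q, k p q := Finset.single_le_sum (fun _ _ => Nat.zero_le _)
    (Finset.mem_univ q)
  have h2 : ∑ q, k p q ≤ ∑ p, ∑ q, k p q :=
    Finset.single_le_sum (f := fun p => ∑ q, k p q) (fun _ _ => Nat.zero_le _) (Finset.mem_univ p)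
  omega

theorem eq_zero_of_mem_stdLattice {a : Matrix (Fin m) (Fin m) D}
    (h : ∀ k : ℕ, a ∈ stdLattice F g n y k) : a = 0 := by
  apply coord_injective g
  rw [coord_zero]
  ext p q
  by_contra h0
  have := (h ((n * valD F (coord g a p q) + (y p - y q)).toNat + 1) p q).resolve_left h0
  have := Int.self_le_toNat (n * valD F (coord g a p q) + (y p - y q))
  push_cast at *
  omega

/-- The powers of `x` tend to `0`, so that `1 + x` is right regular and hence invertible in the
artinian ring `M_m(D)`. The equation `u = 1 - u x` then improves the level of the inverse `u` one by
one until it reaches `0`. -/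
theorem exists_inverse_one_add {x : Matrix (Fin m) (Fin m) D} (hx : x ∈ stdLattice F g n y 1) :
    ∃ u ∈ stdLattice F g n y 0, u * (1 + x) = 1 := by
  have hreg : IsRightRegular (1 + x) := by
    refine isRightRegular_of_non_zero_divisor _ fun a ha => ?_
    obtain ⟨k₀, hk₀⟩ := exists_mem_stdLattice (F := F) (g := g) (n := n) (y := y) a
    have hk : ∀ j : ℕ, a ∈ stdLattice F g n y (-k₀ + j) := fun j => by
      induction j with
      | zero => simpa using hk₀
      | succ j ih =>
        rw [mul_add, mul_one, add_eq_zero_iff_eq_neg] at ha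
        rw [ha]
        have := neg_mem (mul_mem_stdLattice ih hx)
        rwa [add_assoc] at this
    exact eq_zero_of_mem_stdLattice fun k => by
      have := hk (k₀ + k)
      push_cast at this
      rwa [neg_add_cancel_left] at this
  obtain ⟨u, hu⟩ := (IsArtinianRing.isUnit_iff_isRightRegular.2 hreg).exists_left_inv
  refine ⟨u, ?_, hu⟩
  obtain ⟨k₀, hk₀⟩ := exists_mem_stdLattice (F := F) (g := g) (n := n) (y := y) u
  have hk : ∀ j : ℕ, j ≤ k₀ → u ∈ stdLattice F g n y (-k₀ + j) := fun j => by
    induction j with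
    | zero => intro _; simpa using hk₀
    | succ j ih =>
      intro hj
      have h1 : u = 1 - u * x := by rw [← hu]; noncomm_ring
      rw [h1]
      refine sub_mem (stdLattice_anti (by push_cast; omega) one_mem_stdLattice) ?_
      have := mul_mem_stdLattice (ih (by omega)) hx
      rwa [add_assoc] at this
  simpa using hk k₀ le_rfl

theorem radical_stdOrder : radical (stdOrder F g n y) = stdLattice F g n y 1 := by
  ext x
  rw [mem_radical]
  constructor
  · rintro ⟨hx, hj⟩ p q
    by_contra hlt
    rw [valGE, not_or] at hlt
    obtain ⟨h0, hlt⟩ := hlt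
    have hge := (hx p q).resolve_left h0
    -- otherwise the idempotent `E_{qq}` lies in the Jacobson radical
    set c := coord g x p q with hc
    have hz : elemMat g q p c⁻¹ ∈ stdOrder F g n y := elemMat_mem_stdLattice.2 (Or.inr (by
      rw [valD_inv h0, mul_neg]; omega))
    have he : elemMat g q q (1 : D) ∈ stdOrder F g n y :=
      elemMat_mem_stdLattice.2 (Or.inr (by simp [valD_one]))
    have h1 : (⟨elemMat g q q 1, he⟩ : stdOrder F g n y) ∈ Ring.jacobson (stdOrder F g n y) := by
      have h2 := Ideal.mul_mem_left (Ring.jacobson (stdOrder F g n y)) ⟨_, hz⟩ hj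
      have h3 := Ideal.mul_mem_right ⟨_, he⟩ (Ring.jacobson (stdOrder F g n y)) h2
      convert h3 using 1
      refine Subtype.ext ?_
      change elemMat g q q 1 = elemMat g q p c⁻¹ * x * elemMat g q q 1
      apply coord_injective g
      rw [coord_mul, coord_mul, coord_elemMat, coord_elemMat, Matrix.single_mul_mul_single, ← hc,
        inv_mul_cancel₀ h0, one_mul]
    have := eq_zero_of_idempotent_mem_jacobson (Subtype.ext (by
      change elemMat g q q 1 * elemMat g q q 1 = elemMat g q q 1
      rw [elemMat_mul_elemMat, one_mul])) h1
    exact elemMat_ne_zero g one_ne_zero (congrArg Subtype.val this)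
  · intro hx
    refine ⟨stdLattice_anti (by omega) hx, ?_⟩
    rw [← Ideal.jacobson_bot, Ideal.mem_jacobson_iff]
    rintro ⟨z, hz⟩
    have hzx : z * x ∈ stdLattice F g n y 1 := by
      simpa using mul_mem_stdLattice (k := 0) hz hx
    obtain ⟨u, hu, h⟩ := exists_inverse_one_add hzx
    refine ⟨⟨u, hu⟩, (Submodule.mem_bot _).2 (Subtype.ext ?_)⟩
    change u * z * x + u - 1 = 0
    rw [← h]; noncomm_ring

/-- Every residue class modulo `n` contains some `y i`; equivalently, the norm
`w ↦ min_i (n v(w_i) + y_i)` takes all integral values. -/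
def HitsResidues (n : ℕ) (y : Fin m → ℤ) : Prop := ∀ k : ℤ, ∃ i, (n : ℤ) ∣ k - y i

theorem HitsResidues.exists_valD (hy : HitsResidues n y) (p : Fin m) (k : ℤ) :
    ∃ (s : Fin m) (c : D), c ≠ 0 ∧ n * valD F c + (y p - y s) = k := by
  obtain ⟨s, v, hv⟩ := hy (y p - k)
  obtain ⟨c, hc, hcv⟩ := exists_valD_eq F D (-v)
  refine ⟨s, c, hc, ?_⟩
  have : (n : ℤ) * valD F c = - (n * v) := by rw [hcv]; ring
  omega

/-- In every row there is an elementary matrix of exact level `1`, by which the entries of this row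
can be divided. -/
theorem stdLattice_succ_le (hy : HitsResidues n y) (k : ℤ) :
    stdLattice F g n y (1 + k) ≤ stdLattice F g n y 1 * stdLattice F g n y k := by
  intro a ha
  rw [← sum_elemMat_coord g a]
  refine sum_mem fun p _ => sum_mem fun q _ => ?_
  obtain ⟨s, c, hc, h⟩ := hy.exists_valD (F := F) (D := D) p 1
  rw [show coord g a p q = c * (c⁻¹ * coord g a p q) by rw [mul_inv_cancel_left₀ hc],
    ← elemMat_mul_elemMat g p s q]
  refine Submodule.mul_mem_mul (elemMat_mem_stdLattice.2 (Or.inr h.ge))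
    (elemMat_mem_stdLattice.2 ?_)
  have h1 : valGE F n (y s - y p) (-1) c⁻¹ := Or.inr (by
    rw [valD_inv hc, mul_neg]; omega)
  exact valGE_mono (valGE_mul h1 (ha p q)) (by omega)

theorem radical_stdOrder_pow (hy : HitsResidues n y) (k : ℕ) :
    radical (stdOrder F g n y) ^ (k + 1) = stdLattice F g n y (k + 1) := by
  induction k with
  | zero => simp [radical_stdOrder]
  | succ k ih =>
    rw [pow_succ', ih, radical_stdOrder]
    refine le_antisymm (Submodule.mul_le.2 fun a ha b hb => ?_) ?_
    · have := mul_mem_stdLattice ha hb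
      convert this using 2
      push_cast; ring
    · have := stdLattice_succ_le (F := F) (g := g) hy (k + 1)
      convert this using 2
      push_cast; ring

theorem maximalIdeal_smul_stdOrder :
    𝓂[F] • Subalgebra.toSubmodule (stdOrder F g n y) =
      stdLattice F g n y ((n * ramD F D : ℕ) : ℤ) := by
  rw [maximalIdeal_eq, Submodule.ideal_span_singleton_smul, toSubmodule_stdOrder]
  have hval : ∀ c : D, c ≠ 0 → valD F (unifF F • c) = ramD F D + valD F c := fun c hc => by
    rw [Algebra.smul_def, valD_mul (by simp [unifF_ne_zero]) hc, valD_algebraMap unifF_ne_zero,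
      ordF_unifF, mul_one]
  ext a
  rw [Submodule.mem_smul_pointwise_iff_exists]
  constructor
  · rintro ⟨b, hb, rfl⟩ p q
    rw [coord_smul]
    change valGE F n _ _ (unifF F • coord g b p q)
    rcases hb p q with h | h
    · rw [h, smul_zero]; exact valGE_zero _ _ _
    by_cases h0 : coord g b p q = 0
    · rw [h0, smul_zero]; exact valGE_zero _ _ _
    right
    rw [hval _ h0, mul_add]
    push_cast
    omega
  · intro ha
    refine ⟨(unifF F)⁻¹ • a, fun p q => ?_, ?_⟩
    · rw [coord_smul]
      change valGE F n _ _ ((unifF F)⁻¹ • coord g a p q)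
      by_cases h0 : coord g a p q = 0
      · rw [h0, smul_zero]; exact valGE_zero _ _ _
      right
      have h1 := (ha p q).resolve_left h0
      have h2 := hval ((unifF F)⁻¹ • coord g a p q)
        (smul_ne_zero (inv_ne_zero unifF_ne_zero) h0)
      rw [smul_inv_smul₀ unifF_ne_zero] at h2
      rw [h2, mul_add] at h1
      push_cast at h1
      omega
    · change unifF F • (unifF F)⁻¹ • a = a
      rw [smul_inv_smul₀ unifF_ne_zero]

theorem stdLattice_injective (hm : 0 < m) (hy : HitsResidues n y) :
    Function.Injective (stdLattice F g n y) := by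
  have key : ∀ k l, stdLattice F g n y k ≤ stdLattice F g n y l → l ≤ k := fun k l h => by
    obtain ⟨s, c, hc, hk⟩ := hy.exists_valD (F := F) (D := D) ⟨0, hm⟩ k
    have h1 := h (elemMat_mem_stdLattice.2 (Or.inr hk.ge) :
      elemMat g ⟨0, hm⟩ s c ∈ stdLattice F g n y k)
    have := (elemMat_mem_stdLattice.1 h1).resolve_left hc
    omega
  exact fun k l h => le_antisymm (key l k h.ge) (key k l h.le)

theorem ramificationIndex_stdOrder (hm : 0 < m) (hn : 0 < n) (hy : HitsResidues n y) :
    ramificationIndex (stdOrder F g n y) = n * ramD F D := by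
  have hpos : 0 < n * ramD F D := Nat.mul_pos hn (by exact_mod_cast ramD_pos (F := F) (D := D))
  have : {e : ℕ | 0 < e ∧ 𝓂[F] • Subalgebra.toSubmodule (stdOrder F g n y) =
      radical (stdOrder F g n y) ^ e} = {n * ramD F D} := by
    ext e
    rw [Set.mem_ofPred_eq, maximalIdeal_smul_stdOrder, Set.mem_singleton_iff]
    constructor
    · rintro ⟨he, h⟩
      obtain ⟨k, rfl⟩ := Nat.exists_eq_succ_of_ne_zero he.ne'
      rw [Nat.succ_eq_add_one, radical_stdOrder_pow hy] at h
      exact_mod_cast (stdLattice_injective hm hy h).symm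
    · rintro rfl
      obtain ⟨k, hk⟩ := Nat.exists_eq_succ_of_ne_zero hpos.ne'
      refine ⟨hpos, ?_⟩
      rw [hk, Nat.succ_eq_add_one, radical_stdOrder_pow hy]
      push_cast
      rfl
  rw [ramificationIndex, this, csInf_singleton]

theorem mem_U_stdOrder (hy : HitsResidues n y) (j : ℕ) {h : (Matrix (Fin m) (Fin m) D)ˣ} :
    h ∈ U (stdOrder F g n y) (j + 1) ↔
      (h : Matrix (Fin m) (Fin m) D) - 1 ∈ stdLattice F g n y (j + 1) := by
  rw [← radical_stdOrder_pow hy]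
  rfl

end StandardOrders

/-! ### Lattices over a hereditary order -/

section OrderLattices

open scoped Matrix.Module

variable {F : Type*} [Field F] [ValuativeRel F] [TopologicalSpace F] [IsNonarchimedeanLocalField F]
variable {D : Type*} [DivisionRing D] [Algebra F D] [FiniteDimensional F D] {m : ℕ}
variable {𝔄 : Subalgebra 𝒪[F] (Matrix (Fin m) (Fin m) D)}

/-- A hereditary order is bounded. -/
theorem IsHereditaryOrder.exists_le_stdLattice (h : IsHereditaryOrder 𝔄) :
    ∃ s : ℕ, Subalgebra.toSubmodule 𝔄 ≤ stdLattice F 1 1 0 (-s) := by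
  obtain ⟨S, hS⟩ := h.fg
  choose k hk using exists_mem_stdLattice (F := F) (D := D) (g := 1) (n := 1) (y := (0 : Fin m → ℤ))
  refine ⟨∑ a ∈ S, k a, ?_⟩
  rw [← hS, Submodule.span_le]
  intro a ha
  refine stdLattice_anti ?_ (hk a)
  have := Finset.single_le_sum (f := k) (fun _ _ => Nat.zero_le _) ha
  omega

theorem IsHereditaryOrder.exists_pow_smul_mem (h : IsHereditaryOrder 𝔄)
    (a : Matrix (Fin m) (Fin m) D) : ∃ l : ℕ, ∀ k, l ≤ k → (unifF F ^ k) • a ∈ 𝔄 := by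
  have hF : ∀ f : F, ∃ l : ℕ, ∀ k, l ≤ k → unifF F ^ k * f ∈ 𝒪[F] := by
    intro f
    by_cases hf : f = 0
    · exact ⟨0, fun k _ => by rw [hf, mul_zero]; exact zero_mem _⟩
    refine ⟨(-ordF F f).toNat, fun k hk => ?_⟩
    rw [mem_integer_iff (mul_ne_zero (pow_ne_zero _ unifF_ne_zero) hf),
      ordF_mul (pow_ne_zero _ unifF_ne_zero) hf, ordF_pow unifF_ne_zero, ordF_unifF]
    omega
  have ha : a ∈ Submodule.span F (𝔄 : Set (Matrix (Fin m) (Fin m) D)) := by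
    rw [h.span_eq_top]; trivial
  have hO : ∀ (x : 𝒪[F]) b, b ∈ 𝔄 → (x : F) • b ∈ 𝔄 := fun x b hb => 𝔄.smul_mem hb x
  have hfa : ∀ (f : F) b, b ∈ 𝔄 → ∃ l : ℕ, ∀ k, l ≤ k → (unifF F ^ k) • f • b ∈ 𝔄 := by
    intro f b hb
    obtain ⟨l, hl⟩ := hF f
    refine ⟨l, fun k hk => ?_⟩
    rw [smul_smul]
    exact hO ⟨_, hl k hk⟩ b hb
  induction ha using Submodule.span_induction with
  | mem x hx => simpa using hfa 1 x hx
  | zero => exact ⟨0, fun k _ => by rw [smul_zero]; exact zero_mem _⟩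
  | add x z _ _ hx hz =>
    obtain ⟨l, hl⟩ := hx
    obtain ⟨l', hl'⟩ := hz
    refine ⟨max l l', fun k hk => ?_⟩
    rw [smul_add]
    exact add_mem (hl k (le_trans (le_max_left _ _) hk)) (hl' k (le_trans (le_max_right _ _) hk))
  | smul f x _ hx =>
    obtain ⟨l, hl⟩ := hx
    obtain ⟨l', hl'⟩ := hfa f _ (hl l le_rfl)
    refine ⟨l + l', fun k hk => ?_⟩
    have := hl' (k - l) (by omega)
    rw [smul_comm f, smul_smul, ← pow_add] at this
    rwa [show k - l + l = k by omega] at this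

/-- A hereditary order is open. -/
theorem IsHereditaryOrder.exists_stdLattice_le (h : IsHereditaryOrder 𝔄) :
    ∃ t : ℕ, stdLattice F 1 1 0 t ≤ Subalgebra.toSubmodule 𝔄 := by
  obtain ⟨S, hS⟩ := stdLattice_fg (F := F) (D := D) (g := 1) (n := 1) (y := (0 : Fin m → ℤ))
    one_pos 0
  choose l hl using h.exists_pow_smul_mem
  set L := ∑ a ∈ S, l a
  have h1 : ∀ a ∈ stdLattice F (1 : (Matrix (Fin m) (Fin m) D)ˣ) 1 0 0, (unifF F ^ L) • a ∈ 𝔄 := by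
    intro a ha
    rw [← hS] at ha
    induction ha using Submodule.span_induction with
    | mem x hx => exact hl x L (Finset.single_le_sum (f := l) (fun _ _ => Nat.zero_le _) hx)
    | zero => rw [smul_zero]; exact zero_mem _
    | add x z _ _ hx hz => rw [smul_add]; exact add_mem hx hz
    | smul f x _ hx => rw [smul_comm]; exact 𝔄.smul_mem hx f
  have hu : unifF F ^ L ≠ 0 := pow_ne_zero _ unifF_ne_zero
  refine ⟨ramD F D * L, fun a ha => ?_⟩
  have h2 := h1 ((unifF F ^ L)⁻¹ • a) fun p q => by
    rw [coord_smul, Matrix.smul_apply]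
    rcases ha p q with h0 | h0
    · rw [h0, smul_zero]; exact valGE_zero _ _ _
    by_cases hc : coord 1 a p q = 0
    · rw [hc, smul_zero]; exact valGE_zero _ _ _
    right
    rw [Algebra.smul_def, valD_mul (by simp [unifF_ne_zero]) hc, valD_algebraMap (inv_ne_zero hu),
      ordF_inv hu, ordF_pow unifF_ne_zero, ordF_unifF]
    push_cast at h0 ⊢
    linarith
  rwa [smul_inv_smul₀ hu] at h2

theorem coord_one_left (a : Matrix (Fin m) (Fin m) D) : coord 1 a = a := by simp [coord]

theorem orderSmul_def (a : 𝔄) (w : Fin m → D) : a • w = (a : Matrix (Fin m) (Fin m) D) • w := rfl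

theorem matSmul_apply (a : Matrix (Fin m) (Fin m) D) (w : Fin m → D) (i : Fin m) :
    (a • w) i = ∑ j, a i j * w j := rfl

/-- A finitely generated `𝔄`-submodule of `D^m` is bounded. -/
theorem IsHereditaryOrder.exists_bound (h : IsHereditaryOrder 𝔄) {N : Submodule 𝔄 (Fin m → D)}
    (hN : N.FG) : ∃ s : ℕ, ∀ w ∈ N, ∀ i, valGE F 1 0 (-s) (w i) := by
  obtain ⟨s, hs⟩ := h.exists_le_stdLattice
  obtain ⟨S, rfl⟩ := hN
  obtain ⟨t, ht⟩ : ∃ t : ℕ, ∀ w ∈ S, ∀ i, valGE F 1 0 (-t) (w i) := by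
    have h1 : ∀ (w : Fin m → D) i, ∃ k : ℕ, -valD F (w i) ≤ k := fun w i =>
      ⟨_, Int.self_le_toNat _⟩
    choose k hk using h1
    refine ⟨S.sup fun w => Finset.univ.sup (k w), fun w hw i => Or.inr ?_⟩
    have h2 : k w i ≤ S.sup fun w => Finset.univ.sup (k w) :=
      (Finset.le_sup (f := k w) (Finset.mem_univ i)).trans
        (Finset.le_sup (f := fun w => Finset.univ.sup (k w)) hw)
    generalize (S.sup fun w => Finset.univ.sup (k w)) = t at h2
    have := hk w i
    push_cast
    omega
  refine ⟨s + t, fun w hw => ?_⟩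
  have key : ∀ a : 𝔄, ∀ i, valGE F 1 0 (-((s + t : ℕ) : ℤ)) ((a • w) i) := by
    induction hw using Submodule.span_induction with
    | mem x hx =>
      intro a i
      rw [orderSmul_def, matSmul_apply]
      refine valGE_sum _ fun j _ => ?_
      have := hs a.2 i j
      rw [coord_one_left] at this
      exact valGE_mono (valGE_mul this (ht x hx j)) (by simp)
    | zero => intro a i; rw [smul_zero]; exact valGE_zero _ _ _
    | add x z _ _ hx hz => intro a i; rw [smul_add]; exact valGE_add (hx a i) (hz a i)
    | smul b x _ hx => intro a i; rw [smul_smul]; exact hx _ i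
  simpa using key 1

/-- A nonzero `𝔄`-submodule of `D^m` contains all sufficiently small vectors. -/
theorem IsHereditaryOrder.exists_small_mem (h : IsHereditaryOrder 𝔄) {N : Submodule 𝔄 (Fin m → D)}
    (hN : N ≠ ⊥) : ∃ t : ℕ, ∀ w : Fin m → D, (∀ i, valGE F 1 0 t (w i)) → w ∈ N := by
  obtain ⟨t, ht⟩ := h.exists_stdLattice_le
  obtain ⟨x, hx, hx0⟩ := (Submodule.ne_bot_iff _).1 hN
  obtain ⟨k, hk⟩ := Function.ne_iff.1 hx0
  have hk : x k ≠ 0 := hk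
  refine ⟨t + (valD F (x k)).toNat, fun w hw => ?_⟩
  let a : Matrix (Fin m) (Fin m) D := Matrix.of fun i j => if j = k then w i * (x k)⁻¹ else 0
  have ha : a ∈ 𝔄 := ht fun p q => by
    rw [coord_one_left]
    simp only [a, Matrix.of_apply]
    split_ifs with hq
    · refine valGE_mono (valGE_mul (hw p) (c' := 0) (k' := -valD F (x k)) (Or.inr ?_)) ?_
      · rw [valD_inv hk]; simp
      · have := Int.self_le_toNat (valD F (x k))
        simp only [Pi.zero_apply]; push_cast; omega
    · exact valGE_zero _ _ _
  have hw' : (⟨a, ha⟩ : 𝔄) • x = w := by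
    rw [orderSmul_def]
    ext i
    rw [matSmul_apply, Finset.sum_eq_single k]
    · simp [a, hk]
    · intro j _ hj; simp [a, hj]
    · simp
  rw [← hw']
  exact N.smul_mem _ hx

/-- An `𝔄`-linear map from a submodule of `D^m` to a module over the whole matrix algebra commutes
with the matrix algebra wherever this makes sense. -/
theorem IsHereditaryOrder.map_smul_of_mem (h : IsHereditaryOrder 𝔄) {X : Type*} [AddCommGroup X]
    [Module (Matrix (Fin m) (Fin m) D) X] {N : Submodule 𝔄 (Fin m → D)} (f : N →ₗ[𝔄] X)
    (a : Matrix (Fin m) (Fin m) D) (w : N) (haw : a • (w : Fin m → D) ∈ N) :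
    f ⟨a • (w : Fin m → D), haw⟩ = a • f w := by
  obtain ⟨l₁, h₁⟩ := h.exists_pow_smul_mem a
  obtain ⟨l₂, h₂⟩ := h.exists_pow_smul_mem 1
  set u := unifF F ^ (max l₁ l₂)
  have hu0 : u ≠ 0 := pow_ne_zero _ unifF_ne_zero
  have hu : u • (1 : Matrix (Fin m) (Fin m) D) ∈ 𝔄 := h₂ _ (le_max_right _ _)
  have hua : u • a ∈ 𝔄 := h₁ _ (le_max_left _ _)
  have e1 : (⟨u • 1, hu⟩ : 𝔄) • f ⟨a • (w : Fin m → D), haw⟩ = (⟨u • a, hua⟩ : 𝔄) • f w := by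
    rw [← f.map_smul, ← f.map_smul]
    congr 1
    refine Subtype.ext ?_
    change (u • (1 : Matrix (Fin m) (Fin m) D)) • a • (w : Fin m → D) = (u • a) • (w : Fin m → D)
    rw [smul_smul, smul_mul_assoc, one_mul]
  change (u • (1 : Matrix (Fin m) (Fin m) D)) • f ⟨a • (w : Fin m → D), haw⟩ = (u • a) • f w at e1
  have e2 := congrArg (fun x => (u⁻¹ • (1 : Matrix (Fin m) (Fin m) D)) • x) e1
  simp only [smul_smul, smul_mul_assoc, one_mul] at e2
  rwa [inv_mul_cancel₀ hu0, one_smul, one_smul, one_smul] at e2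

/-- The right multiplication by `d` on `D^m`. -/
def rightMul (𝔄 : Subalgebra 𝒪[F] (Matrix (Fin m) (Fin m) D)) (d : D) :
    (Fin m → D) →ₗ[𝔄] (Fin m → D) where
  toFun w i := w i * d
  map_add' w z := by ext i; exact add_mul _ _ _
  map_smul' a w := by
    ext i
    rw [RingHom.id_apply, orderSmul_def, orderSmul_def, matSmul_apply, matSmul_apply,
      Finset.sum_mul]
    simp only [mul_assoc]

theorem rightMul_apply (d : D) (w : Fin m → D) (i : Fin m) : rightMul 𝔄 d w i = w i * d := rfl

/-- The endomorphisms of the simple module `D^m` are the right multiplications. -/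
theorem IsHereditaryOrder.exists_rightMul (h : IsHereditaryOrder 𝔄)
    {N : Submodule 𝔄 (Fin m → D)} (hN : N ≠ ⊥) (f : N →ₗ[𝔄] (Fin m → D)) :
    ∃ d : D, ∀ w : N, f w = rightMul 𝔄 d w := by
  obtain ⟨x, hx, hx0⟩ := (Submodule.ne_bot_iff _).1 hN
  obtain ⟨k, hk⟩ := Function.ne_iff.1 hx0
  have hk : x k ≠ 0 := hk
  refine ⟨(x k)⁻¹ * f ⟨x, hx⟩ k, fun w => ?_⟩
  let a : Matrix (Fin m) (Fin m) D :=
    Matrix.of fun i j => if j = k then (w : Fin m → D) i * (x k)⁻¹ else 0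
  have ha : ∀ (z : Fin m → D) i, (a • z) i = (w : Fin m → D) i * (x k)⁻¹ * z k := fun z i => by
    rw [matSmul_apply, Finset.sum_eq_single k]
    · simp [a]
    · intro j _ hj; simp [a, hj]
    · simp
  have haw : a • x = (w : Fin m → D) := by
    ext i
    rw [ha, inv_mul_cancel_right₀ hk]
  have h2 := h.map_smul_of_mem f a ⟨x, hx⟩ (by rw [haw]; exact w.2)
  have h3 : (⟨a • x, by rw [haw]; exact w.2⟩ : N) = w := Subtype.ext haw
  rw [h3] at h2
  rw [h2]
  ext i
  rw [ha, rightMul_apply, mul_assoc]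

/-- Lattices in `D^m` over a hereditary order are isomorphic to left ideals, hence projective. -/
theorem IsHereditaryOrder.projective (h : IsHereditaryOrder 𝔄) {N : Submodule 𝔄 (Fin m → D)}
    (hN : N.FG) (i₀ : Fin m) : Module.Projective 𝔄 N := by
  obtain ⟨t, ht⟩ := h.exists_stdLattice_le
  obtain ⟨s, hs⟩ := h.exists_bound hN
  obtain ⟨c, hc, hcv⟩ := exists_valD_eq F D (s + t)
  let M (w : Fin m → D) : Matrix (Fin m) (Fin m) D :=
    Matrix.of fun i j => if j = i₀ then w i * c else 0
  have hM : ∀ w : N, M w ∈ 𝔄 := fun w => ht fun p q => by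
    rw [coord_one_left]
    simp only [M, Matrix.of_apply]
    split_ifs with hq
    · exact valGE_mono (valGE_mul (hs w w.2 p) (c' := 0) (k' := s + t) (Or.inr (by simp [hcv])))
        (by simp)
    · exact valGE_zero _ _ _
  let θ : N →ₗ[𝔄] 𝔄 :=
    { toFun := fun w => ⟨M w, hM w⟩
      map_add' := fun w z => by
        refine Subtype.ext ?_
        change M (w + z) = M w + M z
        ext i j
        simp only [M, Matrix.of_apply, Matrix.add_apply, Pi.add_apply]
        split_ifs
        · rw [add_mul]
        · rw [add_zero]
      map_smul' := fun a w => by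
        refine Subtype.ext ?_
        change M ((a : Matrix (Fin m) (Fin m) D) • (w : Fin m → D)) = a.1 * M w
        ext i j
        simp only [M, Matrix.of_apply, Matrix.mul_apply, matSmul_apply]
        split_ifs
        · rw [Finset.sum_mul]; simp only [mul_assoc]
        · simp }
  have hθ : Function.Injective θ := by
    intro w z hwz
    refine Subtype.ext (funext fun i => ?_)
    have h1 : M w = M z := congrArg Subtype.val hwz
    have := congrFun₂ h1 i i₀
    simpa [M, hc] using this
  have : Module.Projective 𝔄 (LinearMap.range θ) := h.hereditary.1 _
  exact Module.Projective.of_equiv (LinearEquiv.ofInjective θ hθ).symm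

/-- Otherwise the powers of `d` would move a nonzero vector of `N` out of every bounded set. -/
theorem valGE_nonneg_of_preserves (h : IsHereditaryOrder 𝔄) {N : Submodule 𝔄 (Fin m → D)}
    (hfg : N.FG) (hN : N ≠ ⊥) {d : D} (hd : ∀ w ∈ N, rightMul 𝔄 d w ∈ N) : valGE F 1 0 0 d := by
  by_contra hlt
  rw [valGE, not_or] at hlt
  obtain ⟨hd0, hlt⟩ := hlt
  obtain ⟨s, hs⟩ := h.exists_bound hfg
  obtain ⟨x, hx, hx0⟩ := (Submodule.ne_bot_iff _).1 hN
  obtain ⟨k, hk⟩ := Function.ne_iff.1 hx0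
  have hk : x k ≠ 0 := hk
  have hpow : ∀ j : ℕ, (fun i => x i * d ^ j) ∈ N := fun j => by
    induction j with
    | zero => simpa using hx
    | succ j ih =>
      have := hd _ ih
      convert this using 1
      ext i
      rw [rightMul_apply, pow_succ, mul_assoc]
  have h1 := (hs _ (hpow (s + (valD F (x k)).toNat + 1)) k).resolve_left
    (mul_ne_zero hk (pow_ne_zero _ hd0))
  rw [valD_mul hk (pow_ne_zero _ hd0), valD_pow hd0] at h1
  have h2 := Int.self_le_toNat (valD F (x k))
  have h3 : (((s + (valD F (x k)).toNat + 1 : ℕ)) : ℤ) * valD F d ≤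
      (((s + (valD F (x k)).toNat + 1 : ℕ)) : ℤ) * (-1) :=
    mul_le_mul_of_nonneg_left (by simp at hlt; omega) (by positivity)
  push_cast at h1 h3
  omega

/-- If `v(d) = 0` then `d` maps a lattice onto any lattice that contains its image: modulo small
vectors, `d` has finite order. -/
theorem IsHereditaryOrder.le_of_rightMul_mem (h : IsHereditaryOrder 𝔄)
    {M N : Submodule 𝔄 (Fin m → D)} (hfg : M.FG) (hN : N ≠ ⊥) (hNM : N ≤ M) {d : D} (hd0 : d ≠ 0)
    (hd : valD F d = 0) (hMN : ∀ w ∈ M, rightMul 𝔄 d w ∈ N) : M ≤ N := by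
  obtain ⟨s, hs⟩ := h.exists_bound hfg
  obtain ⟨t, ht⟩ := h.exists_small_mem hN
  obtain ⟨k, hk, hkv⟩ := exists_pow_sub_one_valGE hd0 hd (s + t)
  intro w hw
  have hpow : ∀ j : ℕ, (fun i => w i * d ^ (j + 1)) ∈ N := fun j => by
    induction j with
    | zero =>
      convert hMN w hw using 1
      ext i
      rw [rightMul_apply, zero_add, pow_one]
    | succ j ih =>
      have := hMN _ (hNM ih)
      convert this using 1
      ext i
      rw [rightMul_apply, pow_succ _ (j + 1), mul_assoc]
  have h1 := hpow (k - 1)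
  rw [show k - 1 + 1 = k by omega] at h1
  have h2 : (fun i => w i * (d ^ k - 1)) ∈ N := ht _ fun i =>
    valGE_mono (valGE_mul (hs w hw i) hkv) (by push_cast; omega)
  have h3 : w = (fun i => w i * d ^ k) - fun i => w i * (d ^ k - 1) := by
    ext i
    simp [mul_sub]
  rw [h3]
  exact sub_mem h1 h2

/-- Any two lattices `N₁, N₂` in `D^m` over a hereditary order are comparable: the surjection
`N₁ × N₂ → N₁ + N₂` splits, and one of the two components of the splitting is the right
multiplication by a unit of the valuation ring of `D`. -/
theorem IsHereditaryOrder.le_total (h : IsHereditaryOrder 𝔄) {N₁ N₂ : Submodule 𝔄 (Fin m → D)}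
    (hfg₁ : N₁.FG) (hfg₂ : N₂.FG) (h₁ : N₁ ≠ ⊥) (h₂ : N₂ ≠ ⊥) : N₁ ≤ N₂ ∨ N₂ ≤ N₁ := by
  set M := N₁ ⊔ N₂ with hM
  have hMfg : M.FG := hfg₁.sup hfg₂
  have hM0 : M ≠ ⊥ := fun hb => h₁ (le_bot_iff.1 (hb ▸ le_sup_left))
  obtain ⟨x, hx, hx0⟩ := (Submodule.ne_bot_iff _).1 hM0
  obtain ⟨k, hk⟩ := Function.ne_iff.1 hx0
  have hk : x k ≠ 0 := hk
  have : Module.Projective 𝔄 M := h.projective hMfg k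
  let f : N₁ × N₂ →ₗ[𝔄] M :=
    (Submodule.inclusion (le_sup_left : N₁ ≤ M)).coprod
      (Submodule.inclusion (le_sup_right : N₂ ≤ M))
  have hf : Function.Surjective f := by
    rintro ⟨w, hw⟩
    obtain ⟨a, ha, b, hb, rfl⟩ := Submodule.mem_sup.1 hw
    exact ⟨(⟨a, ha⟩, ⟨b, hb⟩), Subtype.ext rfl⟩
  obtain ⟨σ, hσ⟩ := f.exists_rightInverse_of_surjective (LinearMap.range_eq_top.2 hf)
  obtain ⟨d₁, hd₁⟩ := h.exists_rightMul hM0 (N₁.subtype ∘ₗ LinearMap.fst 𝔄 N₁ N₂ ∘ₗ σ)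
  obtain ⟨d₂, hd₂⟩ := h.exists_rightMul hM0 (N₂.subtype ∘ₗ LinearMap.snd 𝔄 N₁ N₂ ∘ₗ σ)
  have hm₁ : ∀ w ∈ M, rightMul 𝔄 d₁ w ∈ N₁ := fun w hw => by
    rw [← hd₁ ⟨w, hw⟩]; exact (σ ⟨w, hw⟩).1.2
  have hm₂ : ∀ w ∈ M, rightMul 𝔄 d₂ w ∈ N₂ := fun w hw => by
    rw [← hd₂ ⟨w, hw⟩]; exact (σ ⟨w, hw⟩).2.2
  have hsum : d₁ + d₂ = 1 := by
    have e : f (σ ⟨x, hx⟩) = ⟨x, hx⟩ := LinearMap.congr_fun hσ _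
    have e := congrFun (congrArg Subtype.val e) k
    change (σ ⟨x, hx⟩).1.1 k + (σ ⟨x, hx⟩).2.1 k = x k at e
    have e1 := congrFun (hd₁ ⟨x, hx⟩) k
    have e2 := congrFun (hd₂ ⟨x, hx⟩) k
    change (σ ⟨x, hx⟩).1.1 k = x k * d₁ at e1
    change (σ ⟨x, hx⟩).2.1 k = x k * d₂ at e2
    rw [e1, e2, ← mul_add] at e
    exact mul_left_cancel₀ hk (e.trans (mul_one _).symm)
  have hv₁ := valGE_nonneg_of_preserves h hMfg hM0 fun w hw => le_sup_left (b := N₂) (hm₁ w hw)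
  have hv₂ := valGE_nonneg_of_preserves h hMfg hM0 fun w hw => le_sup_right (a := N₁) (hm₂ w hw)
  by_cases c₁ : valGE F 1 0 1 d₁
  · by_cases c₂ : valGE F 1 0 1 d₂
    · have := valGE_add c₁ c₂
      rw [hsum] at this
      simp [valGE, valD_one] at this
    · rw [valGE, not_or] at c₂
      have := hv₂.resolve_left c₂.1
      exact Or.inl (le_trans le_sup_left (h.le_of_rightMul_mem hMfg h₂ le_sup_right c₂.1
        (by have := c₂.2; push_cast at *; omega) hm₂))
  · rw [valGE, not_or] at c₁
    have := hv₁.resolve_left c₁.1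
    exact Or.inr (le_trans le_sup_right (h.le_of_rightMul_mem hMfg h₁ le_sup_left c₁.1
      (by have := c₁.2; push_cast at *; omega) hm₁))

/-- A hereditary order consists of all matrices that preserve all its lattices in `D^m`. The order
is filtered by its columns; every graded piece is a lattice in `D^m`, hence projective, and is split
off by a map that commutes with the matrix algebra. -/
theorem IsHereditaryOrder.mem_of_preserves (h : IsHereditaryOrder 𝔄)
    {a : Matrix (Fin m) (Fin m) D}
    (ha : ∀ N : Submodule 𝔄 (Fin m → D), N.FG → N ≠ ⊥ → ∀ w ∈ N, a • w ∈ N) : a ∈ 𝔄 := by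
  have : Module.Finite 𝒪[F] 𝔄 := Module.Finite.iff_fg.2 h.fg
  have hnoeth : IsNoetherianRing 𝔄 := IsNoetherianRing.of_finite 𝒪[F] 𝔄
  have key : ∀ (s : Finset (Fin m)) (x : 𝔄), (∀ j ∉ s, ∀ i, x.1 i j = 0) → a * x.1 ∈ 𝔄 := by
    intro s
    induction s using Finset.induction_on with
    | empty =>
      intro x hx
      have : x.1 = 0 := by ext i j; exact hx j (by simp) i
      rw [this, mul_zero]; exact zero_mem _
    | insert j s hj ih =>
      intro x hx
      let J : Ideal 𝔄 :=
        { carrier := {x | ∀ k ∉ insert j s, ∀ i, x.1 i k = 0}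
          zero_mem' := fun k _ i => rfl
          add_mem' := fun {x z} hx hz k hk i => by
            change x.1 i k + z.1 i k = 0
            rw [hx k hk i, hz k hk i, add_zero]
          smul_mem' := fun b x hx k hk i => by
            change (b.1 * x.1) i k = 0
            rw [Matrix.mul_apply]
            exact Finset.sum_eq_zero fun l _ => by rw [hx k hk l, mul_zero] }
      let col : J →ₗ[𝔄] (Fin m → D) :=
        { toFun := fun x i => x.1.1 i j
          map_add' := fun x z => rfl
          map_smul' := fun b x => by ext i; exact Matrix.mul_apply }
      have hfg : (LinearMap.range col).FG := by
        rw [LinearMap.range_eq_map]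
        exact (IsNoetherian.noetherian (⊤ : Submodule 𝔄 J)).map col
      have : Module.Projective 𝔄 (LinearMap.range col) := h.projective hfg j
      obtain ⟨σ, hσ⟩ := col.rangeRestrict.exists_rightInverse_of_surjective
        (LinearMap.range_eq_top.2 col.surjective_rangeRestrict)
      let incl : 𝔄 →ₗ[𝔄] Matrix (Fin m) (Fin m) D :=
        { toFun := Subtype.val, map_add' := fun _ _ => rfl, map_smul' := fun _ _ => rfl }
      let f : LinearMap.range col →ₗ[𝔄] Matrix (Fin m) (Fin m) D := incl ∘ₗ J.subtype ∘ₗ σ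
      let xJ : J := ⟨x, hx⟩
      let n := col.rangeRestrict xJ
      have hσn : col (σ n) = col xJ :=
        congrArg Subtype.val (LinearMap.congr_fun hσ n)
      have han : a • (n : Fin m → D) ∈ LinearMap.range col := by
        by_cases hb : LinearMap.range col = ⊥
        · rw [(Submodule.eq_bot_iff _).1 hb n n.2, smul_zero]; exact zero_mem _
        · exact ha _ hfg hb _ n.2
      have h1 : (σ ⟨_, han⟩).1.1 = a * (σ n).1.1 := h.map_smul_of_mem f a n han
      have h2 : a * (x - (σ n).1).1 ∈ 𝔄 := by
        refine ih _ fun k hk i => ?_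
        change x.1 i k - (σ n).1.1 i k = 0
        by_cases hkj : k = j
        · subst hkj
          exact sub_eq_zero.2 (congrFun hσn i).symm
        · have hk' : k ∉ insert j s := by simp [hkj, hk]
          rw [hx k hk' i, (σ n).2 k hk' i, sub_zero]
      have h3 : a * x.1 = (σ ⟨_, han⟩).1.1 + a * (x - (σ n).1).1 := by
        rw [h1, ← mul_add]
        congr 1
        change x.1 = (σ n).1.1 + (x.1 - (σ n).1.1)
        abel
      rw [h3]
      exact add_mem (σ ⟨_, han⟩).1.2 h2
  simpa using key Finset.univ 1 fun j hj => absurd (Finset.mem_univ j) hj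

end OrderLattices

/-! ### The lattice chain of a hereditary order -/

section LatticeChain

open scoped Matrix.Module

variable {F : Type*} [Field F] [ValuativeRel F] [TopologicalSpace F] [IsNonarchimedeanLocalField F]
variable {D : Type*} [DivisionRing D] [Algebra F D] [FiniteDimensional F D] {m : ℕ}

/-- The set of all lattices in `D^m` over the order `𝔄`. -/
def OrderLattice (𝔄 : Subalgebra 𝒪[F] (Matrix (Fin m) (Fin m) D)) : Type _ :=
  {N : Submodule 𝔄 (Fin m → D) // N.FG ∧ N ≠ ⊥}

variable {𝔄 : Subalgebra 𝒪[F] (Matrix (Fin m) (Fin m) D)}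

theorem rightMul_rightMul (d d' : D) (w : Fin m → D) :
    rightMul 𝔄 d (rightMul 𝔄 d' w) = rightMul 𝔄 (d' * d) w := by
  ext i; simp [rightMul_apply, mul_assoc]

theorem rightMul_one (w : Fin m → D) : rightMul 𝔄 1 w = w := by
  ext i; simp [rightMul_apply]

theorem rightMul_injective {d : D} (hd : d ≠ 0) : Function.Injective (rightMul 𝔄 d) :=
  fun w z h => by
    rw [← rightMul_one (𝔄 := 𝔄) w, ← rightMul_one (𝔄 := 𝔄) z, ← mul_inv_cancel₀ hd,
      ← rightMul_rightMul, ← rightMul_rightMul, h]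

theorem mem_map_rightMul {d : D} (hd : d ≠ 0) {N : Submodule 𝔄 (Fin m → D)} {w : Fin m → D} :
    w ∈ N.map (rightMul 𝔄 d) ↔ rightMul 𝔄 d⁻¹ w ∈ N := by
  constructor
  · rintro ⟨z, hz, rfl⟩
    rwa [rightMul_rightMul, mul_inv_cancel₀ hd, rightMul_one]
  · intro h
    exact ⟨_, h, by rw [rightMul_rightMul, inv_mul_cancel₀ hd, rightMul_one]⟩

/-- The submodule of vectors whose entries have valuation at least `k`. -/
noncomputable def boxLattice (F D : Type*) [Field F] [ValuativeRel F] [TopologicalSpace F]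
    [IsNonarchimedeanLocalField F] [DivisionRing D] [Algebra F D] [FiniteDimensional F D] (m : ℕ)
    (k : ℤ) : Submodule 𝒪[F] (Fin m → D) := Submodule.pi Set.univ fun _ => idealD F D k

theorem mem_boxLattice {k : ℤ} {w : Fin m → D} :
    w ∈ boxLattice F D m k ↔ ∀ i, valGE F 1 0 k (w i) := by
  simp [boxLattice, Submodule.mem_pi, mem_idealD]

theorem finite_image_boxLattice (s : ℤ) (t : ℕ) :
    ((boxLattice F D m (t - s)).mkQ '' (boxLattice F D m (-s))).Finite := by
  set B := boxLattice F D m (-s)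
  have hB : B.FG := Submodule.fg_pi fun _ => idealD_fg _
  have hfg : (⊤ : Submodule 𝒪[F] B).FG := (Submodule.fg_top _).2 hB
  have : Finite (𝒪[F] ⧸ 𝓂[F]) := inferInstanceAs (Finite 𝓀[F])
  have hfin : Finite (𝒪[F] ⧸ 𝓂[F] ^ t) := Ideal.finite_quotient_pow (IsNoetherian.noetherian _) t
  have : Finite (B ⧸ (𝓂[F] ^ t • (⊤ : Submodule 𝒪[F] B))) := Submodule.finite_quotient_smul _ hfg
  let f : B →ₗ[𝒪[F]] (Fin m → D) ⧸ boxLattice F D m (t - s) :=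
    (boxLattice F D m (t - s)).mkQ ∘ₗ B.subtype
  have hf : 𝓂[F] ^ t • (⊤ : Submodule 𝒪[F] B) ≤ f.ker := by
    intro w hw
    rw [maximalIdeal_eq, Ideal.span_singleton_pow, Submodule.ideal_span_singleton_smul] at hw
    obtain ⟨⟨x, hx⟩, -, rfl⟩ := (Submodule.mem_smul_pointwise_iff_exists _ _ _).1 hw
    refine (Submodule.Quotient.mk_eq_zero _).2 (mem_boxLattice.2 fun i => ?_)
    change valGE F 1 0 _ ((unifF F ^ t) • x i)
    rw [Algebra.smul_def]
    refine valGE_mono (valGE_mul (c := 0) (k := ramD F D * t) (Or.inr ?_)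
      (mem_boxLattice.1 hx i)) ?_
    · rw [valD_algebraMap (pow_ne_zero _ unifF_ne_zero), ordF_pow unifF_ne_zero, ordF_unifF]
      simp
    · have : (ramD F D : ℤ) * t ≥ 1 * t := mul_le_mul_of_nonneg_right ramD_pos (by positivity)
      omega
  refine (Set.finite_range (Submodule.liftQ _ f hf)).subset ?_
  rintro _ ⟨w, hw, rfl⟩
  exact ⟨Submodule.Quotient.mk ⟨w, hw⟩, rfl⟩

namespace OrderLattice

/-- There are only finitely many lattices between two given ones, since they correspond to subsets
of a finite quotient. -/
theorem finite_Icc (h : IsHereditaryOrder 𝔄) (M N : Submodule 𝔄 (Fin m → D)) (hM : M ≠ ⊥)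
    (hN : N.FG) : (Set.Icc M N).Finite := by
  obtain ⟨s, hs⟩ := h.exists_bound hN
  obtain ⟨t, ht⟩ := h.exists_small_mem hM
  set Q := boxLattice F D m (((s + t : ℕ) : ℤ) - s) with hQ
  have hsmall : ∀ L ∈ Set.Icc M N, ∀ w ∈ Q, w ∈ L := fun L hL w hw =>
    hL.1 (ht w fun i => valGE_mono (mem_boxLattice.1 hw i) (by push_cast; omega))
  refine Set.Finite.of_finite_image (f := fun L : Submodule 𝔄 (Fin m → D) => Q.mkQ '' L)
    (((finite_image_boxLattice (F := F) (D := D) (m := m) s (s + t)).finite_subsets).subset ?_) ?_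
  · rintro _ ⟨L, hL, rfl⟩
    exact Set.image_mono fun w hw => mem_boxLattice.2 (hs w (hL.2 hw))
  · have key : ∀ L ∈ Set.Icc M N, ∀ L' ∈ Set.Icc M N, Q.mkQ '' L = Q.mkQ '' L' → L ≤ L' := by
      intro L hL L' hL' e w hw
      obtain ⟨z, hz, hzw⟩ : Q.mkQ w ∈ Q.mkQ '' L' := e ▸ ⟨w, hw, rfl⟩
      have h1 : w - z ∈ L' := hsmall L' hL' _ ((Submodule.Quotient.eq _).1 hzw.symm)
      simpa using add_mem h1 hz
    exact fun L hL L' hL' e => le_antisymm (key L hL L' hL' e) (key L' hL' L hL e.symm)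

instance : PartialOrder (OrderLattice 𝔄) := inferInstanceAs (PartialOrder (Subtype _))

/-- The lattices over a hereditary order form a chain. -/
noncomputable abbrev linearOrder (h : IsHereditaryOrder 𝔄) : LinearOrder (OrderLattice 𝔄) :=
  { (inferInstance : PartialOrder (OrderLattice 𝔄)) with
    le_total := fun M N => h.le_total M.2.1 N.2.1 M.2.2 N.2.2
    toDecidableLE := Classical.decRel _ }

/-- The lattice `N d`, for a nonzero element `d` of `D`. -/
noncomputable def mulRight (N : OrderLattice 𝔄) (d : D) (hd : d ≠ 0) : OrderLattice 𝔄 :=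
  ⟨N.1.map (rightMul 𝔄 d), N.2.1.map _, fun h => N.2.2
    (Submodule.map_injective_of_injective (rightMul_injective hd)
      (h.trans (Submodule.map_bot _).symm))⟩

theorem mem_mulRight {N : OrderLattice 𝔄} {d : D} {hd : d ≠ 0} {w : Fin m → D} :
    w ∈ (N.mulRight d hd).1 ↔ rightMul 𝔄 d⁻¹ w ∈ N.1 := mem_map_rightMul hd

theorem mulRight_le_mulRight {M N : OrderLattice 𝔄} {d : D} (hd : d ≠ 0) (h : M ≤ N) :
    M.mulRight d hd ≤ N.mulRight d hd := Submodule.map_mono h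

theorem ext_mem {M N : OrderLattice 𝔄} (h : ∀ w, w ∈ M.1 ↔ w ∈ N.1) : M = N :=
  Subtype.ext (Submodule.ext h)

theorem mulRight_mulRight (N : OrderLattice 𝔄) {d d' : D} (hd : d ≠ 0) (hd' : d' ≠ 0) :
    (N.mulRight d hd).mulRight d' hd' = N.mulRight (d * d') (mul_ne_zero hd hd') :=
  ext_mem fun w => by
    rw [mem_mulRight, mem_mulRight, mem_mulRight, rightMul_rightMul, mul_inv_rev]

theorem mulRight_mulRight_inv (N : OrderLattice 𝔄) {d : D} (hd : d ≠ 0) :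
    (N.mulRight d hd).mulRight d⁻¹ (inv_ne_zero hd) = N :=
  ext_mem fun w => by
    rw [mem_mulRight, mem_mulRight, rightMul_rightMul, inv_inv, mul_inv_cancel₀ hd, rightMul_one]

theorem mulRight_inv_mulRight (N : OrderLattice 𝔄) {d : D} (hd : d ≠ 0) :
    (N.mulRight d⁻¹ (inv_ne_zero hd)).mulRight d hd = N :=
  ext_mem fun w => by
    rw [mem_mulRight, mem_mulRight, rightMul_rightMul, inv_inv, inv_mul_cancel₀ hd, rightMul_one]

/-- Multiplication by `d` as an automorphism of the chain of lattices. -/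
noncomputable def mulRightIso (d : D) (hd : d ≠ 0) : OrderLattice 𝔄 ≃o OrderLattice 𝔄 where
  toFun N := N.mulRight d hd
  invFun N := N.mulRight d⁻¹ (inv_ne_zero hd)
  left_inv N := N.mulRight_mulRight_inv hd
  right_inv N := N.mulRight_inv_mulRight hd
  map_rel_iff' {M N} := ⟨fun h w hw => by
    have h1 : rightMul 𝔄 d w ∈ (N.mulRight d hd).1 := h ⟨w, hw, rfl⟩
    rwa [mem_mulRight, rightMul_rightMul, mul_inv_cancel₀ hd, rightMul_one] at h1,
    mulRight_le_mulRight hd⟩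

/-- Units of the valuation ring of `D` fix every lattice. -/
theorem mulRight_eq_of_valD_eq_zero (h : IsHereditaryOrder 𝔄) (N : OrderLattice 𝔄) {d : D}
    (hd : d ≠ 0) (h0 : valD F d = 0) : N.mulRight d hd = N := by
  have key : ∀ (d : D) (hd : d ≠ 0), valD F d = 0 → N.mulRight d hd ≤ N → N.mulRight d hd = N :=
    fun d hd h0 hle => le_antisymm hle (h.le_of_rightMul_mem N.2.1 (N.mulRight d hd).2.2 hle hd h0
      fun w hw => ⟨w, hw, rfl⟩)
  rcases h.le_total (N.mulRight d hd).2.1 N.2.1 (N.mulRight d hd).2.2 N.2.2 with hle | hle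
  · exact key d hd h0 hle
  · have h1 : N.mulRight d⁻¹ (inv_ne_zero hd) ≤ N := by
      rw [← (mulRightIso (𝔄 := 𝔄) d hd).le_iff_le]
      change (N.mulRight d⁻¹ (inv_ne_zero hd)).mulRight d hd ≤ N.mulRight d hd
      exact (N.mulRight_inv_mulRight hd).le.trans hle
    have h2 := key d⁻¹ (inv_ne_zero hd) (by rw [valD_inv hd, h0, neg_zero]) h1
    have h3 := N.mulRight_inv_mulRight hd
    rwa [h2] at h3

theorem mulRight_unif_lt (h : IsHereditaryOrder 𝔄) (N : OrderLattice 𝔄) {d : D}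
    (hd : d ≠ 0) (h0 : 0 < valD F d) : N.mulRight d hd < N := by
  let := linearOrder h
  by_contra hle
  have hle : N ≤ N.mulRight d hd := not_lt.1 hle
  have h1 : ∀ w ∈ N.1, rightMul 𝔄 d⁻¹ w ∈ N.1 := fun w hw => mem_mulRight.1 (hle hw)
  have h2 := (valGE_nonneg_of_preserves h N.2.1 N.2.2 h1).resolve_left (inv_ne_zero hd)
  rw [valD_inv hd] at h2
  push_cast at h2
  omega

end OrderLattice

theorem orderIso_int_apply (e : ℤ ≃o ℤ) (k : ℤ) : e k = e 0 + k := by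
  have hs : ∀ k : ℤ, e (k + 1) = e k + 1 := fun k => e.map_succ k
  induction k using Int.induction_on with
  | zero => simp
  | succ k ih => rw [hs, ih]; ring
  | pred k ih =>
    have := hs (-k - 1)
    rw [sub_add_cancel] at this
    linarith

/-- The lattices over a hereditary order `𝔄` can be numbered by the integers in decreasing order,
and multiplication by an element of `D` shifts them by a multiple of its valuation. -/
theorem IsHereditaryOrder.exists_chain (h : IsHereditaryOrder 𝔄) (hm : 0 < m) :
    ∃ (n : ℕ) (L : ℤ → Submodule 𝔄 (Fin m → D)), 0 < n ∧ (∀ k l, L k ≤ L l ↔ l ≤ k) ∧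
      (∀ k, (L k).FG ∧ L k ≠ ⊥) ∧ (∀ N : Submodule 𝔄 (Fin m → D), N.FG → N ≠ ⊥ → ∃ k, N = L k) ∧
      ∀ (d : D), d ≠ 0 → ∀ k w, rightMul 𝔄 d w ∈ L (k + n * valD F d) ↔ w ∈ L k := by
  let := OrderLattice.linearOrder h
  let : LocallyFiniteOrder (OrderLattice 𝔄) := LocallyFiniteOrder.ofFiniteIcc fun M N =>
    Set.Finite.of_finite_image (f := Subtype.val)
      ((OrderLattice.finite_Icc h M.1 N.1 M.2.2 N.2.1).subset (by
        rintro _ ⟨L, hL, rfl⟩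
        exact hL)) Subtype.val_injective.injOn
  obtain ⟨ϖ, hϖ, hϖ1⟩ := exists_valD_eq_one F D
  have : Nonempty (OrderLattice 𝔄) := by
    refine ⟨⟨Submodule.span 𝔄 {Pi.single ⟨0, hm⟩ 1},
      Submodule.fg_span (Set.finite_singleton _), ?_⟩⟩
    rw [Ne, Submodule.span_singleton_eq_bot]
    simp
  have : NoMinOrder (OrderLattice 𝔄) :=
    ⟨fun N => ⟨_, N.mulRight_unif_lt h hϖ (by omega)⟩⟩
  have : NoMaxOrder (OrderLattice 𝔄) := ⟨fun N => ⟨N.mulRight ϖ⁻¹ (inv_ne_zero hϖ), by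
    have := (N.mulRight ϖ⁻¹ (inv_ne_zero hϖ)).mulRight_unif_lt h hϖ (by omega)
    rwa [N.mulRight_inv_mulRight hϖ] at this⟩⟩
  let := LinearLocallyFiniteOrder.succOrder (OrderLattice 𝔄)
  let := LinearLocallyFiniteOrder.predOrder (OrderLattice 𝔄)
  let φ : OrderLattice 𝔄 ≃o ℤ := orderIsoIntOfLinearSuccPredArch
  -- `τ d` is the number of steps by which multiplication by `d` moves the chain
  let e (d : D) (hd : d ≠ 0) : ℤ ≃o ℤ := φ.symm.trans ((OrderLattice.mulRightIso d hd).trans φ)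
  let τ (d : D) (hd : d ≠ 0) : ℤ := e d hd 0
  have hτ : ∀ d hd N, φ (N.mulRight d hd) = τ d hd + φ N := fun d hd N => by
    rw [← orderIso_int_apply (e d hd)]
    simp only [e, OrderIso.trans_apply, OrderIso.symm_apply_apply]
    rfl
  obtain ⟨N₀⟩ := ‹Nonempty (OrderLattice 𝔄)›
  have hτmul : ∀ d hd d' hd', τ (d * d') (mul_ne_zero hd hd') = τ d hd + τ d' hd' :=
    fun d hd d' hd' => by
      have h1 := hτ _ (mul_ne_zero hd hd') N₀
      rw [← OrderLattice.mulRight_mulRight _ hd hd', hτ _ hd', hτ _ hd] at h1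
      linarith
  have hτ0 : ∀ d hd, valD F d = 0 → τ d hd = 0 := fun d hd h0 => by
    have h1 := hτ d hd N₀
    rw [OrderLattice.mulRight_eq_of_valD_eq_zero h N₀ hd h0] at h1
    linarith
  have hτpow : ∀ j : ℕ, τ (ϖ ^ j) (pow_ne_zero _ hϖ) = j * τ ϖ hϖ := fun j => by
    induction j with
    | zero => simpa using hτ0 (ϖ ^ 0) (pow_ne_zero _ hϖ) (by simp [valD_one])
    | succ j ih =>
      have := hτmul (ϖ ^ j) (pow_ne_zero _ hϖ) ϖ hϖ
      simp only [← pow_succ] at this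
      rw [this, ih]; push_cast; ring
  have hτval : ∀ d hd, τ d hd = valD F d * τ ϖ hϖ := by
    have hpos : ∀ d hd, 0 ≤ valD F d → τ d hd = valD F d * τ ϖ hϖ := fun d hd h0 => by
      have h1 := hτmul (ϖ ^ (valD F d).toNat) (pow_ne_zero _ hϖ)
        ((ϖ ^ (valD F d).toNat)⁻¹ * d) (mul_ne_zero (inv_ne_zero (pow_ne_zero _ hϖ)) hd)
      rw [hτ0 _ (mul_ne_zero (inv_ne_zero (pow_ne_zero _ hϖ)) hd) (by
        rw [valD_mul (inv_ne_zero (pow_ne_zero _ hϖ)) hd, valD_inv (pow_ne_zero _ hϖ), valD_pow hϖ,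
          hϖ1, Int.toNat_of_nonneg h0]; ring), hτpow, Int.toNat_of_nonneg h0, add_zero] at h1
      simp only [mul_inv_cancel_left₀ (pow_ne_zero _ hϖ)] at h1
      exact h1
    intro d hd
    rcases _root_.le_total 0 (valD F d) with h0 | h0
    · exact hpos d hd h0
    · have h1 := hpos d⁻¹ (inv_ne_zero hd) (by rw [valD_inv hd]; omega)
      have h2 := hτmul d hd d⁻¹ (inv_ne_zero hd)
      rw [hτ0 _ (mul_ne_zero hd (inv_ne_zero hd)) (by rw [mul_inv_cancel₀ hd, valD_one]), h1,
        valD_inv hd] at h2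
      linarith
  have hneg : τ ϖ hϖ < 0 := by
    have h1 := φ.lt_iff_lt.2 (N₀.mulRight_unif_lt h hϖ (by omega))
    rw [hτ] at h1
    linarith
  obtain ⟨n, hn⟩ := Int.eq_ofNat_of_zero_le (a := -τ ϖ hϖ) (by omega)
  refine ⟨n, fun k => (φ.symm (-k)).1, by omega, fun k l => ?_, fun k => (φ.symm (-k)).2,
    fun N hN hN0 => ⟨-φ ⟨N, hN, hN0⟩, ?_⟩, fun d hd k w => ?_⟩
  · change φ.symm (-k) ≤ φ.symm (-l) ↔ _
    rw [φ.symm.le_iff_le]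
    omega
  · have h1 := φ.symm_apply_apply (⟨N, hN, hN0⟩ : OrderLattice 𝔄)
    change N = (φ.symm (- -φ ⟨N, hN, hN0⟩)).1
    rw [neg_neg, h1]
  · have h1 : φ.symm (-(k + n * valD F d)) = (φ.symm (-k)).mulRight d hd := by
      rw [OrderIso.symm_apply_eq, hτ, OrderIso.apply_symm_apply, hτval, ← hn]
      ring
    change rightMul 𝔄 d w ∈ (φ.symm (-(k + n * valD F d))).1 ↔ w ∈ (φ.symm (-k)).1
    rw [h1, OrderLattice.mem_mulRight, rightMul_rightMul, mul_inv_cancel₀ hd, rightMul_one]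

end LatticeChain

/-! ### Splitting the lattice chain -/

section Splitting

open scoped Matrix.Module

variable {F : Type*} [Field F] [ValuativeRel F] [TopologicalSpace F] [IsNonarchimedeanLocalField F]
variable {D : Type*} [DivisionRing D] [Algebra F D] [FiniteDimensional F D] {m : ℕ}
variable {𝔄 : Subalgebra 𝒪[F] (Matrix (Fin m) (Fin m) D)}

/-- Every vector `w ≠ 0` has an exact level in the chain `L`. -/
theorem exists_level {L : ℤ → Submodule 𝔄 (Fin m → D)} (hL : ∀ k l, L k ≤ L l ↔ l ≤ k)
    (hsurj : ∀ N : Submodule 𝔄 (Fin m → D), N.FG → N ≠ ⊥ → ∃ k, N = L k) {w : Fin m → D}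
    (hw : w ≠ 0) : ∃ k₀, ∀ k, w ∈ L k ↔ k ≤ k₀ := by
  obtain ⟨k₀, hk₀⟩ := hsurj (Submodule.span 𝔄 {w}) (Submodule.fg_span (Set.finite_singleton _))
    (by rwa [Ne, Submodule.span_singleton_eq_bot])
  exact ⟨k₀, fun k => by rw [← hL, ← hk₀, Submodule.span_singleton_le_iff_mem]⟩

/-- A lattice chain is split by a basis that is triangular with respect to the standard one:
modulo the vectors supported in `T`, the vector `e_j` is replaced by one of maximal level. -/
theorem IsHereditaryOrder.exists_splitting (h : IsHereditaryOrder 𝔄) {n : ℕ}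
    {L : ℤ → Submodule 𝔄 (Fin m → D)} (hL : ∀ k l, L k ≤ L l ↔ l ≤ k)
    (hfg : ∀ k, (L k).FG ∧ L k ≠ ⊥)
    (hsurj : ∀ N : Submodule 𝔄 (Fin m → D), N.FG → N ≠ ⊥ → ∃ k, N = L k)
    (hmul : ∀ d : D, d ≠ 0 → ∀ k w, rightMul 𝔄 d w ∈ L (k + n * valD F d) ↔ w ∈ L k)
    (T : Finset (Fin m)) :
    ∃ (b : Fin m → Fin m → D) (y : Fin m → ℤ), (∀ i ∈ T, ∀ j ∉ T, b i j = 0) ∧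
      (∀ w : Fin m → D, (∀ j ∉ T, w j = 0) → ∃ a : Fin m → D, w = ∑ i ∈ T, rightMul 𝔄 (a i) (b i)) ∧
      ∀ (a : Fin m → D) k, ∑ i ∈ T, rightMul 𝔄 (a i) (b i) ∈ L k ↔
        ∀ i ∈ T, valGE F n (y i) k (a i) := by
  classical
  induction T using Finset.induction_on with
  | empty =>
    refine ⟨0, 0, by simp, fun w hw => ⟨0, ?_⟩, by simp⟩
    ext j; simpa using hw j (by simp)
  | insert j T hj ih =>
    obtain ⟨b, y, hb, hspan, hsplit⟩ := ih
    -- the levels of the vectors that may replace `e_j`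
    let P : ℤ → Prop := fun k => ∃ w : Fin m → D, (∀ i ∉ insert j T, w i = 0) ∧ w j = 1 ∧ w ∈ L k
    have hne : ∃ k, P k := by
      obtain ⟨k₀, hk₀⟩ := exists_level hL hsurj (w := (Pi.single j 1 : Fin m → D)) (by simp)
      refine ⟨k₀, Pi.single j 1, fun i hi => ?_, by simp, (hk₀ k₀).2 le_rfl⟩
      exact Pi.single_eq_of_ne (fun e => hi (by simp [e])) _
    have hbdd : ∃ K, ∀ k, P k → k ≤ K := by
      obtain ⟨s, hs⟩ := h.exists_bound (hfg 0).1
      obtain ⟨ϖ, hϖ, hϖ1⟩ := exists_valD_eq F D (s + 1)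
      refine ⟨n * (s + 1), fun k ⟨w, _, hw1, hwk⟩ => ?_⟩
      by_contra hlt
      have h1 : w ∈ L (0 + n * (s + 1)) := (hL k _).2 (by omega) hwk
      have h2 : rightMul 𝔄 ϖ (rightMul 𝔄 ϖ⁻¹ w) = w := by
        rw [rightMul_rightMul, inv_mul_cancel₀ hϖ, rightMul_one]
      rw [← h2, ← hϖ1, hmul ϖ hϖ] at h1
      have h3 := hs _ h1 j
      rw [rightMul_apply, hw1, one_mul] at h3
      have h4 := h3.resolve_left (inv_ne_zero hϖ)
      rw [valD_inv hϖ, hϖ1] at h4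
      push_cast at h4
      omega
    obtain ⟨K, hK⟩ := hbdd
    obtain ⟨k₁, ⟨v, hv, hv1, hvk⟩, hmax⟩ := Int.exists_greatest_of_bdd ⟨K, hK⟩ hne
    have hcomb : ∀ (a : Fin m → D), ∀ i ∉ T, (∑ l ∈ T, rightMul 𝔄 (a l) (b l)) i = 0 := by
      intro a i hi
      rw [Finset.sum_apply]
      exact Finset.sum_eq_zero fun l hl => by rw [rightMul_apply, hb l hl i hi, zero_mul]
    let b' := Function.update b j v
    let y' := Function.update y j k₁
    have hsum : ∀ a : Fin m → D, ∑ i ∈ insert j T, rightMul 𝔄 (a i) (b' i) =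
        rightMul 𝔄 (a j) v + ∑ i ∈ T, rightMul 𝔄 (a i) (b i) := by
      intro a
      rw [Finset.sum_insert hj]
      congr 1
      · simp [b']
      · refine Finset.sum_congr rfl fun i hi => ?_
        have : i ≠ j := by rintro rfl; exact hj hi
        simp [b', this]
    refine ⟨b', y', fun i hi l hl => ?_, fun w hw => ?_, fun a k => ?_⟩
    · rcases Finset.mem_insert.1 hi with rfl | hi
      · simpa [b'] using hv l hl
      · have : i ≠ j := fun e => hj (e ▸ hi)
        simpa [b', this] using hb i hi l fun hl' => hl (Finset.mem_insert_of_mem hl')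
    · obtain ⟨a, ha⟩ := hspan (w - rightMul 𝔄 (w j) v) fun i hi => by
        by_cases hij : i = j
        · subst hij
          simp [rightMul_apply, hv1]
        · have hi' : i ∉ insert j T := by simp [hij, hi]
          simp [rightMul_apply, hw i hi', hv i hi']
      refine ⟨Function.update a j (w j), ?_⟩
      rw [hsum]
      have : ∑ i ∈ T, rightMul 𝔄 (Function.update a j (w j) i) (b i) =
          ∑ i ∈ T, rightMul 𝔄 (a i) (b i) := Finset.sum_congr rfl fun i hi => by
        have : i ≠ j := by rintro rfl; exact hj hi
        simp [this]
      rw [this, ← ha]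
      simp
    · rw [hsum]
      set u := ∑ i ∈ T, rightMul 𝔄 (a i) (b i) with hu
      have hj' : rightMul 𝔄 (a j) v ∈ L k ↔ valGE F n k₁ k (a j) := by
        by_cases h0 : a j = 0
        · have : rightMul 𝔄 (a j) v = 0 := by ext i; simp [h0, rightMul_apply]
          rw [this]
          exact ⟨fun _ => Or.inl h0, fun _ => zero_mem _⟩
        · have h1 := hmul (a j) h0 (k - n * valD F (a j)) v
          rw [sub_add_cancel] at h1
          rw [h1, valGE, or_iff_right h0]
          constructor
          · intro h2
            have := hmax _ ⟨v, hv, hv1, h2⟩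
            omega
          · intro h2
            exact (hL k₁ _).2 (by omega) hvk
      -- by the maximality of `k₁`, adding combinations of the `b i` cannot raise the level of `v`
      have key : rightMul 𝔄 (a j) v + u ∈ L k ↔ rightMul 𝔄 (a j) v ∈ L k ∧ u ∈ L k := by
        refine ⟨fun h1 => ?_, fun h1 => add_mem h1.1 h1.2⟩
        have h2 : rightMul 𝔄 (a j) v ∈ L k := by
          by_cases h0 : a j = 0
          · have : rightMul 𝔄 (a j) v = 0 := by ext i; simp [h0, rightMul_apply]
            rw [this]; exact zero_mem _
          rw [hj']
          right
          have h3 : rightMul 𝔄 (a j) (v + rightMul 𝔄 (a j)⁻¹ u) ∈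
              L (k - n * valD F (a j) + n * valD F (a j)) := by
            rwa [map_add, rightMul_rightMul, inv_mul_cancel₀ h0, rightMul_one, sub_add_cancel]
          rw [hmul _ h0] at h3
          have := hmax _ ⟨_, fun i hi => ?_, ?_, h3⟩
          · omega
          · have hi' : i ∉ T := fun hi' => hi (Finset.mem_insert_of_mem hi')
            rw [Pi.add_apply, hv i hi, rightMul_apply, hu, hcomb a i hi', zero_mul, add_zero]
          · rw [Pi.add_apply, hv1, rightMul_apply, hu, hcomb a j hj, zero_mul, add_zero]
        exact ⟨h2, by simpa using sub_mem h1 h2⟩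
      rw [key, hj', hsplit, Finset.forall_mem_insert]
      refine and_congr (by simp [y']) (forall₂_congr fun i hi => ?_)
      have : i ≠ j := by rintro rfl; exact hj hi
      simp [y', this]

/-- Structure theorem: every hereditary order in `M_m(D)` is a standard order. The frame is a basis
that splits the chain of lattices, and the exponents are the levels of the basis vectors. -/
theorem IsHereditaryOrder.exists_eq_stdOrder (h : IsHereditaryOrder 𝔄) (hm : 0 < m) :
    ∃ (g : (Matrix (Fin m) (Fin m) D)ˣ) (n : ℕ) (y : Fin m → ℤ), 0 < n ∧ HitsResidues n y ∧
      𝔄 = stdOrder F g n y := by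
  obtain ⟨n, L, hn, hL, hfg, hsurj, hmul⟩ := h.exists_chain hm
  obtain ⟨b, y, -, hspan, hsplit⟩ := h.exists_splitting hL hfg hsurj hmul Finset.univ
  let B : Matrix (Fin m) (Fin m) D := Matrix.of fun j i => b i j
  have hB : ∀ a : Fin m → D, B • a = ∑ i, rightMul 𝔄 (a i) (b i) := fun a => by
    ext j
    rw [matSmul_apply, Finset.sum_apply]
    rfl
  have hBunit : IsUnit B := by
    choose a ha using fun w : Fin m → D => hspan w (by simp)
    have h1 : B * Matrix.of (fun i j => a (Pi.single j 1) i) = 1 := by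
      ext p q
      have := congrFun (ha (Pi.single q 1)) p
      rw [← hB, matSmul_apply] at this
      rw [Pi.single_apply] at this
      rw [Matrix.mul_apply, Matrix.one_apply]
      exact this.symm
    exact IsUnit.of_mul_eq_one _ h1
  obtain ⟨g, hg⟩ := hBunit
  have hmem : ∀ w k, w ∈ L k ↔
      ∀ i, valGE F n (y i) k (((↑g⁻¹ : Matrix (Fin m) (Fin m) D) • w) i) := by
    intro w k
    have h1 : g.val • (↑g⁻¹ : Matrix (Fin m) (Fin m) D) • w = w := by
      rw [smul_smul, Units.mul_inv, one_smul]
    conv_lhs => rw [← h1, hg, hB, hsplit]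
    simp
  have hcoord : ∀ (a : Matrix (Fin m) (Fin m) D) (w : Fin m → D),
      (↑g⁻¹ : Matrix (Fin m) (Fin m) D) • a • w =
        coord g a • (↑g⁻¹ : Matrix (Fin m) (Fin m) D) • w := fun a w => by
    rw [coord, smul_smul, smul_smul, mul_assoc, Units.mul_inv, mul_one]
  refine ⟨g, n, y, hn, fun k => ?_, ?_⟩
  · obtain ⟨w, hw, hw'⟩ := SetLike.not_le_iff_exists.1 (mt (hL k (k + 1)).1 (by omega))
    rw [hmem] at hw hw'
    push Not at hw'
    obtain ⟨i, hi⟩ := hw'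
    rw [valGE, not_or] at hi
    have := (hw i).resolve_left hi.1
    exact ⟨i, valD F (((↑g⁻¹ : Matrix (Fin m) (Fin m) D) • w) i), by omega⟩
  · ext a
    constructor
    · intro ha p q
      have h1 : g.val • (Pi.single q 1 : Fin m → D) ∈ L (y q) := by
        rw [hmem]
        intro i
        rw [smul_smul, Units.inv_mul, one_smul, Pi.single_apply]
        split_ifs with hi
        · subst hi
          exact Or.inr (by simp [valD_one])
        · exact valGE_zero _ _ _
      have h2 := (L (y q)).smul_mem (⟨a, ha⟩ : 𝔄) h1
      rw [orderSmul_def, hmem] at h2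
      have h3 := h2 p
      rw [hcoord, smul_smul _ g.val, Units.inv_mul, one_smul, matSmul_apply,
        Finset.sum_eq_single q (fun j _ hj => by simp [hj]) (by simp), Pi.single_eq_same,
        mul_one] at h3
      exact valGE_mono h3 (by omega)
    · intro ha
      refine h.mem_of_preserves fun N hN hN0 w hw => ?_
      obtain ⟨k, rfl⟩ := hsurj N hN hN0
      rw [hmem] at hw ⊢
      intro i
      rw [hcoord, matSmul_apply]
      exact valGE_sum _ fun j _ => valGE_mono (valGE_mul (ha i j) (hw j)) (by omega)

end Splitting

/-! ### Cycle means and potentials -/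

section Potentials

variable {ι : Type*} [Fintype ι] [Nonempty ι]

/-- The least `ρ` for which the system `w_{pq} + y_p - y_q ≤ ρ` is solvable exists, since the
inequalities confine the normalized solutions to a compact box. -/
theorem exists_least_bound (w : ι → ι → ℝ) {c : ι → ℝ} {R : ℝ}
    (hc : ∀ p q, w p q + c p - c q ≤ R) :
    ∃ ρ ≤ R, (∃ y : ι → ℝ, ∀ p q, w p q + y p - y q ≤ ρ) ∧
      ∀ ρ' (y : ι → ℝ), (∀ p q, w p q + y p - y q ≤ ρ') → ρ ≤ ρ' := by
  obtain ⟨i₀⟩ := ‹Nonempty ι›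
  let K : Set ((ι → ℝ) × ℝ) := {z | (∀ p q, w p q + z.1 p - z.1 q ≤ z.2) ∧ z.1 i₀ = 0 ∧ z.2 ≤ R}
  have hK : IsCompact K := by
    refine (isCompact_Icc (a := ((fun q => w i₀ q - R, w i₀ i₀) : (ι → ℝ) × ℝ))
      (b := (fun p => R - w p i₀, R))).of_isClosed_subset ?_ ?_
    · refine IsClosed.inter ?_ (IsClosed.inter ?_ ?_)
      · have : {z : (ι → ℝ) × ℝ | ∀ p q, w p q + z.1 p - z.1 q ≤ z.2} =
            ⋂ p, ⋂ q, {z | w p q + z.1 p - z.1 q ≤ z.2} := by ext; simp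
        change IsClosed {z : (ι → ℝ) × ℝ | ∀ p q, w p q + z.1 p - z.1 q ≤ z.2}
        rw [this]
        exact isClosed_iInter fun p => isClosed_iInter fun q =>
          isClosed_le (by fun_prop) (by fun_prop)
      · exact isClosed_eq (f := fun z : (ι → ℝ) × ℝ => z.1 i₀) (by fun_prop) (by fun_prop)
      · exact isClosed_le (f := fun z : (ι → ℝ) × ℝ => z.2) (by fun_prop) (by fun_prop)
    · rintro ⟨y, ρ⟩ ⟨h1, h2, h3⟩
      simp only at h1 h2 h3
      refine ⟨⟨fun q => ?_, ?_⟩, fun p => ?_, h3⟩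
      · have := h1 i₀ q
        simp only
        linarith
      · have := h1 i₀ i₀
        simp only
        linarith
      · have := h1 p i₀
        simp only
        linarith
  have hne : K.Nonempty := ⟨(fun i => c i - c i₀, R), fun p q => by
    have := hc p q
    simp only
    linarith, by simp, le_refl R⟩
  obtain ⟨⟨y, ρ⟩, hmem, hmin⟩ := hK.exists_isMinOn hne continuous_snd.continuousOn
  refine ⟨ρ, hmem.2.2, ⟨y, hmem.1⟩, fun ρ' y' h' => ?_⟩
  by_contra! hlt
  have h4 : ((fun i => y' i - y' i₀, ρ') : (ι → ℝ) × ℝ) ∈ K := ⟨fun p q => by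
    have := h' p q
    simp only
    linarith, by simp, hlt.le.trans hmem.2.2⟩
  exact absurd (isMinOn_iff.1 hmin _ h4) (not_le.2 hlt)

/-- For the least `ρ`, a solution with as few equalities as possible contains an infinite walk of
equalities: the value at a vertex that such a walk could enter but not leave could be raised. -/
theorem exists_tight_walk (w : ι → ι → ℝ) {c : ι → ℝ} {R : ℝ}
    (hc : ∀ p q, w p q + c p - c q ≤ R) :
    ∃ ρ ≤ R, ∃ y : ι → ℝ, (∀ p q, w p q + y p - y q ≤ ρ) ∧
      ∃ (i : ι) (s : ι → ι), ∀ t : ℕ,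
        w (s^[t] i) (s^[t + 1] i) + y (s^[t] i) - y (s^[t + 1] i) = ρ := by
  classical
  obtain ⟨ρ, hρ, hy, hmin⟩ := exists_least_bound w hc
  -- `T y` is the set of equalities for the solution `y`
  let T : (ι → ℝ) → Finset (ι × ι) := fun y =>
    Finset.univ.filter fun z => w z.1 z.2 + y z.1 - y z.2 = ρ
  have hex : ∃ k, ∃ y : ι → ℝ, (∀ p q, w p q + y p - y q ≤ ρ) ∧ (T y).card = k :=
    ⟨_, hy.choose, hy.choose_spec, rfl⟩
  obtain ⟨y, hy, hk⟩ := Nat.find_spec hex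
  have hmin' : ∀ y' : ι → ℝ, (∀ p q, w p q + y' p - y' q ≤ ρ) → (T y).card ≤ (T y').card :=
    fun y' h' => by rw [hk]; exact Nat.find_min' hex ⟨y', h', rfl⟩
  have hmemT : ∀ (y' : ι → ℝ) p q, (p, q) ∈ T y' ↔ w p q + y' p - y' q = ρ := fun y' p q => by
    simp [T]
  have hstart : ∃ p q, w p q + y p - y q = ρ := by
    obtain ⟨z, -, hz⟩ := Finset.exists_max_image (Finset.univ : Finset (ι × ι))
      (fun z => w z.1 z.2 + y z.1 - y z.2) Finset.univ_nonempty
    exact ⟨z.1, z.2, le_antisymm (hy _ _)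
      (hmin _ y fun p q => hz (p, q) (Finset.mem_univ _))⟩
  have hnext : ∀ i, (∃ p, w p i + y p - y i = ρ) → ∃ q, w i q + y i - y q = ρ := by
    rintro i ⟨p, hp⟩
    by_contra! hno
    obtain ⟨q₀, -, hq₀⟩ := Finset.exists_max_image (Finset.univ : Finset ι)
      (fun q => w i q + y i - y q) Finset.univ_nonempty
    have hlt : w i q₀ + y i - y q₀ < ρ := lt_of_le_of_ne (hy _ _) (hno _)
    obtain ⟨ε, hε, hε'⟩ : ∃ ε > 0, ∀ q, w i q + y i - y q + ε < ρ := by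
      refine ⟨(ρ - (w i q₀ + y i - y q₀)) / 2, by linarith, fun q => ?_⟩
      have := hq₀ q (Finset.mem_univ _)
      linarith
    let y' := Function.update y i (y i + ε)
    have hy'i : y' i = y i + ε := by simp [y']
    have hy'o : ∀ q, q ≠ i → y' q = y q := fun q hq => by simp [y', hq]
    have hstep : ∀ a b, w a b + y' a - y' b ≤ ρ ∧
        (w a b + y' a - y' b = ρ → w a b + y a - y b = ρ ∧ b ≠ i) := by
      intro a b
      have hab := hy a b
      by_cases ha : a = i <;> by_cases hb : b = i
      · subst ha; subst hb
        have := hε' b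
        exact ⟨by linarith, fun h => by linarith⟩
      · subst ha
        rw [hy'i, hy'o b hb]
        have := hε' b
        exact ⟨by linarith, fun h => by linarith⟩
      · subst hb
        rw [hy'i, hy'o a ha]
        exact ⟨by linarith, fun h => by linarith⟩
      · rw [hy'o a ha, hy'o b hb]
        exact ⟨hab, fun h => ⟨h, hb⟩⟩
    have hss : T y' ⊂ T y := by
      refine (Finset.ssubset_iff_of_subset ?_).2 ⟨(p, i), (hmemT _ _ _).2 hp, fun h => ?_⟩
      · rintro ⟨a, b⟩ h
        exact (hmemT _ _ _).2 ((hstep a b).2 ((hmemT _ _ _).1 h)).1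
      · exact ((hstep p i).2 ((hmemT _ _ _).1 h)).2 rfl
    exact absurd (Finset.card_lt_card hss) (not_lt.2 (hmin' y' fun a b => (hstep a b).1))
  obtain ⟨p, i, hpi⟩ := hstart
  let s : ι → ι := fun i => if h : ∃ p, w p i + y p - y i = ρ then (hnext i h).choose else i
  have hs : ∀ i, (∃ p, w p i + y p - y i = ρ) → w i (s i) + y i - y (s i) = ρ := fun i h => by
    simp only [s, dif_pos h]
    exact (hnext i h).choose_spec
  have hin : ∀ t : ℕ, ∃ p, w p (s^[t] i) + y p - y (s^[t] i) = ρ := by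
    intro t
    induction t with
    | zero => exact ⟨p, hpi⟩
    | succ t ih => rw [Function.iterate_succ_apply']; exact ⟨_, hs _ ih⟩
  exact ⟨ρ, hρ, y, hy, i, s, fun t => by rw [Function.iterate_succ_apply']; exact hs _ (hin t)⟩

/-- For integral `w` the optimal `ρ` is the mean `j / n` of `w` along a cycle, and, after scaling by
`n` and rounding down, the solution becomes integral and takes all values modulo `n` along this
cycle. -/
theorem exists_integral_potential (w : ι → ι → ℤ) {c : ι → ℝ} {R : ℝ}
    (hc : ∀ p q, w p q + c p - c q ≤ R) :
    ∃ (n : ℕ) (j : ℤ) (y : ι → ℤ), 0 < n ∧ (j : ℝ) / n ≤ R ∧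
      (∀ p q, n * w p q + y p - y q ≤ j) ∧ ∀ k : ℤ, ∃ i, (n : ℤ) ∣ k - y i := by
  obtain ⟨ρ, hρ, y, hy, i, s, hs⟩ := exists_tight_walk (fun p q => (w p q : ℝ)) hc
  have hsum : ∀ t : ℕ, ∃ W : ℤ, y (s^[t] i) = y i + W - t * ρ := by
    intro t
    induction t with
    | zero => exact ⟨0, by simp⟩
    | succ t ih =>
      obtain ⟨W, hW⟩ := ih
      refine ⟨W + w (s^[t] i) (s^[t + 1] i), ?_⟩
      have := hs t
      push_cast
      linarith
  -- the walk returns to some vertex, so that `ρ` is rational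
  obtain ⟨x, hx⟩ : ∃ x : ℚ, (x : ℝ) = ρ := by
    obtain ⟨a, b, hab, heq⟩ := Finite.exists_ne_map_eq_of_infinite fun t : ℕ => s^[t] i
    obtain ⟨A, hA⟩ := hsum a
    obtain ⟨B, hB⟩ := hsum b
    have h1 : ((b : ℝ) - a) * ρ = B - A := by
      rw [heq] at hA
      linarith
    have h2 : (b : ℝ) - a ≠ 0 := sub_ne_zero.2 (by exact_mod_cast hab.symm)
    refine ⟨((B : ℚ) - A) / ((b : ℚ) - a), ?_⟩
    push_cast
    rw [← h1]
    field_simp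
  have hn : (0 : ℝ) < x.den := by exact_mod_cast x.den_pos
  have hxd : (x.den : ℝ) * ρ = x.num := by
    rw [← hx]
    exact_mod_cast Rat.den_mul_eq_num x
  refine ⟨x.den, x.num, fun q => ⌊x.den * (y q - y i)⌋, x.den_pos, ?_, fun p q => ?_, fun k => ?_⟩
  · rw [div_le_iff₀ hn]
    nlinarith
  · have h1 := mul_le_mul_of_nonneg_left (hy p q) hn.le
    rw [hxd] at h1
    have h2 : (x.den * w p q - x.num + ⌊(x.den : ℝ) * (y p - y i)⌋ : ℤ) ≤
        ⌊(x.den : ℝ) * (y q - y i)⌋ := by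
      rw [Int.le_floor]
      push_cast
      have := Int.floor_le ((x.den : ℝ) * (y p - y i))
      linarith
    linarith
  · -- along the walk the values are `- t j` modulo `n`, and `j` is prime to `n`
    have hcop : IsCoprime x.num (x.den : ℤ) := Rat.isCoprime_num_den x
    obtain ⟨u, v, huv⟩ := hcop
    obtain ⟨W, hW⟩ := hsum (-(k * u) % x.den).toNat
    refine ⟨s^[(-(k * u) % x.den).toNat] i, ?_⟩
    have h0 : 0 ≤ -(k * u) % (x.den : ℤ) := Int.emod_nonneg _ (by exact_mod_cast x.den_pos.ne')
    generalize hT : -(k * u) % (x.den : ℤ) = T at *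
    obtain ⟨t, rfl⟩ := Int.eq_ofNat_of_zero_le h0
    rw [Int.toNat_natCast] at *
    have h3 : (x.den : ℝ) * (y (s^[t] i) - y i) = ((x.den * W - t * x.num : ℤ) : ℝ) := by
      rw [hW]
      push_cast
      rw [← hxd]
      ring
    change (x.den : ℤ) ∣ k - ⌊(x.den : ℝ) * (y (s^[t] i) - y i)⌋
    rw [h3, Int.floor_intCast]
    have h4 := Int.mul_ediv_add_emod (-(k * u)) x.den
    rw [hT] at h4
    refine ⟨k * v - W - (-(k * u) / (x.den : ℤ)) * x.num, ?_⟩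
    linear_combination (-k) * huv + x.num * h4

end Potentials

/-! ### Moy--Prasad groups and norms -/

section MoyPrasad

variable (F : Type*) [Field F] [ValuativeRel F] [TopologicalSpace F] [IsNonarchimedeanLocalField F]
variable {D : Type*} [DivisionRing D] [Algebra F D] [FiniteDimensional F D] {m : ℕ}

/-- The condition `v(a) + t ≥ s` for real `s` and `t`, where `v` extends the valuation of `F`. -/
def ordGE (t s : ℝ) (a : D) : Prop := a = 0 ∨ s ≤ (valD F a : ℝ) / (ramD F D : ℝ) + t

variable {F}

theorem ramD_cast_pos : (0 : ℝ) < ramD F D := by exact_mod_cast (ramD_pos (F := F) (D := D))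

theorem ordGE_iff {t s : ℝ} {a : D} :
    ordGE F t s a ↔ (s : WithTop ℝ) ≤ ordD F a + (t : WithTop ℝ) := by
  by_cases ha : a = 0
  · simp [ha, ordGE, ordD]
  · rw [ordD_eq ha, ← WithTop.coe_add, WithTop.coe_le_coe, ordGE, or_iff_right ha]

theorem ordGE_mono {t s t' s' : ℝ} {a : D} (h : ordGE F t s a) (hk : s' - t' ≤ s - t) :
    ordGE F t' s' a := h.imp_right fun h => by linarith

theorem ordGE_add {t s : ℝ} {a b : D} (ha : ordGE F t s a) (hb : ordGE F t s b) :
    ordGE F t s (a + b) := by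
  by_cases ha0 : a = 0
  · simpa [ha0] using hb
  by_cases hb0 : b = 0
  · simpa [hb0] using ha
  by_cases h : a + b = 0
  · exact Or.inl h
  have h1 := ha.resolve_left ha0
  have h2 := hb.resolve_left hb0
  right
  have hE : (0 : ℝ) < ramD F D := ramD_cast_pos
  rcases min_le_iff.1 (valD_add (F := F) ha0 hb0 h) with h3 | h3
  · have h4 : (valD F a : ℝ) / ramD F D ≤ valD F (a + b) / ramD F D := by gcongr
    linarith
  · have h4 : (valD F b : ℝ) / ramD F D ≤ valD F (a + b) / ramD F D := by gcongr
    linarith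

theorem ordGE_neg {t s : ℝ} {a : D} (ha : ordGE F t s a) : ordGE F t s (-a) := by
  rcases ha with rfl | h
  · simp [ordGE]
  · exact Or.inr (by rwa [valD_neg])

theorem ordGE_sum {ι : Type*} (u : Finset ι) {t s : ℝ} {f : ι → D}
    (h : ∀ i ∈ u, ordGE F t s (f i)) : ordGE F t s (∑ i ∈ u, f i) := by
  classical
  induction u using Finset.induction_on with
  | empty => simp [ordGE]
  | insert i u hi ih =>
    rw [Finset.sum_insert hi]
    exact ordGE_add (h i (by simp)) (ih fun j hj => h j (by simp [hj]))

theorem ordGE_mul {t s t' s' : ℝ} {a b : D} (ha : ordGE F t s a) (hb : ordGE F t' s' b) :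
    ordGE F (t + t') (s + s') (a * b) := by
  by_cases ha0 : a = 0
  · simp [ha0, ordGE]
  by_cases hb0 : b = 0
  · simp [hb0, ordGE]
  have h1 := ha.resolve_left ha0
  have h2 := hb.resolve_left hb0
  right; rw [valD_mul ha0 hb0]; push_cast; rw [add_div]; linarith

theorem ordGE_one : ordGE F 0 0 (1 : D) := Or.inr (by simp [valD_one])

theorem not_ordGE_one {s : ℝ} (hs : 0 < s) : ¬ ordGE F 0 s (1 : D) := by
  simp [ordGE, valD_one, hs]

theorem ne_zero_of_ordGE_sub_one {s : ℝ} (hs : 0 < s) {d : D} (hd : ordGE F 0 s (d - 1)) :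
    d ≠ 0 := by
  rintro rfl
  have := ordGE_neg hd
  rw [zero_sub, neg_neg] at this
  exact not_ordGE_one hs this

theorem ordD_eq_zero_of_ordGE_sub_one {s : ℝ} (hs : 0 < s) {d : D} (hd : ordGE F 0 s (d - 1)) :
    ordD F d = 0 := by
  have hd0 := ne_zero_of_ordGE_sub_one hs hd
  have hE : (0 : ℝ) < ramD F D := ramD_cast_pos
  rw [ordD_eq hd0, ← WithTop.coe_zero, WithTop.coe_inj]
  apply le_antisymm
  · by_contra! hlt
    set s' := min s ((valD F d : ℝ) / ramD F D)
    have h1 : ordGE F 0 s' d := Or.inr (by rw [add_zero]; exact min_le_right _ _)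
    have h2 : ordGE F 0 s' (d - 1) := ordGE_mono hd (by simp [s'])
    have h3 := ordGE_add h1 (ordGE_neg h2)
    rw [← sub_eq_add_neg, sub_sub_cancel] at h3
    exact not_ordGE_one (lt_min hs hlt) h3
  · have h1 := ordGE_add (ordGE_mono hd (by linarith : (0 : ℝ) - 0 ≤ s - 0)) ordGE_one
    rw [sub_add_cancel] at h1
    simpa using h1.resolve_left hd0

theorem le_splitNorm_iff {p : (Matrix (Fin m) (Fin m) D)ˣ × (Fin m → ℝ)} {z : ℝ} {w : Fin m → D} :
    (z : WithTop ℝ) ≤ splitNorm F p w ↔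
      ∀ i, ordGE F (p.2 i) z ((↑p.1⁻¹ : Matrix (Fin m) (Fin m) D).mulVec w i) := by
  simp only [splitNorm, Finset.le_inf_iff, Finset.mem_univ, true_implies, ordGE_iff]

variable (F) in
/-- The endomorphisms of `D^m` that raise the norm attached to `p` by at least `s`. -/
def endGE (p : (Matrix (Fin m) (Fin m) D)ˣ × (Fin m → ℝ)) (s : ℝ) :
    AddSubgroup (Matrix (Fin m) (Fin m) D) where
  carrier := {a | ∀ (z : ℝ) (w : Fin m → D), (z : WithTop ℝ) ≤ splitNorm F p w →
    ((z + s : ℝ) : WithTop ℝ) ≤ splitNorm F p (a.mulVec w)}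
  zero_mem' := fun z w _ => by
    rw [le_splitNorm_iff]
    intro i
    simp [ordGE]
  add_mem' := fun ha hb z w hw => by
    have h1 := ha z w hw
    have h2 := hb z w hw
    rw [le_splitNorm_iff] at *
    intro i
    rw [Matrix.add_mulVec, Matrix.mulVec_add]
    exact ordGE_add (h1 i) (h2 i)
  neg_mem' := fun ha z w hw => by
    have h1 := ha z w hw
    rw [le_splitNorm_iff] at *
    intro i
    rw [Matrix.neg_mulVec, Matrix.mulVec_neg]
    exact ordGE_neg (h1 i)

variable {p : (Matrix (Fin m) (Fin m) D)ˣ × (Fin m → ℝ)} {s : ℝ}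

theorem mem_endGE {a : Matrix (Fin m) (Fin m) D} :
    a ∈ endGE F p s ↔ ∀ (z : ℝ) (w : Fin m → D), (z : WithTop ℝ) ≤ splitNorm F p w →
      ((z + s : ℝ) : WithTop ℝ) ≤ splitNorm F p (a.mulVec w) := Iff.rfl

/-- The description in terms of matrix entries. -/
theorem mem_endGE_iff {a : Matrix (Fin m) (Fin m) D} :
    a ∈ endGE F p s ↔ ∀ i j, ordGE F (p.2 i - p.2 j) s (coord p.1 a i j) := by
  obtain ⟨g, c⟩ := p
  constructor
  · intro h i j
    have h1 : ((c j : ℝ) : WithTop ℝ) ≤ splitNorm F (g, c) (g.val.mulVec (Pi.single j 1)) := by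
      rw [le_splitNorm_iff]
      intro i
      rw [Matrix.mulVec_mulVec, Units.inv_mul, Matrix.one_mulVec]
      by_cases hij : i = j
      · subst hij
        simpa using ordGE_mono (ordGE_one (F := F) (D := D)) (by simp)
      · simp [hij, ordGE]
    have h2 := le_splitNorm_iff.1 (mem_endGE.1 h _ _ h1) i
    have h3 : (↑g⁻¹ : Matrix (Fin m) (Fin m) D).mulVec (a.mulVec (g.val.mulVec (Pi.single j 1))) i =
        coord g a i j := by
      rw [Matrix.mulVec_mulVec, Matrix.mulVec_mulVec]
      simp [coord]
    rw [h3] at h2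
    exact ordGE_mono h2 (by simp only; linarith)
  · intro h z w hw
    rw [le_splitNorm_iff] at *
    intro i
    have h1 : (↑g⁻¹ : Matrix (Fin m) (Fin m) D).mulVec (a.mulVec w) =
        (coord g a).mulVec ((↑g⁻¹ : Matrix (Fin m) (Fin m) D).mulVec w) := by
      rw [Matrix.mulVec_mulVec, Matrix.mulVec_mulVec, coord, mul_assoc _ g.val, Units.mul_inv,
        mul_one]
    rw [h1, Matrix.mulVec, dotProduct]
    exact ordGE_sum _ fun j _ => ordGE_mono (ordGE_mul (h i j) (hw j)) (by simp only; linarith)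

theorem mul_mem_endGE {t : ℝ} {a b : Matrix (Fin m) (Fin m) D} (ha : a ∈ endGE F p s)
    (hb : b ∈ endGE F p t) : a * b ∈ endGE F p (t + s) := fun z w hw => by
  rw [← Matrix.mulVec_mulVec, ← add_assoc]
  exact ha _ _ (hb _ _ hw)

theorem one_mem_endGE : (1 : Matrix (Fin m) (Fin m) D) ∈ endGE F p 0 := fun z w hw => by
  simpa using hw

theorem endGE_anti {t : ℝ} (h : s ≤ t) : endGE F p t ≤ endGE F p s := fun a ha => by
  rw [mem_endGE_iff] at *
  exact fun i j => ordGE_mono (ha i j) (by linarith)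

/-- Adding a constant to the norm does not change the endomorphisms that raise it by `s`. -/
theorem endGE_congr {q : (Matrix (Fin m) (Fin m) D)ˣ × (Fin m → ℝ)}
    (h : (buildingSetoid F D m) p q) : endGE F p s = endGE F q s := by
  have key : ∀ {p q : (Matrix (Fin m) (Fin m) D)ˣ × (Fin m → ℝ)}, (buildingSetoid F D m) p q →
      endGE F p s ≤ endGE F q s := by
    rintro p q ⟨k, hk⟩ a ha z w hw
    have h1 : ((z + k : ℝ) : WithTop ℝ) ≤ splitNorm F p w := by
      rw [hk, WithTop.coe_add]
      gcongr
    have h2 := ha _ _ h1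
    rw [hk, show z + k + s = z + s + k by ring, WithTop.coe_add] at h2
    exact (WithTop.add_le_add_iff_right WithTop.coe_ne_top).1 h2
  exact le_antisymm (key h) (key ((buildingSetoid F D m).symm h))

variable (F) in
/-- The group of all `u` such that `u - 1` and `u⁻¹ - 1` raise the norm attached to `p` by at least
`s`. -/
def endUnits (p : (Matrix (Fin m) (Fin m) D)ˣ × (Fin m → ℝ)) {s : ℝ} (hs : 0 ≤ s) :
    Subgroup (Matrix (Fin m) (Fin m) D)ˣ where
  carrier := {u | u.val - 1 ∈ endGE F p s ∧ (↑u⁻¹ : Matrix (Fin m) (Fin m) D) - 1 ∈ endGE F p s}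
  one_mem' := by simp
  mul_mem' := by
    have key : ∀ a b : Matrix (Fin m) (Fin m) D, a - 1 ∈ endGE F p s → b - 1 ∈ endGE F p s →
        a * b - 1 ∈ endGE F p s := fun a b ha hb => by
      have h1 : a ∈ endGE F p 0 := by
        simpa using add_mem (endGE_anti hs ha) one_mem_endGE
      have h2 := mul_mem_endGE h1 hb
      rw [add_zero] at h2
      have h2 := add_mem h2 ha
      convert h2 using 1
      noncomm_ring
    intro u v hu hv
    refine ⟨key _ _ hu.1 hv.1, ?_⟩
    rw [mul_inv_rev]
    exact key _ _ hv.2 hu.2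
  inv_mem' := fun hu => ⟨hu.2, by rw [inv_inv]; exact hu.1⟩

theorem standardMoyPrasad_le (g : (Matrix (Fin m) (Fin m) D)ˣ) (c : Fin m → ℝ) (hs : 0 ≤ s) :
    (standardMoyPrasad F c s).map (MulAut.conj g).toMonoidHom ≤ endUnits F (g, c) hs := by
  have key : ∀ h : (Matrix (Fin m) (Fin m) D)ˣ,
      (∀ i j, ordGE F (c i - c j) s ((h.val - 1) i j)) →
      (∀ i j, ordGE F (c i - c j) s (((↑h⁻¹ : Matrix (Fin m) (Fin m) D) - 1) i j)) →
      h ∈ (endUnits F (g, c) hs).comap (MulAut.conj g).toMonoidHom := by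
    intro h h1 h2
    refine ⟨?_, ?_⟩
    · rw [mem_endGE_iff]
      simpa [coord, mul_sub, sub_mul, mul_assoc] using h1
    · rw [mem_endGE_iff, ← map_inv]
      simpa [coord, mul_sub, sub_mul, mul_assoc] using h2
  rw [Subgroup.map_le_iff_le_comap, standardMoyPrasad, Subgroup.closure_le]
  rintro h (⟨t, ht, hh⟩ | ⟨i, j, a, hij, ha, hh⟩)
  · have ht0 : ∀ i, t i ≠ 0 := fun i h0 => by
      have := (ht i).1
      simp [h0, ordD] at this
    have hinv : (↑h⁻¹ : Matrix (Fin m) (Fin m) D) = Matrix.diagonal fun i => (t i)⁻¹ := by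
      refine Units.inv_eq_of_mul_eq_one_right ?_
      rw [hh, Matrix.diagonal_mul_diagonal, ← Matrix.diagonal_one]
      congr 1
      funext i
      exact mul_inv_cancel₀ (ht0 i)
    have hoff : ∀ i j (x : Fin m → D), ordGE F 0 s (x i - 1) →
        ordGE F (c i - c j) s ((Matrix.diagonal x - 1) i j) := fun i j x hx => by
      rw [Matrix.sub_apply, Matrix.diagonal_apply, Matrix.one_apply]
      split_ifs with hij
      · subst hij
        rwa [sub_self]
      · simp [ordGE]
    have h1 : ∀ i, ordGE F 0 s (t i - 1) := fun i => by
      rw [ordGE_iff]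
      simpa using (ht i).2
    refine key h ?_ ?_
    · rw [hh]
      exact fun i j => hoff i j t (h1 i)
    · rw [hinv]
      refine fun i j => hoff i j _ ?_
      have h2 : ordGE F 0 0 (t i)⁻¹ := by
        right
        have h3 := (ht i).1
        rw [ordD_eq (ht0 i), ← WithTop.coe_zero, WithTop.coe_inj] at h3
        rw [valD_inv (ht0 i)]
        push_cast
        rw [neg_div, h3]
        simp
      have h3 := ordGE_neg (ordGE_mul h2 (h1 i))
      rw [mul_sub, inv_mul_cancel₀ (ht0 i), mul_one, neg_sub, add_zero, zero_add] at h3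
      exact h3
  · have hinv : (↑h⁻¹ : Matrix (Fin m) (Fin m) D) = 1 - Matrix.single i j a := by
      refine Units.inv_eq_of_mul_eq_one_right ?_
      rw [hh, mul_sub, add_mul, add_mul]
      simp [Matrix.single_mul_single_of_ne _ _ _ _ hij.symm]
    have h1 : ∀ p q, ordGE F (c p - c q) s (Matrix.single i j a p q) := fun p q => by
      rw [Matrix.single_apply]
      split_ifs with hpq
      · obtain ⟨rfl, rfl⟩ := hpq
        exact ordGE_iff.2 ha
      · simp [ordGE]
    refine key h ?_ ?_
    · rw [hh, add_sub_cancel_left]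
      exact h1
    · rw [hinv, sub_sub_cancel_left]
      exact fun p q => ordGE_neg (h1 p q)

/-- The generators of `P_{x,s}` come from all pairs that represent `x`, and for all of them the norm
is the same up to a constant. -/
theorem moyPrasad_le (hs : 0 ≤ s) :
    moyPrasad F (Quotient.mk (buildingSetoid F D m) p) s ≤ endUnits F p hs := by
  refine iSup₂_le fun q hq => (standardMoyPrasad_le q.1 q.2 hs).trans ?_
  intro u hu
  have h := Quotient.exact hq
  exact ⟨endGE_congr (F := F) h ▸ hu.1, endGE_congr (F := F) h ▸ hu.2⟩

end MoyPrasad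

/-! ### Elimination in Moy--Prasad groups -/

section Elimination

variable {F : Type*} [Field F] [ValuativeRel F] [TopologicalSpace F] [IsNonarchimedeanLocalField F]
variable {D : Type*} [DivisionRing D] [Algebra F D] [FiniteDimensional F D] {m : ℕ}
variable {c : Fin m → ℝ} {s : ℝ}

theorem exists_transvection_mem {i j : Fin m} (hij : i ≠ j) {a : D}
    (ha : ordGE F (c i - c j) s a) :
    ∃ v ∈ standardMoyPrasad F c s, v.val = 1 + Matrix.single i j a := by
  have h : ∀ b : D, (1 + Matrix.single i j b) * (1 + Matrix.single i j (-b)) = 1 := fun b => by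
    rw [mul_add, mul_one, add_mul, one_mul, Matrix.single_mul_single_of_ne _ _ _ _ hij.symm,
      add_zero, add_assoc, ← Matrix.single_add, add_neg_cancel, Matrix.single_zero,
      add_zero]
  refine ⟨⟨1 + Matrix.single i j a, 1 + Matrix.single i j (-a), h a, by simpa using h (-a)⟩,
    Subgroup.subset_closure (Or.inr ⟨i, j, a, hij, ordGE_iff.1 ha, rfl⟩), rfl⟩

theorem exists_diagonal_mem (hs : 0 < s) (q : Fin m) {d : D} (hd : ordGE F 0 s (d - 1)) :
    ∃ v ∈ standardMoyPrasad F c s, v.val = Matrix.diagonal (Function.update 1 q d) := by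
  have hd0 := ne_zero_of_ordGE_sub_one hs hd
  have h : ∀ a b : D, a * b = 1 → Matrix.diagonal (Function.update (1 : Fin m → D) q a) *
      Matrix.diagonal (Function.update (1 : Fin m → D) q b) = 1 := fun a b hab => by
    rw [Matrix.diagonal_mul_diagonal, ← Matrix.diagonal_one]
    congr 1
    funext i
    by_cases hi : i = q
    · subst hi; simpa using hab
    · simp [hi]
  refine ⟨⟨_, Matrix.diagonal (Function.update 1 q d⁻¹), h _ _ (mul_inv_cancel₀ hd0),
    h _ _ (inv_mul_cancel₀ hd0)⟩, Subgroup.subset_closure (Or.inl ⟨_, fun i => ?_, rfl⟩), rfl⟩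
  by_cases hi : i = q
  · subst hi
    refine ⟨by simpa using ordD_eq_zero_of_ordGE_sub_one hs hd, ?_⟩
    simpa using ordGE_iff.1 hd
  · simp only [Function.update_of_ne hi, Pi.one_apply]
    exact ⟨by simp [ordD_eq (one_ne_zero (α := D)), valD_one], by simp [ordD]⟩

/-- The matrix that differs from `1` only in column `q`, where it agrees with `h`, is a product of
generators. -/
theorem exists_column_mem (hs : 0 < s) {h : Matrix (Fin m) (Fin m) D}
    (hh : ∀ i j, ordGE F (c i - c j) s ((h - 1) i j)) (q : Fin m) :
    ∃ v ∈ standardMoyPrasad F c s, (∀ i, v.val i q = h i q) ∧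
      ∀ i j, j ≠ q → v.val i j = (1 : Matrix (Fin m) (Fin m) D) i j := by
  have hoff : ∀ T : Finset (Fin m), q ∉ T → ∃ v ∈ standardMoyPrasad F c s, ∀ i j, v.val i j =
      (1 : Matrix (Fin m) (Fin m) D) i j + if i ∈ T ∧ j = q then h i q else 0 := by
    intro T
    induction T using Finset.induction_on with
    | empty => exact fun _ => ⟨1, one_mem _, by simp⟩
    | insert k T hk ih =>
      intro hq
      rw [Finset.mem_insert, not_or] at hq
      obtain ⟨v, hv, hval⟩ := ih hq.2
      have hkq : k ≠ q := fun hkq => hq.1 hkq.symm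
      have h1 := hh k q
      rw [Matrix.sub_apply, Matrix.one_apply_ne hkq, sub_zero] at h1
      obtain ⟨u, hu, huval⟩ := exists_transvection_mem hkq h1
      refine ⟨v * u, mul_mem hv hu, fun i j => ?_⟩
      rw [Units.val_mul, huval, mul_add, mul_one, Matrix.add_apply, hval, add_assoc]
      congr 1
      by_cases hj : j = q
      · subst hj
        rw [Matrix.mul_single_apply_same, hval i k,
          if_neg (show ¬(i ∈ T ∧ k = j) from fun h => hkq h.2), add_zero, Matrix.one_apply]
        by_cases hik : i = k
        · subst hik
          simp [hk]
        · simp [hik]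
      · rw [Matrix.mul_single_apply_of_ne _ _ _ _ _ hj]
        simp [hj]
  obtain ⟨v, hv, hval⟩ := hoff (Finset.univ.erase q) (by simp)
  have h1 := hh q q
  rw [Matrix.sub_apply, Matrix.one_apply_eq, sub_self] at h1
  obtain ⟨u, hu, huval⟩ := exists_diagonal_mem (c := c) hs q h1
  refine ⟨u * v, mul_mem hu hv, fun i => ?_, fun i j hj => ?_⟩
  · rw [Units.val_mul, huval, Matrix.diagonal_mul, hval]
    by_cases hi : i = q
    · subst hi; simp
    · simp [hi]
  · rw [Units.val_mul, huval, Matrix.diagonal_mul, hval]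
    by_cases hi : i = q
    · subst hi; simp [hj, Matrix.one_apply_ne (Ne.symm hj)]
    · simp [hi, hj]

/-- Gaussian elimination: for `s > 0` all diagonal entries of `h` are units, so that the columns of
`h` can be cleared one after the other by elements of the group. -/
theorem mem_standardMoyPrasad (hs : 0 < s) {h : (Matrix (Fin m) (Fin m) D)ˣ}
    (hh : ∀ i j, ordGE F (c i - c j) s ((h.val - 1) i j)) : h ∈ standardMoyPrasad F c s := by
  have hP : standardMoyPrasad (D := D) F c s ≤
      endUnits F ((1 : (Matrix (Fin m) (Fin m) D)ˣ), c) hs.le := by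
    have := standardMoyPrasad_le (F := F) (1 : (Matrix (Fin m) (Fin m) D)ˣ) c hs.le
    rwa [map_one,
      show (1 : MulAut (Matrix (Fin m) (Fin m) D)ˣ).toMonoidHom = MonoidHom.id _ from rfl,
      Subgroup.map_id] at this
  have hcoord : ∀ a : Matrix (Fin m) (Fin m) D,
      a ∈ endGE F ((1 : (Matrix (Fin m) (Fin m) D)ˣ), c) s ↔
        ∀ i j, ordGE F (c i - c j) s (a i j) := fun a => by
    rw [mem_endGE_iff]; simp only [coord_one_left]
  have key : ∀ S : Finset (Fin m), ∃ u ∈ standardMoyPrasad F c s,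
      (∀ i j, ordGE F (c i - c j) s (((u * h).val - 1) i j)) ∧
      ∀ i, ∀ j ∈ S, (u * h).val i j = (1 : Matrix (Fin m) (Fin m) D) i j := by
    intro S
    induction S using Finset.induction_on with
    | empty => exact ⟨1, one_mem _, by simpa using hh, by simp⟩
    | insert q S hq ih =>
      obtain ⟨u, hu, hu1, hu2⟩ := ih
      obtain ⟨v, hv, hv1, hv2⟩ := exists_column_mem hs hu1 q
      refine ⟨v⁻¹ * u, mul_mem (inv_mem hv) hu, ?_, fun i j hj => ?_⟩
      · rw [← hcoord] at hu1 ⊢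
        have h1 := (hP hv).2
        have h2 := mul_mem_endGE (endGE_anti hs.le h1) hu1
        rw [add_zero] at h2
        have h3 := add_mem (add_mem h2 hu1) h1
        rw [mul_assoc, Units.val_mul]
        convert h3 using 1
        noncomm_ring
      · -- columns `j` of `v` and of `u h` agree
        have h1 : ∀ k, (u * h).val k j = v.val k j := fun k => by
          by_cases hjq : j = q
          · rw [hjq, hv1]
          · rw [hv2 _ _ hjq, hu2 _ _ (Finset.mem_of_mem_insert_of_ne hj hjq)]
        rw [mul_assoc, Units.val_mul, Matrix.mul_apply]
        simp_rw [h1]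
        rw [← Matrix.mul_apply, Units.inv_mul]
  obtain ⟨u, hu, -, hu2⟩ := key Finset.univ
  have h1 : u * h = 1 := Units.ext <| by
    ext i j
    exact hu2 i j (Finset.mem_univ _)
  rw [eq_inv_of_mul_eq_one_right h1]
  exact inv_mem hu

end Elimination

/-! ### Comparison of the two filtrations -/

section Comparison

variable {F : Type*} [Field F] [ValuativeRel F] [TopologicalSpace F] [IsNonarchimedeanLocalField F]
variable {D : Type*} [DivisionRing D] [Algebra F D] [FiniteDimensional F D] {m : ℕ}

/-- For the point `x` given by the frame and the exponents of a standard order, scaled by the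
ramification index, `P_{x,r+}` is contained in `U^{j+1}` if `r = j / e`. -/
theorem IsHereditaryOrder.exists_moyPrasadPlus_le (hm : 0 < m)
    {𝔄 : Subalgebra 𝒪[F] (Matrix (Fin m) (Fin m) D)} (h : IsHereditaryOrder 𝔄) (j : ℕ) :
    ∃ x : Building F D m, moyPrasadPlus F x ((j : ℝ) / ramificationIndex 𝔄) ≤ U 𝔄 (j + 1) := by
  obtain ⟨g, n, y, hn, hy, rfl⟩ := h.exists_eq_stdOrder hm
  refine ⟨Quotient.mk _ (g, fun i => (y i : ℝ) / (n * ramD F D)), ?_⟩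
  rw [ramificationIndex_stdOrder hm hn hy]
  refine iSup₂_le fun s hs => ?_
  have hn' : (0 : ℝ) < n := by exact_mod_cast hn
  have hE : (0 : ℝ) < ramD F D := ramD_cast_pos
  have hs0 : 0 ≤ s := le_trans (by positivity) hs.le
  intro u hu
  rw [mem_U_stdOrder hy]
  have h1 := (moyPrasad_le hs0 hu).1
  rw [mem_endGE_iff] at h1
  intro p q
  refine (h1 p q).imp_right fun h2 => ?_
  have h3 := hs.trans_le h2
  push_cast at h3
  rw [div_lt_iff₀ (by positivity)] at h3
  have h4 : ((j : ℤ) : ℝ) < ((n * valD F (coord g (u.val - 1) p q) + (y p - y q) : ℤ) : ℝ) := by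
    push_cast
    refine h3.trans_eq ?_
    field_simp
  have h5 := Int.cast_lt.1 h4
  omega

/-- Every group `P_{x,r+}` contains a group `U^{j+1}` of a standard order with `j / e ≤ r`. The
exponents `y` of the order solve the inequalities that express this inclusion. -/
theorem exists_U_le_moyPrasadPlus (hm : 0 < m) (x : Building F D m) {r : ℝ} (hr : 0 ≤ r) :
    ∃ (𝔄 : Subalgebra 𝒪[F] (Matrix (Fin m) (Fin m) D)) (j : ℕ), IsHereditaryOrder 𝔄 ∧
      U 𝔄 (j + 1) ≤ moyPrasadPlus F x r ∧ (j : ℝ) / ramificationIndex 𝔄 ≤ r := by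
  obtain ⟨⟨g, c⟩, rfl⟩ := Quotient.exists_rep x
  have : Nonempty (Fin m) := ⟨⟨0, hm⟩⟩
  have hE : (0 : ℝ) < ramD F D := ramD_cast_pos
  -- the largest integral valuation that violates `v(a) / E + c_p - c_q > r`
  let w : Fin m → Fin m → ℤ := fun p q => ⌊ramD F D * (r - c p + c q)⌋
  obtain ⟨n, j, y, hn, hj, hw, hy⟩ := exists_integral_potential w
    (c := fun i => ramD F D * c i) (R := ramD F D * r) fun p q => by
      have := Int.floor_le ((ramD F D : ℝ) * (r - c p + c q))
      simp only [w]
      linarith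
  have hj0 : 0 ≤ j := by
    have h1 := hw ⟨0, hm⟩ ⟨0, hm⟩
    have h2 : 0 ≤ w ⟨0, hm⟩ ⟨0, hm⟩ := Int.floor_nonneg.2 (by simpa using mul_nonneg hE.le hr)
    have h3 := mul_nonneg (Nat.cast_nonneg (α := ℤ) n) h2
    omega
  obtain ⟨j, rfl⟩ := Int.eq_ofNat_of_zero_le hj0
  have hn' : (0 : ℝ) < n := by exact_mod_cast hn
  refine ⟨stdOrder F g n y, j, isHereditaryOrder_stdOrder hn, ?_, ?_⟩
  · -- the inclusion holds for the smallest value `s > r` that entries of elements of `U` can attain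
    obtain ⟨z, -, hz⟩ := Finset.exists_min_image (Finset.univ : Finset (Fin m × Fin m))
      (fun z => ((w z.1 z.2 : ℝ) + 1) / ramD F D + (c z.1 - c z.2)) Finset.univ_nonempty
    set s := ((w z.1 z.2 : ℝ) + 1) / ramD F D + (c z.1 - c z.2) with hs
    have hrs : r < s := by
      have h1 := Int.lt_floor_add_one ((ramD F D : ℝ) * (r - c z.1 + c z.2))
      rw [← lt_div_iff₀' hE] at h1
      change r - c z.1 + c z.2 < ((w z.1 z.2 : ℝ) + 1) / ramD F D at h1
      linarith
    refine le_trans ?_ (le_iSup₂_of_le s hrs (le_iSup₂_of_le (g, c) rfl le_rfl))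
    intro u hu
    rw [mem_U_stdOrder hy] at hu
    refine ⟨g⁻¹ * u * g, mem_standardMoyPrasad (hr.trans_lt hrs) fun p q => ?_, ?_⟩
    · have h1 : (g⁻¹ * u * g).val - 1 = coord g (u.val - 1) := by
        simp [coord, mul_sub, sub_mul]
      rw [h1]
      refine (hu p q).imp_right fun h2 => ?_
      have h3 := hw p q
      have h4 : w p q + 1 ≤ valD F (coord g (u.val - 1) p q) := by
        have h5 : (n : ℤ) * w p q < n * valD F (coord g (u.val - 1) p q) := by
          omega
        exact lt_of_mul_lt_mul_left h5 (Nat.cast_nonneg n)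
      have h6 : ((w p q : ℝ) + 1) / ramD F D ≤
          (valD F (coord g (u.val - 1) p q) : ℝ) / ramD F D := by
        have : ((w p q : ℝ) + 1) ≤ valD F (coord g (u.val - 1) p q) := by exact_mod_cast h4
        gcongr
      have h7 := hz (p, q) (Finset.mem_univ _)
      simp only at h7
      linarith
    · simp [mul_assoc]
  · rw [ramificationIndex_stdOrder hm hn hy]
    push_cast at hj ⊢
    rw [div_le_iff₀ hn'] at hj
    rw [div_le_iff₀ (by positivity)]
    linarith

end Comparison

/-! ### Existence of the minima -/

section Minima

theorem HasFixedVector.mono {G V : Type*} [Group G] [AddCommGroup V] [Module ℂ V]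
    {π : Representation ℂ G V} {H K : Subgroup G} (h : HasFixedVector π K) (hHK : H ≤ K) :
    HasFixedVector π H := by
  obtain ⟨v, hv, hK⟩ := h
  exact ⟨v, hv, fun g hg => hK g (hHK hg)⟩

/-- If the sets `P 0 ⊇ P 1 ⊇ ⋯` are cofinal among the neighbourhoods of `0`, then so are the sets
of functions with values in `P k`. -/
theorem exists_pi_subset_of_mem_nhds {ι X : Type*} [Finite ι] [TopologicalSpace X] [Zero X]
    {P : ℕ → Set X} (hanti : Antitone P) (hP : ∀ U ∈ nhds (0 : X), ∃ k, P k ⊆ U)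
    {U : Set (ι → X)} (hU : U ∈ nhds 0) : ∃ k, {f : ι → X | ∀ i, f i ∈ P k} ⊆ U := by
  rw [nhds_pi, Filter.mem_pi] at hU
  obtain ⟨I, -, t, ht, hsub⟩ := hU
  choose k hk using fun i => hP _ (ht i)
  obtain ⟨K, hK⟩ := (Set.finite_range k).bddAbove
  exact ⟨K, fun f hf => hsub fun i _ => hk i (hanti (hK ⟨i, rfl⟩) (hf i))⟩

variable {F : Type*} [Field F] [ValuativeRel F] [TopologicalSpace F] [IsNonarchimedeanLocalField F]
variable {D : Type*} [DivisionRing D] [Algebra F D] [FiniteDimensional F D] {m : ℕ}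

theorem exists_stdLattice_subset_of_mem_nhds [TopologicalSpace D] [IsModuleTopology F D]
    {U : Set (Matrix (Fin m) (Fin m) D)} (hU : U ∈ nhds 1) :
    ∃ k : ℕ, ∀ a, a - 1 ∈ stdLattice F (1 : (Matrix (Fin m) (Fin m) D)ˣ) 1 0 k → a ∈ U := by
  have := IsModuleTopology.toContinuousAdd F D
  have hcont : Continuous fun a : Matrix (Fin m) (Fin m) D => a + 1 :=
    continuous_id.add continuous_const
  have hU' : (fun a : Matrix (Fin m) (Fin m) D => a + 1) ⁻¹' U ∈ nhds 0 :=
    hcont.continuousAt.preimage_mem_nhds (by simpa using hU)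
  have hanti : Antitone fun k : ℕ => {a : D | valGE F 1 0 k a} := fun k l hkl a ha =>
    valGE_mono ha (by omega)
  have hanti' : Antitone fun k : ℕ => {f : Fin m → D | ∀ i, f i ∈ {a : D | valGE F 1 0 k a}} :=
    fun k l hkl f hf i => hanti hkl (hf i)
  obtain ⟨k, hk⟩ := exists_pi_subset_of_mem_nhds (ι := Fin m) hanti'
    (fun V hV => exists_pi_subset_of_mem_nhds hanti
      (fun W hW => exists_valGE_subset_of_mem_nhds (F := F) hW) hV) hU'
  refine ⟨k, fun a ha => ?_⟩
  have h1 : a - 1 ∈ (fun a : Matrix (Fin m) (Fin m) D => a + 1) ⁻¹' U := hk fun i j => by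
    have := ha i j
    rw [coord_one_left] at this
    exact valGE_mono this (by simp)
  simpa using h1

/-- The groups `U^{j+1}` of the maximal order `M_m(𝔬_D)` form a basis of neighbourhoods of `1`. -/
theorem exists_U_le_of_isOpen [TopologicalSpace D] [IsModuleTopology F D]
    {K : Subgroup (Matrix (Fin m) (Fin m) D)ˣ} (hK : IsOpen (K : Set (Matrix (Fin m) (Fin m) D)ˣ)) :
    ∃ j, U (stdOrder F (1 : (Matrix (Fin m) (Fin m) D)ˣ) 1 0) (j + 1) ≤ K := by
  have hy : ∀ k : ℤ, 0 < m → ∃ i : Fin m, ((1 : ℕ) : ℤ) ∣ k - (0 : Fin m → ℤ) i := fun k hm =>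
    ⟨⟨0, hm⟩, by simp⟩
  rcases Nat.eq_zero_or_pos m with rfl | hm
  · refine ⟨0, fun u _ => ?_⟩
    rw [show u = 1 from Units.ext (Subsingleton.elim _ _)]
    exact one_mem _
  have h1 : (K : Set (Matrix (Fin m) (Fin m) D)ˣ) ∈ nhds 1 := hK.mem_nhds (one_mem K)
  rw [Units.isEmbedding_embedProduct.nhds_eq_comap, Filter.mem_comap] at h1
  obtain ⟨T, hT, hTK⟩ := h1
  rw [map_one, Prod.one_eq_mk, mem_nhds_prod_iff] at hT
  obtain ⟨A, hA, B, hB, hAB⟩ := hT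
  rw [← MulOpposite.op_one, ← MulOpposite.map_op_nhds, Filter.mem_map] at hB
  obtain ⟨k, hk⟩ := exists_stdLattice_subset_of_mem_nhds (F := F) hA
  obtain ⟨l, hl⟩ := exists_stdLattice_subset_of_mem_nhds (F := F) hB
  refine ⟨max k l, fun u hu => hTK (hAB ⟨hk _ ?_, hl _ ?_⟩)⟩
  · rw [mem_U_stdOrder fun k => hy k hm] at hu
    exact stdLattice_anti (by push_cast; omega) hu
  · have hu := inv_mem hu
    rw [mem_U_stdOrder fun k => hy k hm] at hu
    exact stdLattice_anti (by push_cast; omega) hu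

theorem HitsResidues.le {n : ℕ} {y : Fin m → ℤ} (hy : HitsResidues n y) : n ≤ m := by
  choose i hi using hy
  have hinj : Function.Injective fun k : Fin n => i (k : ℤ) := fun k l hkl => by
    simp only at hkl
    have h1 := hi k
    rw [hkl] at h1
    have h2 := dvd_sub h1 (hi l)
    rw [sub_sub_sub_cancel_right] at h2
    have h3 := Int.eq_zero_of_abs_lt_dvd h2 (by rw [abs_lt]; omega)
    exact Fin.ext (by omega)
  simpa using Fintype.card_le_of_injective _ hinj

theorem normalizedLevelSet_nonempty [TopologicalSpace D] [IsModuleTopology F D]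
    {V : Type*} [AddCommGroup V] [Module ℂ V] [Nontrivial V]
    {π : Representation ℂ (Matrix (Fin m) (Fin m) D)ˣ V} (hπ : IsSmoothRep π) :
    (normalizedLevelSet F π).Nonempty := by
  obtain ⟨v, hv⟩ := exists_ne (0 : V)
  obtain ⟨K, hK, hfix⟩ := hπ v
  obtain ⟨j, hj⟩ := exists_U_le_of_isOpen (F := F) hK
  exact ⟨_, _, j, isHereditaryOrder_stdOrder one_pos, ⟨v, hv, fun g hg => hfix g (hj hg)⟩, rfl⟩

/-- All levels lie in `(1/N) ℤ` for `N = (m E)!`, since `e` is at most `m E`. -/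
theorem exists_isLeast_normalizedLevelSet (hm : 0 < m) {V : Type*} [AddCommGroup V] [Module ℂ V]
    {π : Representation ℂ (Matrix (Fin m) (Fin m) D)ˣ V} (hne : (normalizedLevelSet F π).Nonempty) :
    ∃ r, IsLeast (normalizedLevelSet F π) r := by
  classical
  set N := (m * ramD F D).factorial
  have hN : (0 : ℝ) < N := by exact_mod_cast Nat.factorial_pos _
  have hmem : ∀ r ∈ normalizedLevelSet F π, ∃ a : ℕ, r = (a : ℝ) / N := by
    rintro r ⟨𝔄, j, h𝔄, -, rfl⟩
    obtain ⟨g, n, y, hn, hy, rfl⟩ := h𝔄.exists_eq_stdOrder hm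
    rw [ramificationIndex_stdOrder hm hn hy]
    have hpos : 0 < n * ramD F D := Nat.mul_pos hn (by exact_mod_cast ramD_pos (F := F) (D := D))
    obtain ⟨b, hb⟩ : n * ramD F D ∣ N :=
      Nat.dvd_factorial hpos (Nat.mul_le_mul_right _ hy.le)
    have hpos' : ((n * ramD F D : ℕ) : ℝ) ≠ 0 := by exact_mod_cast hpos.ne'
    refine ⟨j * b, ?_⟩
    rw [div_eq_div_iff hpos' hN.ne', hb]
    push_cast
    ring
  have hex : ∃ a : ℕ, (a : ℝ) / N ∈ normalizedLevelSet F π := by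
    obtain ⟨r, hr⟩ := hne
    obtain ⟨a, rfl⟩ := hmem r hr
    exact ⟨a, hr⟩
  refine ⟨_, Nat.find_spec hex, fun r hr => ?_⟩
  obtain ⟨a, rfl⟩ := hmem r hr
  have : Nat.find hex ≤ a := Nat.find_min' hex hr
  gcongr

/-- The least normalized level is also the least Moy--Prasad depth, by the inclusions between the
two kinds of groups in both directions. -/
theorem isLeast_moyPrasadDepthSet (hm : 0 < m) {V : Type*} [AddCommGroup V] [Module ℂ V]
    {π : Representation ℂ (Matrix (Fin m) (Fin m) D)ˣ V} {r : ℝ}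
    (hr : IsLeast (normalizedLevelSet F π) r) : IsLeast (moyPrasadDepthSet F π) r := by
  refine ⟨?_, ?_⟩
  · obtain ⟨𝔄, j, h𝔄, hfix, rfl⟩ := hr.1
    obtain ⟨x, hx⟩ := h𝔄.exists_moyPrasadPlus_le hm j
    exact ⟨by positivity, x, hfix.mono hx⟩
  · rintro s ⟨hs, x, hfix⟩
    obtain ⟨𝔄, j, h𝔄, hle, hjs⟩ := exists_U_le_moyPrasadPlus hm x hs
    exact (hr.2 ⟨𝔄, j, h𝔄, hfix.mono hle, rfl⟩).trans hjs

end Minima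

end DepthGL

theorem mainTheorem9
    {F : Type*} [Field F] [ValuativeRel F] [TopologicalSpace F] [IsNonarchimedeanLocalField F]
    {D : Type*} [DivisionRing D] [Algebra F D] [Algebra.IsCentral F D] [FiniteDimensional F D]
    [TopologicalSpace D] [IsModuleTopology F D]
    (m : ℕ) (hm : 0 < m)
    {V : Type*} [AddCommGroup V] [Module ℂ V]
    (π : Representation ℂ (Matrix (Fin m) (Fin m) D)ˣ V)
    (hsmooth : DepthGL.IsSmoothRep π) (hirr : π.IsIrreducible) :
    IsLeast (DepthGL.normalizedLevelSet F π) (DepthGL.normalizedLevel F π) ∧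
    IsLeast (DepthGL.moyPrasadDepthSet F π) (DepthGL.moyPrasadDepth F π) ∧
    DepthGL.normalizedLevel F π = DepthGL.moyPrasadDepth F π := by
  have : Nontrivial V := by
    have := (Representation.irreducible_iff_isSimpleModule_asModule π).1 hirr
    exact IsSimpleModule.nontrivial (MonoidAlgebra ℂ (Matrix (Fin m) (Fin m) D)ˣ) π.asModule
  obtain ⟨r, hr⟩ := DepthGL.exists_isLeast_normalizedLevelSet hm
    (DepthGL.normalizedLevelSet_nonempty (F := F) hsmooth)
  have hr' := DepthGL.isLeast_moyPrasadDepthSet hm hr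
  rw [DepthGL.normalizedLevel, DepthGL.moyPrasadDepth, hr.csInf_eq, hr'.csInf_eq]
  exact ⟨hr, hr', rfl⟩
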